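/- Let $k$ be an algebraically closed field and let $\mathcal C$ be a $k$-linear category with finitely many objects and finite-dimensional morphism spaces which is directed: there is a partial order $\leqslant$ on $\mathrm{Ob}\,\mathcal C$ such that $\mathcal C(x,y)\ne 0$ only if $x\leqslant y$. We identify $\mathcal C$ with its associated algebra $\bigoplus_{x,y}\mathcal C(x,y)$ (the product $\beta\alpha$ is the composite if it is defined and $0$ otherwise); modules are left modules over this algebra. Suppose $\mathcal C$ is graded, $\mathcal C=\bigoplus_{i\ge 0}\mathcal C_i$ with $\mathcal C_i=\bigoplus_{x,y}\mathcal C(x,y)_i$, $\mathcal C_i\cdot\mathcal C_j=\mathcal C_{i+j}$ for all $i,j\geq 0$, and $\mathcal C_0=\bigoplus_{x}\mathcal C(x,x)$, and that $\mathcal C_0$ is self-injective, i.e. injective as a left module over itself. Graded modules $M=\bigoplus_{j\in\mathbb Z}M_j$ are assumed locally finite ($\dim_k M_j<\infty$ for all $j$); $M$ is generated in degree $s$ if $M=\mathcal C\cdot M_s$. View $\mathcal C_0=\mathcal C/\bigoplus_{i\ge 1}\mathcal C_i$ as a graded $\mathcal C$-module concentrated in degree $0$. For each object $x$ choose a complete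 set $E_x$ of orthogonal primitive idempotents of $\mathcal C(x,x)$. Let $\Lambda$ index $\bigsqcup_x E_x$, with the canonical pre-order: for $e_\lambda\in E_x$ and $e_\mu\in E_y$, $\lambda\preceq\mu$ iff $x\leqslant y$. Put $P_\lambda=\mathcal C e_\lambda$ and $\Delta_\lambda=P_\lambda/\sum_{\mu\not\preceq\lambda}\mathrm{tr}_{P_\mu}(P_\lambda)$, where $\mathrm{tr}_{P}(M)$ is the sum of the images of all homomorphisms $P\to M$. Call $\mathcal C$ *standardly stratified* (for $\preceq$) if every $P_\lambda$ has a finite filtration by submodules all of whose successive quotients are isomorphic to standard modules $\Delta_\mu$. A graded module $M$ generated in degree $0$ is *Koszul* if it has a graded projective resolution $\cdots\to P^1\to P^0\to M\to 0$ with $P^i$ generated in degree $i$ for all $i\ge 0$. A module $M$ is *quasi-Koszul* if $\mathrm{Ext}^1_{\mathcal C}(\mathcal C_0,\mathcal C_0)\cdot\mathrm{Ext}^i_{\mathcal C}(M,\mathcal C_0)=\mathrm{Ext}^{i+1}_{\mathcal C}(M,\mathcal C_0)$ for all $i\geq 0$ (span of Yoneda products). The category $\mathcal C$ is *Koszul*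 (resp. *quasi-Koszul*) if the module $\mathcal C_0$ is. Then, for every choice of the sets $E_x$: 1. $\mathcal C$ is standardly stratified if and only if $\mathcal C$ is a projective $\mathcal C_0$-module. 2. $\mathcal C$ is Koszul if and only if $\mathcal C$ is standardly stratified and quasi-Koszul. 3. If $\mathcal C$ is standardly stratified, then a graded $\mathcal C$-module $M$ generated in degree $0$ is Koszul if and only if it is quasi-Koszul and projective as a $\mathcal C_0$-module. -/

import Mathlib

open CategoryTheory

universe w v u

noncomputable section

namespace KoszulStrat

/-! ## Graded algebras and their Koszul theory

`𝒜` is a non-negative grading of the `k`-algebra `A`; all modules are left modules. -/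

section GradedAlgebra

variable {k : Type w} {A : Type u} [Field k] [Ring A] [Algebra k A]

/-- The degree zero subalgebra `A₀` of `A`. Every `A`-module is an `A₀`-module by restriction. -/
abbrev degreeZero (𝒜 : ℕ → Submodule k A) [GradedAlgebra 𝒜] : Subalgebra k A :=
  SetLike.GradeZero.subalgebra 𝒜

/-- The ideal `J = ⨁_{i ≥ 1} Aᵢ`. -/
abbrev positiveIdeal (𝒜 : ℕ → Submodule k A) [GradedAlgebra 𝒜] : Ideal A :=
  (HomogeneousIdeal.irrelevant 𝒜).toIdeal

/-- `A₀` viewed as a left `A`-module, i.e. `A / J`. -/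
abbrev ZeroModule (𝒜 : ℕ → Submodule k A) [GradedAlgebra 𝒜] : Type u :=
  A ⧸ positiveIdeal 𝒜

/-- Locally finite `ℤ`-graded left modules `M = ⨁ Mⱼ` over the graded algebra `A`. -/
structure GrMod (𝒜 : ℕ → Submodule k A) where
  carrier : Type u
  [addCommGroup : AddCommGroup carrier]
  [moduleBase : Module k carrier]
  [module : Module A carrier]
  [isScalarTower : IsScalarTower k A carrier]
  /-- the homogeneous components -/
  gr : ℤ → Submodule k carrier
  isInternal : DirectSum.IsInternal gr
  smul_mem : ∀ (i : ℕ) (j : ℤ) (a : A) (m : carrier),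
    a ∈ 𝒜 i → m ∈ gr j → a • m ∈ gr ((i : ℤ) + j)
  finite : ∀ j, FiniteDimensional k (gr j)

instance (𝒜 : ℕ → Submodule k A) : CoeSort (GrMod 𝒜) (Type u) := ⟨GrMod.carrier⟩

attribute [instance] GrMod.addCommGroup GrMod.moduleBase GrMod.module GrMod.isScalarTower

/-- `M` is generated in degree `s`: `M = A · Mₛ`. -/
def GeneratedInDegree {𝒜 : ℕ → Submodule k A} (M : GrMod 𝒜) (s : ℤ) : Prop :=
  Submodule.span A (M.gr s : Set M) = ⊤

/-- The `A`-linear map `f` is homogeneous of degree zero. -/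
def IsHomogeneousMap {𝒜 : ℕ → Submodule k A} {M N : GrMod 𝒜} (f : M →ₗ[A] N) : Prop :=
  ∀ (j : ℤ) (m : M), m ∈ M.gr j → f m ∈ N.gr j

/-- `M` is a Koszul module: it is generated in degree `0` and has a graded projective resolution
`⋯ → P 2 → P 1 → P 0 → M → 0` such that `P n` is generated in degree `n`. -/
def IsKoszulModule {𝒜 : ℕ → Submodule k A} (M : GrMod 𝒜) : Prop :=
  GeneratedInDegree M 0 ∧
  ∃ (P : ℕ → GrMod 𝒜) (d : ∀ n, P (n + 1) →ₗ[A] P n) (ε : P 0 →ₗ[A] M),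
    (∀ n, Module.Projective A (P n)) ∧
    (∀ n : ℕ, GeneratedInDegree (P n) n) ∧
    (∀ n, IsHomogeneousMap (d n)) ∧ IsHomogeneousMap ε ∧
    Function.Surjective ε ∧
    Function.Exact (d 0) ε ∧
    ∀ n, Function.Exact (d (n + 1)) (d n)

/-- `M` is quasi-Koszul: `Ext¹(A₀, A₀) · Extⁱ(M, A₀) = Extⁱ⁺¹(M, A₀)` for all `i ≥ 0`, where the
left-hand side is the additive span of all Yoneda products. -/
def IsQuasiKoszulModule (𝒜 : ℕ → Submodule k A) [GradedAlgebra 𝒜]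
    (M : Type u) [AddCommGroup M] [Module A M] : Prop :=
  ∀ i : ℕ, AddSubgroup.closure
    {z : Abelian.Ext.{u} (ModuleCat.of A M) (ModuleCat.of A (ZeroModule 𝒜)) (i + 1) |
      ∃ (x : Abelian.Ext.{u} (ModuleCat.of A M) (ModuleCat.of A (ZeroModule 𝒜)) i)
        (y : Abelian.Ext.{u} (ModuleCat.of A (ZeroModule 𝒜)) (ModuleCat.of A (ZeroModule 𝒜)) 1),
        z = x.comp y rfl} = ⊤

theorem mul_mem_positiveIdeal (𝒜 : ℕ → Submodule k A) [GradedAlgebra 𝒜] {a : A}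
    (ha : a ∈ positiveIdeal 𝒜) (b : A) : a * b ∈ positiveIdeal 𝒜 := by
  rw [positiveIdeal, HomogeneousIdeal.toIdeal_irrelevant, RingHom.mem_ker] at *
  rw [map_mul, ha, zero_mul]

/-- `A₀` viewed as a graded `A`-module concentrated in degree `0`. -/
def zeroGrMod (𝒜 : ℕ → Submodule k A) [GradedAlgebra 𝒜] [FiniteDimensional k A] :
    GrMod 𝒜 where
  carrier := ZeroModule 𝒜
  gr j := if j = 0 then ⊤ else ⊥
  isInternal := by
    rw [DirectSum.isInternal_submodule_iff_iSupIndep_and_iSup_eq_top]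
    constructor
    · intro j
      rw [Submodule.disjoint_def]
      intro m hm hm'
      by_cases hj : j = 0
      · have hbot : (⨆ i, ⨆ (_ : i ≠ j), if i = (0 : ℤ) then (⊤ : Submodule k (ZeroModule 𝒜))
            else ⊥) = ⊥ := by
          simp only [iSup_eq_bot]
          intro i hi
          rw [if_neg (fun h => hi (h.trans hj.symm))]
        exact (Submodule.mem_bot k).1 (hbot ▸ hm')
      · simpa [hj] using hm
    · refine top_le_iff.1 (le_trans ?_ (le_iSup _ (0 : ℤ)))
      simp
  smul_mem := by
    intro i j a m ha hm
    by_cases hj : j = 0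
    · subst hj
      rcases Nat.eq_zero_or_pos i with hi | hi
      · subst hi
        simp
      · have h0 : a • m = 0 := by
          obtain ⟨b, rfl⟩ := Submodule.Quotient.mk_surjective _ m
          rw [← Submodule.Quotient.mk_smul, Submodule.Quotient.mk_eq_zero]
          exact mul_mem_positiveIdeal 𝒜 (HomogeneousIdeal.mem_irrelevant_of_mem 𝒜 hi ha) b
        rw [h0]
        exact zero_mem _
    · rw [if_neg hj, Submodule.mem_bot] at hm
      rw [hm, smul_zero]
      exact zero_mem _
  finite j := inferInstance

/-- The graded algebra `A` is Koszul: `A₀` is a Koszul `A`-module. -/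
def IsKoszulAlgebra (𝒜 : ℕ → Submodule k A) [GradedAlgebra 𝒜] [FiniteDimensional k A] : Prop :=
  IsKoszulModule (zeroGrMod 𝒜)

/-- The graded algebra `A` is quasi-Koszul: `A₀` is a quasi-Koszul `A`-module. -/
def IsQuasiKoszulAlgebra (𝒜 : ℕ → Submodule k A) [GradedAlgebra 𝒜] : Prop :=
  IsQuasiKoszulModule 𝒜 (ZeroModule 𝒜)

end GradedAlgebra

/-! ## The associated algebra of a linear category with finitely many objects -/

section AssociatedAlgebra

/-- The space `⨁_{x, y} C(x, y)` (for `C` with finitely many objects), whose elements are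
written as families `a x y : x ⟶ y`. -/
def CatAlg (C : Type u) [Category.{v} C] : Type (max u v) := ∀ x y : C, (x ⟶ y)

variable {C : Type u} [Category.{v} C] [Preadditive C]

instance : AddCommGroup (CatAlg C) := inferInstanceAs (AddCommGroup (∀ x y : C, (x ⟶ y)))

instance {k : Type w} [Field k] [Linear k C] : Module k (CatAlg C) :=
  inferInstanceAs (Module k (∀ x y : C, (x ⟶ y)))

namespace CatAlg

@[ext] theorem ext {C : Type u} [Category.{v} C] {a b : CatAlg C} (h : ∀ x y, a x y = b x y) : a = b :=
  funext fun x => funext fun y => h x y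

@[simp] theorem add_apply (a b : CatAlg C) (x y : C) : (a + b) x y = a x y + b x y := rfl

@[simp] theorem zero_apply (x y : C) : (0 : CatAlg C) x y = 0 := rfl

@[simp] theorem smul_apply {k : Type w} [Field k] [Linear k C] (c : k) (a : CatAlg C) (x y : C) :
    (c • a) x y = c • a x y := rfl

open Classical in
/-- The morphism `f : x ⟶ y` as an element of the associated algebra. -/
def ofHom {x y : C} (f : x ⟶ y) : CatAlg C := fun x' y' =>
  if h : x = x' ∧ y = y' then eqToHom h.1.symm ≫ f ≫ eqToHom h.2 else 0

open Classical in
instance : One (CatAlg C) := ⟨fun x y => if h : x = y then eqToHom h else 0⟩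

open Classical in
theorem one_apply (x y : C) : (1 : CatAlg C) x y = if h : x = y then eqToHom h else 0 := rfl

variable [Fintype C]

/-- The product `b * a` is "`b` after `a`": the product of `α : x ⟶ y` and `β : y ⟶ z` is
`β * α = α ≫ β`, and products of non-composable morphisms are zero. -/
instance : Mul (CatAlg C) := ⟨fun b a x z => ∑ y, a x y ≫ b y z⟩

theorem mul_apply (b a : CatAlg C) (x z : C) : (b * a) x z = ∑ y, a x y ≫ b y z := rfl

instance : Ring (CatAlg C) :=
  { (inferInstance : AddCommGroup (CatAlg C)) with
    mul := (· * ·)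
    one := 1
    left_distrib := by
      intro a b c; ext x z; simp [mul_apply, Preadditive.add_comp, Finset.sum_add_distrib]
    right_distrib := by
      intro a b c; ext x z; simp [mul_apply, Preadditive.comp_add, Finset.sum_add_distrib]
    zero_mul := by intro a; ext x z; simp [mul_apply]
    mul_zero := by intro a; ext x z; simp [mul_apply]
    mul_assoc := by
      intro a b c; ext x z
      simp only [mul_apply, Preadditive.sum_comp, Preadditive.comp_sum, Category.assoc]
      exact Finset.sum_comm
    one_mul := by
      intro a; ext x z
      rw [mul_apply, Finset.sum_eq_single z]
      · simp [one_apply]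
      · intro y _ hy; simp [one_apply, hy]
      · simp
    mul_one := by
      intro a; ext x z
      rw [mul_apply, Finset.sum_eq_single x]
      · simp [one_apply]
      · intro y _ hy; simp [one_apply, hy.symm]
      · simp }

variable {k : Type w} [Field k] [Linear k C]

instance : Algebra k (CatAlg C) :=
  Algebra.ofModule
    (by intro r a b; ext x z; simp [mul_apply, Finset.smul_sum])
    (by intro r a b; ext x z; simp [mul_apply, Finset.smul_sum])

instance [∀ x y : C, FiniteDimensional k (x ⟶ y)] : FiniteDimensional k (CatAlg C) :=
  inferInstanceAs (FiniteDimensional k (∀ x y : C, (x ⟶ y)))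

theorem eq_sum_ofHom (a : CatAlg C) : a = ∑ x, ∑ y, ofHom (a x y) := by
  have h : ∀ (s : Finset C) (f : C → CatAlg C) (x y : C), (∑ i ∈ s, f i) x y = ∑ i ∈ s, f i x y := by
    intro s f x y
    induction s using Finset.cons_induction with
    | empty => rfl
    | cons i s hi ih => rw [Finset.sum_cons, Finset.sum_cons, add_apply, ih]
  ext x y
  rw [h, Finset.sum_eq_single x, h, Finset.sum_eq_single y]
  · simp [ofHom]
  · intro y' _ hy; simp [ofHom, hy]
  · simp
  · intro x' _ hx
    rw [h]
    exact Finset.sum_eq_zero fun y' _ => by simp [ofHom, hx]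
  · simp

end CatAlg

end AssociatedAlgebra

/-! ## Directed categories, gradings -/

section Directed

/-- `C` is directed with respect to the partial order `le` on its objects:
`C(x, y) ≠ 0` only if `x ≤ y`. -/
def DirectedWrt {C : Type u} [Category.{v} C] [Preadditive C] (le : C → C → Prop) : Prop :=
  ∀ (x y : C) (f : x ⟶ y), f ≠ 0 → le x y

variable (k : Type w) [Field k] (C : Type u) [Category.{v} C] [Preadditive C] [Linear k C]
  [Fintype C]

variable {k C} in
/-- For subspaces `gr x y` of the `C(x, y)`, the subspace `⨁_{x, y} gr x y` of the
associated algebra. -/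
def totalPart (gr : ∀ x y : C, Submodule k (x ⟶ y)) : Submodule k (CatAlg C) where
  carrier := {a | ∀ x y, a x y ∈ gr x y}
  add_mem' := fun ha hb x y => add_mem (ha x y) (hb x y)
  zero_mem' := fun _ _ => zero_mem _
  smul_mem' := fun c _ ha x y => (gr x y).smul_mem c (ha x y)

/-- A non-negative grading of the morphism spaces of `C` with `Cᵢ · Cⱼ = Cᵢ₊ⱼ` and
`C₀ = ⨁ₓ C(x, x)`, where `Cᵢ = ⨁_{x, y} C(x, y)ᵢ`. -/
structure CatGrading where
  gr : ℕ → ∀ x y : C, Submodule k (x ⟶ y)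
  isInternal : ∀ x y, DirectSum.IsInternal (fun i => gr i x y)
  mul_eq : ∀ i j : ℕ, totalPart (gr i) * totalPart (gr j) = totalPart (gr (i + j))
  zero_self : ∀ x : C, gr 0 x x = ⊤
  zero_ne : ∀ x y : C, x ≠ y → gr 0 x y = ⊥

variable {k C}

/-- The homogeneous component `Cᵢ` of the associated algebra. -/
def CatGrading.part (G : CatGrading k C) (i : ℕ) : Submodule k (CatAlg C) :=
  totalPart (G.gr i)

theorem CatGrading.part_isInternal (G : CatGrading k C) : DirectSum.IsInternal G.part := by
  rw [DirectSum.isInternal_submodule_iff_iSupIndep_and_iSup_eq_top]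
  constructor
  · rw [iSupIndep_def]
    intro i
    rw [Submodule.disjoint_def]
    intro a ha hb
    ext x y
    have hd := (G.isInternal x y).submodule_iSupIndep i
    rw [Submodule.disjoint_def] at hd
    refine hd (a x y) (ha x y) ?_
    let p : CatAlg C →ₗ[k] (x ⟶ y) :=
      { toFun := fun b => b x y, map_add' := fun _ _ => rfl, map_smul' := fun _ _ => rfl }
    have hle : (⨆ j, ⨆ (_ : j ≠ i), G.part j) ≤
        Submodule.comap p (⨆ j, ⨆ (_ : j ≠ i), G.gr j x y) := by
      refine iSup₂_le fun j hj b hbj => ?_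
      exact (le_iSup₂ (f := fun j (_ : j ≠ i) => G.gr j x y) j hj) (hbj x y)
    exact hle hb
  · rw [eq_top_iff]
    intro a _
    rw [CatAlg.eq_sum_ofHom a]
    refine Submodule.sum_mem _ fun x _ => Submodule.sum_mem _ fun y _ => ?_
    let q : (x ⟶ y) →ₗ[k] CatAlg C :=
      { toFun := fun f => CatAlg.ofHom f
        map_add' := by
          intro f g; ext x' y'
          simp only [CatAlg.ofHom, CatAlg.add_apply]
          split_ifs with h
          · simp
          · simp
        map_smul' := by
          intro c f; ext x' y'
          simp only [CatAlg.ofHom, CatAlg.smul_apply, RingHom.id_apply]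
          split_ifs with h
          · simp
          · simp }
    have htop : (⊤ : Submodule k (x ⟶ y)) ≤ Submodule.comap q (⨆ i, G.part i) := by
      rw [← (G.isInternal x y).submodule_iSup_eq_top]
      refine iSup_le fun i f hf => Submodule.mem_iSup_of_mem i ?_
      intro x' y'
      change CatAlg.ofHom f x' y' ∈ G.gr i x' y'
      simp only [CatAlg.ofHom]
      split_ifs with h
      · obtain ⟨rfl, rfl⟩ := h
        simpa using hf
      · exact zero_mem _
    exact htop (Submodule.mem_top (x := a x y))

instance (G : CatGrading k C) : SetLike.GradedMonoid G.part where
  one_mem := by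
    intro x y
    rw [CatAlg.one_apply]
    split_ifs with h
    · subst h
      rw [G.zero_self]
      exact Submodule.mem_top
    · exact zero_mem _
  mul_mem := by
    intro i j a b ha hb
    change a * b ∈ totalPart (G.gr (i + j))
    rw [← G.mul_eq]
    exact Submodule.mul_mem_mul ha hb

instance (G : CatGrading k C) : GradedAlgebra G.part :=
  { (inferInstance : SetLike.GradedMonoid G.part), G.part_isInternal.chooseDecomposition with }

end Directed

/-! ## Standard modules and standard stratification -/

section Stratification

/-- A primitive idempotent: nonzero and not a sum of two nonzero orthogonal idempotents. -/
def IsPrimitiveIdempotent {R : Type u} [Ring R] (e : R) : Prop :=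
  IsIdempotentElem e ∧ e ≠ 0 ∧
    ∀ a b : R, IsIdempotentElem a → IsIdempotentElem b → a * b = 0 → b * a = 0 → a + b = e →
      a = 0 ∨ b = 0

/-- The trace of `P` in `M`: the sum of the images of all homomorphisms `P → M`. -/
def traceSubmodule (A : Type u) [Ring A] (P M : Type v) [AddCommGroup P] [Module A P]
    [AddCommGroup M] [Module A M] : Submodule A M :=
  ⨆ f : P →ₗ[A] M, LinearMap.range f

/-- For every object `x`, a complete set `E_x` of orthogonal primitive idempotents
of the algebra `C(x, x)`. -/
structure PrimitiveSystem (C : Type u) [Category.{v} C] [Preadditive C] where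
  idem : ∀ x : C, Finset (End x)
  primitive : ∀ x, ∀ e ∈ idem x, IsPrimitiveIdempotent e
  ortho : ∀ x, ∀ e ∈ idem x, ∀ f ∈ idem x, e ≠ f → e * f = 0
  sum_eq_one : ∀ x, ∑ e ∈ idem x, e = 1

variable {C : Type u} [Category.{v} C] [Preadditive C] [Fintype C]

/-- The index set `Λ` of all chosen primitive idempotents. -/
def PrimitiveSystem.Index (E : PrimitiveSystem C) : Type (max u v) :=
  Σ x : C, {e : End x // e ∈ E.idem x}

/-- The canonical pre-order on `Λ`: `e ∈ E_x` precedes `f ∈ E_y` iff `x ≤ y`. -/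
def PrimitiveSystem.preceq (E : PrimitiveSystem C) (le : C → C → Prop) (l m : E.Index) : Prop :=
  le l.1 m.1

/-- The indecomposable projective module `P_l = C · e_l`. -/
def PrimitiveSystem.proj (E : PrimitiveSystem C) (l : E.Index) : Submodule (CatAlg C) (CatAlg C) :=
  Submodule.span (CatAlg C) {CatAlg.ofHom (l.2.1 : l.1 ⟶ l.1)}

/-- The standard module
`Δ_l = P_l / ∑_{m ⋠ l} tr_{P_m} (P_l)`. -/
abbrev PrimitiveSystem.Standard (E : PrimitiveSystem C) (le : C → C → Prop) (l : E.Index) :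
    Type (max u v) :=
  E.proj l ⧸ (⨆ (m : E.Index) (_ : ¬ E.preceq le m l),
    traceSubmodule (CatAlg C) (E.proj m) (E.proj l))

/-- `M` has a finite filtration `0 = F 0 ≤ F 1 ≤ ⋯ ≤ F n = M` by submodules such that each
`F (i + 1) / F i` is isomorphic to a standard module. -/
def HasStandardFiltration (E : PrimitiveSystem C) (le : C → C → Prop)
    (M : Type (max u v)) [AddCommGroup M] [Module (CatAlg C) M] : Prop :=
  ∃ (n : ℕ) (F : ℕ → Submodule (CatAlg C) M), F 0 = ⊥ ∧ F n = ⊤ ∧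
    (∀ i < n, F i ≤ F (i + 1)) ∧
    ∀ i < n, ∃ l : E.Index,
      Nonempty ((F (i + 1) ⧸ (F i).submoduleOf (F (i + 1))) ≃ₗ[CatAlg C] E.Standard le l)

/-- `C` is standardly stratified for the canonical pre-order: every indecomposable
projective module `P_l` has a filtration by standard modules. -/
def IsStandardlyStratified (le : C → C → Prop) (E : PrimitiveSystem C) : Prop :=
  ∀ l : E.Index, HasStandardFiltration E le (E.proj l)

end Stratification

end KoszulStrat

end

noncomputable section

set_option linter.unusedSectionVars false

/-! Write `A` for the associated algebra, `A₀` for its degree zero part and `J` for the ideal of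
positive degree.

Stratification. Since `A₀` contains all endomorphisms, `J` consists of the elements with zero
diagonal entries. Directedness then identifies the trace submodule of `P_l` with its positive part
(`PrimitiveSystem.iSup_trace_eq`), so `Δ_l` is `A₀ e_l`, with `J` acting by zero. Standard modules
are thus projective over `A₀`, and filtrations by them split over `A₀`. Conversely, if `A` is
projective over `A₀`, the degree layers `A_j e_l` of `P_l` are finitely generated projective
`A₀`-modules killed by `J`, and standard modules are split off them one at a time
(`StandardChain.extend`).

From Koszul to quasi-Koszul. For a cover `P → M` with kernel `Ω ≤ J P`, dimension shifting turns the
degree zero quasi-Koszul condition into an extension property: every map `Ω → A₀` extends to `J P`.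
If `Ω` is generated one degree above `P`, self-injectivity of `A₀` supplies the extension
(`exists_extension_of_generated`). Projectivity over `A₀` follows degree by degree, because finitely
generated projective `A₀`-modules are injective and so the sequences `0 → Ω_j → P_j → M_j → 0` split
(`IsKoszulFrom.projective_comp`). For `M = A₀`, the cover also has `A` as a retract, which gives
projectivity of `A` itself (`projective_of_isKoszulAlgebra`).

From quasi-Koszul to Koszul. If `A` and `M` are projective over `A₀`, then `M` has a cover which is
an isomorphism in the generating degree. A generator of `Ω` in too high a degree would be detected
by a map `Ω → A₀`, since a self-injective artinian ring is a cogenerator. Such a map extends to `J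
P` and therefore kills `J² P`, which contains all these high degrees: a contradiction. The syzygy
inherits every hypothesis (`IsLinearCandidate.exists_syzygy`), and iteration builds the linear
resolution. -/

namespace KoszulStrat

/-! ### Primitive idempotents and self-injective artinian rings -/

section RingTheory

variable {R : Type u} [Ring R]

theorem projective_span_idempotent {e : R} (he : IsIdempotentElem e) :
    Module.Projective R (Submodule.span R {e}) := by
  let s : R →ₗ[R] Submodule.span R {e} :=
    LinearMap.toSpanSingleton R _ ⟨e, Submodule.mem_span_singleton_self e⟩
  refine Module.Projective.of_split (Submodule.subtype _) s ?_
  ext ⟨x, hx⟩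
  obtain ⟨a, rfl⟩ := Submodule.mem_span_singleton.1 hx
  simp [s, mul_assoc, he.eq]

theorem injective_span_idempotent [Module.Injective R R] {e : R} (he : IsIdempotentElem e) :
    Module.Injective R (Submodule.span R {e}) := by
  let s : R →ₗ[R] Submodule.span R {e} :=
    LinearMap.toSpanSingleton R _ ⟨e, Submodule.mem_span_singleton_self e⟩
  refine ⟨fun X Y _ _ _ _ f hf g => ?_⟩
  obtain ⟨h, hh⟩ := Module.Injective.out f hf ((Submodule.subtype _).comp g)
  refine ⟨s.comp h, fun x => ?_⟩
  have h1 : s (g x : R) = g x := by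
    ext
    obtain ⟨a, ha⟩ := Submodule.mem_span_singleton.1 (g x).2
    simp [s, ← ha, mul_assoc, he.eq]
  rw [LinearMap.comp_apply, hh]
  exact h1

/-- Fitting's lemma for the module generated by a primitive idempotent. -/
theorem IsPrimitiveIdempotent.isNilpotent_or_bijective [IsArtinianRing R] [IsNoetherianRing R]
    {e : R} (he : IsPrimitiveIdempotent e) (f : Module.End R (Submodule.span R {e})) :
    IsNilpotent f ∨ Function.Bijective f := by
  obtain ⟨n, hn, hn0⟩ :=
    (f.eventually_isCompl_ker_pow_range_pow.and (Filter.eventually_ge_atTop 1)).exists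
  set K := LinearMap.ker (f ^ n) with hK
  set L := LinearMap.range (f ^ n) with hL
  let ee : Submodule.span R {e} := ⟨e, Submodule.mem_span_singleton_self e⟩
  have key : ∀ x : Submodule.span R {e}, (x : R) • ee = x := by
    rintro ⟨x, hx⟩
    obtain ⟨a, rfl⟩ := Submodule.mem_span_singleton.1 hx
    ext
    simp [ee, mul_assoc, he.1.eq]
  -- Split `e = u + v` along kernel and range. Both `u - u²` and `v - v²` lie in the kernel and in
  -- the range, hence vanish; so `u` and `v` are orthogonal idempotents and primitivity kills one of
  -- them.
  obtain ⟨u, hu, v, hv, huv⟩ := Submodule.mem_sup.1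
    (hn.sup_eq_top.symm ▸ Submodule.mem_top : ee ∈ K ⊔ L)
  have disj : ∀ x, x ∈ K → x ∈ L → x = 0 := fun x h1 h2 =>
    Submodule.disjoint_def.1 hn.disjoint x h1 h2
  have hab : (u : R) + v = e := congrArg Subtype.val huv
  have hau : u - (u : R) • u = (u : R) • v := by
    rw [sub_eq_iff_eq_add, add_comm, ← smul_add, huv, key]
  have hbv : v - (v : R) • v = (v : R) • u := by
    rw [sub_eq_iff_eq_add, ← smul_add, huv, key]
  have hz1 : (u : R) • v = 0 :=
    disj _ (hau ▸ K.sub_mem hu (K.smul_mem _ hu)) (L.smul_mem _ hv)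
  have hz2 : (v : R) • u = 0 :=
    disj _ (K.smul_mem _ hu) (hbv ▸ L.sub_mem hv (L.smul_mem _ hv))
  rw [hz1, sub_eq_zero] at hau
  rw [hz2, sub_eq_zero] at hbv
  have hcase := he.2.2 u v (congrArg Subtype.val hau).symm (congrArg Subtype.val hbv).symm
    (congrArg Subtype.val hz1) (congrArg Subtype.val hz2) hab
  have hgen : ∀ N : Submodule R (Submodule.span R {e}), ee ∈ N → N = ⊤ := fun N h =>
    eq_top_iff.2 fun x _ => key x ▸ N.smul_mem _ h
  rcases hcase with h | h
  · right
    have hu0 : u = 0 := Subtype.ext h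
    have hL' : L = ⊤ := hgen L (by rw [← huv, hu0, zero_add]; exact hv)
    have hK' : K = ⊥ := by simpa [hL'] using hn.inf_eq_bot
    constructor
    · rw [← LinearMap.ker_eq_bot, eq_bot_iff, ← hK', hK]
      obtain ⟨m, rfl⟩ := Nat.exists_eq_add_of_le hn0
      intro x hx
      rw [LinearMap.mem_ker] at hx ⊢
      rw [add_comm, pow_succ, Module.End.mul_apply, hx, map_zero]
    · rw [← LinearMap.range_eq_top, eq_top_iff, ← hL', hL]
      obtain ⟨m, rfl⟩ := Nat.exists_eq_add_of_le hn0
      rintro _ ⟨y, rfl⟩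
      rw [add_comm, pow_succ', Module.End.mul_apply]
      exact ⟨_, rfl⟩
  · left
    have hv0 : v = 0 := Subtype.ext h
    have hK' : K = ⊤ := hgen K (by rw [← huv, hv0, add_zero]; exact hu)
    exact ⟨n, LinearMap.ker_eq_top.1 hK'⟩

/-- Every power of `f` also fixes `p ≠ 0`, so `f` is not nilpotent and Fitting's lemma applies. This
gives uniqueness of projective covers; the primed version does the same for injective hulls. -/
theorem IsPrimitiveIdempotent.bijective_of_comp_eq [IsArtinianRing R] [IsNoetherianRing R]
    {e : R} (he : IsPrimitiveIdempotent e) {T : Type*} [AddCommGroup T] [Module R T]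
    (f : Module.End R (Submodule.span R {e})) (p : Submodule.span R {e} →ₗ[R] T) (hp : p ≠ 0)
    (h : p.comp f = p) : Function.Bijective f := by
  refine (he.isNilpotent_or_bijective f).resolve_left ?_
  rintro ⟨n, hn⟩
  have : ∀ m : ℕ, p.comp (f ^ m) = p := by
    intro m
    induction m with
    | zero => rfl
    | succ m ih => rw [pow_succ, Module.End.mul_eq_comp, ← LinearMap.comp_assoc, ih, h]
  exact hp (by rw [← this n, hn, LinearMap.comp_zero])

theorem IsPrimitiveIdempotent.bijective_of_comp_eq' [IsArtinianRing R] [IsNoetherianRing R]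
    {e : R} (he : IsPrimitiveIdempotent e) {T : Type*} [AddCommGroup T] [Module R T]
    (f : Module.End R (Submodule.span R {e})) (p : T →ₗ[R] Submodule.span R {e}) (hp : p ≠ 0)
    (h : f.comp p = p) : Function.Bijective f := by
  refine (he.isNilpotent_or_bijective f).resolve_left ?_
  rintro ⟨n, hn⟩
  have : ∀ m : ℕ, LinearMap.comp (f ^ m) p = p := by
    intro m
    induction m with
    | zero => rfl
    | succ m ih => rw [pow_succ, Module.End.mul_eq_comp, LinearMap.comp_assoc, h, ih]
  exact hp (by rw [← this n, hn, LinearMap.zero_comp])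

/-- Two simple quotients of the module generated by a primitive idempotent are isomorphic. -/
theorem IsPrimitiveIdempotent.ker_eq_of_simple [IsArtinianRing R] [IsNoetherianRing R]
    {e : R} (he : IsPrimitiveIdempotent e) {T T' : Type*} [AddCommGroup T] [Module R T]
    [AddCommGroup T'] [Module R T'] [IsSimpleModule R T] [IsSimpleModule R T']
    (p : Submodule.span R {e} →ₗ[R] T) (p' : Submodule.span R {e} →ₗ[R] T')
    (hp : p ≠ 0) (hp' : p' ≠ 0) : LinearMap.ker p = LinearMap.ker p' := by
  by_contra hne
  have hco := LinearMap.isCoatom_ker_of_surjective (LinearMap.surjective_of_ne_zero hp)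
  have hco' := LinearMap.isCoatom_ker_of_surjective (LinearMap.surjective_of_ne_zero hp')
  have hsup : LinearMap.ker p ⊔ LinearMap.ker p' = ⊤ := hco.sup_eq_top_of_ne hco' hne
  -- If the kernels differ, `p` is still onto when restricted to `ker p'`. Lifting `p` through this
  -- restriction gives an endomorphism with image in `ker p'` that fixes `p`; it is bijective, which
  -- forces `p' = 0`.
  have hs : Function.Surjective (p.comp (LinearMap.ker p').subtype) := by
    intro t
    obtain ⟨x, rfl⟩ := LinearMap.surjective_of_ne_zero hp t
    obtain ⟨u, hu, v, hv, rfl⟩ := Submodule.mem_sup.1 (hsup.symm ▸ Submodule.mem_top (x := x))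
    exact ⟨⟨v, hv⟩, by simp [LinearMap.mem_ker.1 hu]⟩
  have := projective_span_idempotent he.1
  obtain ⟨φ, hφ⟩ := Module.projective_lifting_property _ p hs
  have hb := he.bijective_of_comp_eq ((LinearMap.ker p').subtype.comp φ) p hp hφ
  apply hp'
  ext x
  obtain ⟨y, hy⟩ := hb.2 x
  rw [← hy]
  exact (φ y).2

variable {ι : Type*} [Fintype ι] {e : ι → R}

/-- Some `e i` acts nontrivially because they sum to `1`. When `T` is simple the map obtained is
onto. -/
theorem exists_simple_quotient_map (hsum : ∑ i, e i = 1) (T : Type*) [AddCommGroup T]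
    [Module R T] [Nontrivial T] : ∃ i, ∃ p : Submodule.span R {e i} →ₗ[R] T, p ≠ 0 := by
  obtain ⟨x, hx⟩ := exists_ne (0 : T)
  obtain ⟨i, hi⟩ : ∃ i, e i • x ≠ 0 := by
    by_contra! h
    apply hx
    rw [← one_smul R x, ← hsum, Finset.sum_smul]
    exact Finset.sum_eq_zero fun i _ => h i
  refine ⟨i, (LinearMap.toSpanSingleton R T x).comp (Submodule.subtype _), fun h => hi ?_⟩
  exact LinearMap.congr_fun h ⟨e i, Submodule.mem_span_singleton_self _⟩

/-- A nonzero finitely generated projective module has some `R e` as a retract. -/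
theorem exists_retract_of_projective [IsArtinianRing R] [IsNoetherianRing R]
    (he : ∀ i, IsPrimitiveIdempotent (e i)) (hsum : ∑ i, e i = 1)
    (Q : Type*) [AddCommGroup Q] [Module R Q] [Module.Finite R Q] [Module.Projective R Q]
    [Nontrivial Q] : ∃ i, ∃ (α : Submodule.span R {e i} →ₗ[R] Q)
      (β : Q →ₗ[R] Submodule.span R {e i}), β.comp α = LinearMap.id := by
  obtain ⟨N, hN, -⟩ := (eq_top_or_exists_le_coatom (⊥ : Submodule R Q)).resolve_left bot_ne_top
  have : IsSimpleModule R (Q ⧸ N) := isSimpleModule_iff_isCoatom.2 hN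
  have := IsSimpleModule.nontrivial R (Q ⧸ N)
  obtain ⟨i, p, hp⟩ := exists_simple_quotient_map hsum (Q ⧸ N)
  have := projective_span_idempotent (he i).1
  -- `Q` and `R e_i` cover the same simple module; lifting each cover through the other gives `β ∘
  -- α` fixing `p`, hence invertible.
  obtain ⟨α, hα⟩ := Module.projective_lifting_property N.mkQ p N.mkQ_surjective
  obtain ⟨β, hβ⟩ := Module.projective_lifting_property p N.mkQ
    (LinearMap.surjective_of_ne_zero hp)
  have hb : Function.Bijective (β.comp α) :=
    (he i).bijective_of_comp_eq (β.comp α) p hp (by rw [← LinearMap.comp_assoc, hβ, hα])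
  let c := LinearEquiv.ofBijective _ hb
  refine ⟨i, α, c.symm.toLinearMap.comp β, ?_⟩
  ext1 x
  exact c.symm_apply_apply x

/-- Over a self-injective artinian ring every simple module embeds in the ring. -/
theorem exists_simple_embedding [IsArtinianRing R] [IsNoetherianRing R] [Module.Injective R R]
    (he : ∀ i, IsPrimitiveIdempotent (e i)) (hsum : ∑ i, e i = 1)
    (T : Type*) [AddCommGroup T] [Module R T] [IsSimpleModule R T] :
    ∃ f : T →ₗ[R] R, f ≠ 0 := by
  classical
  have hnt : ∀ i, Nontrivial (Submodule.span R {e i}) := fun i => by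
    refine ⟨⟨e i, Submodule.mem_span_singleton_self _⟩, 0, fun h => (he i).2.1 ?_⟩
    exact congrArg Subtype.val h
  have hat : ∀ i, ∃ U : Submodule R (Submodule.span R {e i}), IsAtom U := fun i => by
    obtain ⟨U, hU, -⟩ := (eq_bot_or_exists_atom_le
      (⊤ : Submodule R (Submodule.span R {e i}))).resolve_left top_ne_bot
    exact ⟨U, hU⟩
  choose U hU using hat
  have hsimple : ∀ i, IsSimpleModule R (U i) := fun i => isSimpleModule_iff_isAtom.2 (hU i)
  have hnU : ∀ i, Nontrivial (U i) := fun i => IsSimpleModule.nontrivial R (U i)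
  -- The Nakayama permutation: `R e_{π i}` has the simple submodule `U i` of `R e_i` as a quotient.
  choose π p hp using fun i => exists_simple_quotient_map hsum (U i)
  let s : Setoid ι :=
    { r := fun i j => Nonempty (Submodule.span R {e i} ≃ₗ[R] Submodule.span R {e j})
      iseqv := ⟨fun _ => ⟨.refl _ _⟩, fun ⟨f⟩ => ⟨f.symm⟩, fun ⟨f⟩ ⟨g⟩ => ⟨f.trans g⟩⟩ }
  have iso : ∀ (j : ι) {T T' : Type _} [AddCommGroup T] [Module R T] [AddCommGroup T']
      [Module R T'] [IsSimpleModule R T] [IsSimpleModule R T']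
      (q : Submodule.span R {e j} →ₗ[R] T) (q' : Submodule.span R {e j} →ₗ[R] T')
      (_ : q ≠ 0) (_ : q' ≠ 0), Nonempty (T ≃ₗ[R] T') := by
    intro j T T' _ _ _ _ _ _ q q' hq hq'
    have hk := (he j).ker_eq_of_simple q q' hq hq'
    exact ⟨(q.quotKerEquivOfSurjective (LinearMap.surjective_of_ne_zero hq)).symm ≪≫ₗ
      Submodule.quotEquivOfEq _ _ hk ≪≫ₗ
      q'.quotKerEquivOfSurjective (LinearMap.surjective_of_ne_zero hq')⟩
  have hcomp : ∀ {i j : ι} {T : Type _} [AddCommGroup T] [Module R T]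
      (q : Submodule.span R {e i} →ₗ[R] T) (_ : q ≠ 0)
      (c : Submodule.span R {e j} ≃ₗ[R] Submodule.span R {e i}),
      q.comp c.toLinearMap ≠ 0 := by
    intro i j T _ _ q hq c h
    apply hq
    ext1 x
    have := LinearMap.congr_fun h (c.symm x)
    simpa using this
  have hπ : ∀ i j, s.r (π i) (π j) → s.r i j := by
    rintro i j ⟨c⟩
    obtain ⟨t⟩ := iso (π i) (p i) ((p j).comp c.toLinearMap) (hp i) (hcomp _ (hp j) c)
    have := injective_span_idempotent (he i).1
    have := injective_span_idempotent (he j).1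
    let g : U i →ₗ[R] Submodule.span R {e j} := (U j).subtype.comp t.toLinearMap
    have hg : Function.Injective g := (U j).injective_subtype.comp t.injective
    -- `R e_i` and `R e_j` are injective and contain isomorphic simple modules. The extensions in
    -- both directions have composites that fix a nonzero map, so they are isomorphisms.
    obtain ⟨φ, hφ⟩ := Module.Injective.extension_property R _ _ _ (U i).subtype
      (U i).injective_subtype g
    obtain ⟨ψ, hψ⟩ := Module.Injective.extension_property R _ _ _ g hg (U i).subtype
    have h1 : Function.Bijective (ψ.comp φ) := by
      refine (he i).bijective_of_comp_eq' (ψ.comp φ) (U i).subtype ?_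
        (by rw [LinearMap.comp_assoc, hφ, hψ])
      intro h
      obtain ⟨x, hx⟩ := exists_ne (0 : U i)
      exact hx (Subtype.ext (LinearMap.congr_fun h x))
    have h2 : Function.Bijective (φ.comp ψ) := by
      refine (he j).bijective_of_comp_eq' (φ.comp ψ) g ?_
        (by rw [LinearMap.comp_assoc, hψ, hφ])
      intro h
      obtain ⟨x, hx⟩ := exists_ne (0 : U i)
      exact hx (hg ((LinearMap.congr_fun h x).trans (map_zero g).symm))
    have h3 : Function.Bijective φ :=
      ⟨Function.Injective.of_comp (f := ψ) h1.1, Function.Surjective.of_comp (g := ψ) h2.2⟩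
    exact ⟨LinearEquiv.ofBijective φ h3⟩
  let πb : Quotient s → Quotient s := fun q => ⟦π q.out⟧
  have hinj : Function.Injective πb := by
    intro q q' h
    have := hπ _ _ (Quotient.exact h)
    rw [← q.out_eq, ← q'.out_eq]
    exact Quotient.sound this
  -- An injective self-map of the finite set of isomorphism classes is onto, so every simple module
  -- occurs as some `U i`.
  have hsurj := Finite.injective_iff_surjective.1 hinj
  have := IsSimpleModule.nontrivial R T
  obtain ⟨j, q, hq⟩ := exists_simple_quotient_map hsum T
  obtain ⟨x, hx⟩ := hsurj ⟦j⟧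
  obtain ⟨c⟩ : s.r (π x.out) j := Quotient.exact hx
  have hk := (he j).ker_eq_of_simple q ((p x.out).comp c.symm.toLinearMap) hq
    (hcomp _ (hp _) c.symm)
  let t : T ≃ₗ[R] U x.out := (q.quotKerEquivOfSurjective (LinearMap.surjective_of_ne_zero hq)).symm
    ≪≫ₗ Submodule.quotEquivOfEq _ _ hk ≪≫ₗ
      LinearMap.quotKerEquivOfSurjective _
        (LinearMap.surjective_of_ne_zero (hcomp _ (hp x.out) c.symm))
  refine ⟨(Submodule.subtype _).comp ((U x.out).subtype.comp t.toLinearMap), fun h => ?_⟩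
  obtain ⟨y, hy⟩ := exists_ne (0 : T)
  apply hy
  apply t.injective
  rw [map_zero]
  exact Subtype.ext (Subtype.ext (LinearMap.congr_fun h y))

/-- A self-injective artinian ring is a cogenerator. -/
theorem exists_linearMap_apply_ne_zero [IsArtinianRing R] [IsNoetherianRing R]
    [Module.Injective R R] (he : ∀ i, IsPrimitiveIdempotent (e i)) (hsum : ∑ i, e i = 1)
    {X : Type*} [AddCommGroup X] [Module R X] {x : X} (hx : x ≠ 0) :
    ∃ f : X →ₗ[R] R, f x ≠ 0 := by
  let xx : Submodule.span R {x} := ⟨x, Submodule.mem_span_singleton_self x⟩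
  have hgen : ∀ N : Submodule R (Submodule.span R {x}), xx ∈ N → N = ⊤ := by
    refine fun N h => eq_top_iff.2 ?_
    rintro ⟨y, hy⟩ -
    obtain ⟨a, rfl⟩ := Submodule.mem_span_singleton.1 hy
    exact N.smul_mem a h
  have : Nontrivial (Submodule.span R {x}) := ⟨xx, 0, fun h => hx (congrArg Subtype.val h)⟩
  obtain ⟨N, hN, -⟩ := (eq_top_or_exists_le_coatom
    (⊥ : Submodule R (Submodule.span R {x}))).resolve_left bot_ne_top
  have : IsSimpleModule R (Submodule.span R {x} ⧸ N) := isSimpleModule_iff_isCoatom.2 hN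
  -- A simple quotient of `R x` embeds in `R`; injectivity then extends the resulting map from `R x`
  -- to `X`, still nonzero at `x`.
  obtain ⟨f, hf⟩ := exists_simple_embedding he hsum (Submodule.span R {x} ⧸ N)
  obtain ⟨g, hg⟩ := Module.Injective.extension_property R _ _ _ (Submodule.span R {x}).subtype
    (Submodule.injective_subtype _) (f.comp N.mkQ)
  refine ⟨g, fun h => hf ?_⟩
  have hgx : (f.comp N.mkQ) xx = 0 := (LinearMap.congr_fun hg xx).symm.trans h
  have : LinearMap.ker (f.comp N.mkQ) = ⊤ := hgen _ hgx
  rw [LinearMap.ker_eq_top] at this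
  ext1
  exact this

end RingTheory

/-! ### Graded modules, their components and graded free modules -/

section Grading

variable {k : Type w} {A : Type u} [Field k] [Ring A] [Algebra k A] {𝒜 : ℕ → Submodule k A}

theorem isInternal_of_proj {V : Type*} [AddCommGroup V] [Module k V] (gr : ℤ → Submodule k V)
    (p : ℤ → V →ₗ[k] V) (hsame : ∀ j, ∀ m ∈ gr j, p j m = m)
    (hne : ∀ i j, i ≠ j → ∀ m ∈ gr i, p j m = 0) (htop : ∀ m, m ∈ ⨆ j, gr j) :
    DirectSum.IsInternal gr := by
  rw [DirectSum.isInternal_submodule_iff_iSupIndep_and_iSup_eq_top]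
  refine ⟨?_, eq_top_iff.2 fun m _ => htop m⟩
  rw [iSupIndep_def]
  intro j
  rw [Submodule.disjoint_def]
  intro m hm hm'
  have hle : (⨆ i, ⨆ (_ : i ≠ j), gr i) ≤ LinearMap.ker (p j) :=
    iSup₂_le fun i hi x hx => hne i j hi x hx
  rw [← hsame j m hm]
  exact hle hm'

namespace GrMod

variable (M : GrMod 𝒜)

/-- The decomposition of a graded module into its components. -/
def decomp : M ≃ₗ[k] DirectSum ℤ (fun j => M.gr j) :=
  (LinearEquiv.ofBijective (DirectSum.coeLinearMap M.gr)
    (show Function.Bijective _ from M.isInternal)).symm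

theorem coe_decomp (m : M) : DirectSum.coeLinearMap M.gr (M.decomp m) = m :=
  M.decomp.symm_apply_apply m

variable {M} in
theorem decomp_of_mem {j : ℤ} {m : M} (hm : m ∈ M.gr j) :
    M.decomp m = DirectSum.lof k ℤ (fun j => M.gr j) j ⟨m, hm⟩ := by
  rw [← LinearEquiv.eq_symm_apply]
  exact (DirectSum.coeLinearMap_lof M.gr j ⟨m, hm⟩).symm

/-- The projection of a graded module onto its component of degree `j`. -/
def proj (j : ℤ) : M →ₗ[k] M :=
  (M.gr j).subtype.comp ((DirectSum.component k ℤ (fun j => M.gr j) j).comp M.decomp.toLinearMap)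

theorem proj_apply (j : ℤ) (m : M) : M.proj j m = (M.decomp m j : M) := rfl

theorem proj_mem (j : ℤ) (m : M) : M.proj j m ∈ M.gr j := Submodule.coe_mem _

variable {M} in
theorem proj_of_mem {j : ℤ} {m : M} (hm : m ∈ M.gr j) : M.proj j m = m := by
  rw [proj_apply, decomp_of_mem hm, DirectSum.lof_eq_of, DirectSum.of_eq_same]

variable {M} in
theorem proj_of_mem_ne {i j : ℤ} {m : M} (hm : m ∈ M.gr i) (h : i ≠ j) : M.proj j m = 0 := by
  rw [proj_apply, decomp_of_mem hm, DirectSum.lof_eq_of, DirectSum.of_eq_of_ne _ _ _ h.symm]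
  rfl

theorem exists_eq_sum_proj (m : M) : ∃ s : Finset ℤ, m = ∑ j ∈ s, M.proj j m := by
  classical
  refine ⟨(M.decomp m).support, ?_⟩
  conv_lhs => rw [← M.coe_decomp m, DirectSum.coeLinearMap_eq_dfinsuppSum]
  rfl

variable {M} in
theorem induction {p : M → Prop} (m : M) (hom : ∀ j, ∀ m ∈ M.gr j, p m)
    (add : ∀ x y, p x → p y → p (x + y)) : p m := by
  have h : m ∈ ⨆ j, M.gr j := by rw [M.isInternal.submodule_iSup_eq_top]; trivial
  exact Submodule.iSup_induction M.gr (motive := p) h hom (hom 0 0 (zero_mem _)) add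

variable {M} in
theorem ext_proj {x y : M} (h : ∀ j, M.proj j x = M.proj j y) : x = y := by
  apply M.decomp.injective
  exact DFinsupp.ext fun j => Subtype.ext (h j)

theorem mem_of_proj_mem {V : Type*} [SetLike V M] [AddSubmonoidClass V M] (N : V) (m : M)
    (h : ∀ j, M.proj j m ∈ N) : m ∈ N := by
  obtain ⟨s, hs⟩ := M.exists_eq_sum_proj m
  rw [hs]
  exact sum_mem fun j _ => h j

variable {M} in
theorem map_proj {N : GrMod 𝒜} {f : M →ₗ[A] N} (hf : IsHomogeneousMap f) (j : ℤ) (m : M) :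
    N.proj j (f m) = f (M.proj j m) := by
  induction m using GrMod.induction with
  | hom i m hm =>
    by_cases h : i = j
    · subst h
      rw [proj_of_mem hm, proj_of_mem (hf _ _ hm)]
    · rw [proj_of_mem_ne hm h, proj_of_mem_ne (hf _ _ hm) h, map_zero]
  | add x y hx hy => rw [map_add, map_add, hx, hy, map_add, map_add]

theorem proj_smul {i : ℕ} {a : A} (ha : a ∈ 𝒜 i) {j l : ℤ} (h : i + j = l) (m : M) :
    M.proj l (a • m) = a • M.proj j m := by
  subst h
  induction m using GrMod.induction with
  | hom t m hm =>
    by_cases h : t = j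
    · subst h
      rw [proj_of_mem hm, proj_of_mem (M.smul_mem _ _ _ _ ha hm)]
    · rw [proj_of_mem_ne hm h, proj_of_mem_ne (M.smul_mem _ _ _ _ ha hm) (by lia), smul_zero]
  | add x y hx hy => rw [smul_add, map_add, hx, hy, map_add, smul_add]

/-- A homogeneous submodule as a graded module. -/
def sub (N : Submodule A M) (hN : ∀ m ∈ N, ∀ j, M.proj j m ∈ N) : GrMod 𝒜 where
  carrier := N
  gr j := (M.gr j).comap (N.subtype.restrictScalars k)
  isInternal := by
    refine isInternal_of_proj _ (fun j => (M.proj j).restrict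
      (p := N.restrictScalars k) (q := N.restrictScalars k) fun m hm => hN m hm j) ?_ ?_ ?_
    · rintro j ⟨m, hm⟩ h
      exact Subtype.ext (proj_of_mem h)
    · rintro i j hij ⟨m, hm⟩ h
      exact Subtype.ext (proj_of_mem_ne h hij)
    · rintro ⟨m, hm⟩
      obtain ⟨s, h2⟩ := M.exists_eq_sum_proj m
      have h3 : (⟨m, hm⟩ : N) = ∑ j ∈ s, ⟨M.proj j m, hN m hm j⟩ := by
        ext
        simpa using h2
      rw [h3]
      exact sum_mem fun j _ => Submodule.mem_iSup_of_mem j (M.proj_mem j m)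
  smul_mem i j a m ha hm := M.smul_mem i j a m ha hm
  finite j := by
    have := M.finite j
    let f : ((M.gr j).comap (N.subtype.restrictScalars k)) →ₗ[k] M.gr j :=
      (N.subtype.restrictScalars k).restrict fun m hm => hm
    refine FiniteDimensional.of_injective f fun x y h => ?_
    have := congrArg Subtype.val h
    exact Subtype.ext (Subtype.ext this)

/-- The kernel of a homogeneous map as a graded module. -/
def kernel {M N : GrMod 𝒜} (f : M →ₗ[A] N) (hf : IsHomogeneousMap f) : GrMod 𝒜 :=
  M.sub (LinearMap.ker f) fun m hm j => by
    rw [LinearMap.mem_ker, ← map_proj hf, LinearMap.mem_ker.1 hm, map_zero]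

end GrMod

/-- The components of the graded algebra placed in degrees `≥ s`. -/
def shiftPart (𝒜 : ℕ → Submodule k A) (s j : ℤ) : Submodule k A :=
  -- The test is needed because `toNat` sends negative differences to `0`, which would put `𝒜 0` in
  -- every degree below `s`.
  if s ≤ j then 𝒜 (j - s).toNat else ⊥

theorem shiftPart_add (s : ℤ) (i : ℕ) : shiftPart 𝒜 s (s + i) = 𝒜 i := by
  simp [shiftPart]

theorem shiftPart_of_lt {s j : ℤ} (h : j < s) : shiftPart 𝒜 s j = ⊥ := by
  simp [shiftPart, not_le.2 h]

section Graded

variable [GradedAlgebra 𝒜]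

namespace GrMod

variable (M : GrMod 𝒜)

/-- The homogeneous component of degree `j` as a module over the degree zero subalgebra. -/
def comp (j : ℤ) : Submodule (degreeZero 𝒜) M where
  carrier := M.gr j
  add_mem' := (M.gr j).add_mem
  zero_mem' := (M.gr j).zero_mem
  smul_mem' a m hm := by
    have := M.smul_mem 0 j a m a.2 hm
    rwa [Nat.cast_zero, zero_add] at this

theorem mem_comp {j : ℤ} {m : M} : m ∈ M.comp j ↔ m ∈ M.gr j := Iff.rfl

/-- The projection onto the component of degree `j` is linear over the degree zero subalgebra. -/
def projComp (j : ℤ) : M →ₗ[degreeZero 𝒜] M.comp j where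
  toFun m := ⟨M.proj j m, M.proj_mem j m⟩
  map_add' x y := Subtype.ext (map_add _ _ _)
  map_smul' a m := Subtype.ext (M.proj_smul a.2 (by simp) m)

theorem projective_comp [Module.Projective (degreeZero 𝒜) M] (j : ℤ) :
    Module.Projective (degreeZero 𝒜) (M.comp j) :=
  Module.Projective.of_split (M.comp j).subtype (M.projComp j)
    (LinearMap.ext fun m => Subtype.ext (proj_of_mem m.2))

theorem projective_of_comp (h : ∀ j, Module.Projective (degreeZero 𝒜) (M.comp j)) :
    Module.Projective (degreeZero 𝒜) M :=
  Module.Projective.of_equiv' (LinearEquiv.ofBijective (DirectSum.coeLinearMap M.comp)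
    (show Function.Bijective _ from M.isInternal))

/-- A component of a retract is a retract of the component. -/
theorem projective_comp_of_retract {X Y : GrMod 𝒜} (f : X →ₗ[degreeZero 𝒜] Y)
    (g : Y →ₗ[degreeZero 𝒜] X) (hgf : g.comp f = LinearMap.id)
    (hfg : (∀ j, ∀ x ∈ X.gr j, f x ∈ Y.gr j) ∨
      ∀ j y, X.proj j (g y) = g (Y.proj j y)) (j : ℤ)
    [Module.Projective (degreeZero 𝒜) (Y.comp j)] : Module.Projective (degreeZero 𝒜) (X.comp j) := by
  refine Module.Projective.of_split ((Y.projComp j).comp (f.comp (X.comp j).subtype))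
    ((X.projComp j).comp (g.comp (Y.comp j).subtype)) ?_
  ext ⟨x, hx⟩
  have hg : g (f x) = x := LinearMap.congr_fun hgf x
  change X.proj j (g (Y.proj j (f x))) = x
  -- Homogeneity of just one of the two maps makes the truncated composite the identity in degree
  -- `j`. Sections obtained from projectivity need not be homogeneous.
  rcases hfg with h | h
  · rw [proj_of_mem (h j x hx), hg, proj_of_mem hx]
  · rw [← h, hg, proj_of_mem hx, proj_of_mem hx]

end GrMod

/-- The graded free module on `n` generators of degree `s`. -/
def freeGrMod (𝒜 : ℕ → Submodule k A) [GradedAlgebra 𝒜] [FiniteDimensional k A]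
    (n : ℕ) (s : ℤ) : GrMod 𝒜 where
  carrier := Fin n → A
  gr j := Submodule.pi Set.univ fun _ => shiftPart 𝒜 s j
  isInternal := by
    classical
    refine isInternal_of_proj _ (fun j => LinearMap.pi fun t =>
      (if s ≤ j then GradedAlgebra.proj 𝒜 (j - s).toNat else 0) ∘ₗ LinearMap.proj t) ?_ ?_ ?_
    · intro j m hm
      funext t
      have := hm t trivial
      by_cases h : s ≤ j
      · obtain ⟨l, rfl⟩ := Int.le.dest h
        rw [shiftPart_add] at this
        simpa using DirectSum.decompose_of_mem_same 𝒜 this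
      · have hz : m t = 0 := by
          rw [shiftPart_of_lt (not_le.1 h)] at this
          simpa using this
        simp [hz]
    · intro i j hij m hm
      funext t
      have := hm t trivial
      by_cases hi : s ≤ i
      · by_cases h : s ≤ j
        · obtain ⟨l, rfl⟩ := Int.le.dest h
          obtain ⟨r, rfl⟩ := Int.le.dest hi
          rw [shiftPart_add] at this
          simpa using DirectSum.decompose_of_mem_ne 𝒜 this (by rintro rfl; exact hij rfl)
        · simp [h]
      · have hz : m t = 0 := by
          rw [shiftPart_of_lt (not_le.1 hi)] at this
          simpa using this
        simp [hz]
    · intro m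
      have hm : m = ∑ t, LinearMap.single k (fun _ => A) t (m t) := by
        simp only [LinearMap.single_apply]
        exact (Finset.univ_sum_single m).symm
      rw [hm]
      refine sum_mem fun t _ => ?_
      rw [← DirectSum.sum_support_decompose 𝒜 (m t), map_sum]
      refine sum_mem fun i _ => Submodule.mem_iSup_of_mem (s + i) ?_
      intro t' _
      change _ ∈ shiftPart 𝒜 s (s + i)
      rw [shiftPart_add, LinearMap.single_apply]
      by_cases h : t' = t
      · subst h
        simp
      · rw [Pi.single_eq_of_ne h]
        exact zero_mem _
  smul_mem i j a m ha hm := by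
    intro t _
    have := hm t trivial
    change a * m t ∈ _
    by_cases h : s ≤ j
    · obtain ⟨l, rfl⟩ := Int.le.dest h
      rw [shiftPart_add] at this
      rw [show (i : ℤ) + (s + l) = s + (i + l : ℕ) by push_cast; ring, shiftPart_add]
      exact SetLike.mul_mem_graded ha this
    · have hz : m t = 0 := by
        rw [shiftPart_of_lt (not_le.1 h)] at this
        simpa using this
      rw [hz, mul_zero]
      exact zero_mem _
  finite j := inferInstance

theorem freeGrMod_generated [FiniteDimensional k A] (n : ℕ) (s : ℤ) :
    GeneratedInDegree (freeGrMod 𝒜 n s) s := by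
  classical
  refine eq_top_iff.2 fun (x : Fin n → A) _ => ?_
  rw [pi_eq_sum_univ x]
  refine sum_mem fun t _ => Submodule.smul_mem _ _ (Submodule.subset_span ?_)
  intro t' _
  change _ ∈ shiftPart 𝒜 s s
  have := shiftPart_add (𝒜 := 𝒜) s 0
  rw [Nat.cast_zero, add_zero] at this
  rw [this]
  dsimp only
  split_ifs
  · exact SetLike.one_mem_graded 𝒜
  · exact zero_mem _

/-- The map from a graded free module given by homogeneous elements is homogeneous. -/
theorem isHomogeneousMap_linearCombination [FiniteDimensional k A] {M : GrMod 𝒜} {n : ℕ} {s : ℤ}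
    {m : Fin n → M} (hm : ∀ t, m t ∈ M.gr s) :
    IsHomogeneousMap (M := freeGrMod 𝒜 n s) (N := M) (Fintype.linearCombination A m) := by
  intro j x hx
  have hx : ∀ t, x t ∈ shiftPart 𝒜 s j := fun t => hx t trivial
  change ∑ t, (x t : A) • m t ∈ M.gr j
  refine sum_mem fun t _ => ?_
  by_cases h : s ≤ j
  · obtain ⟨l, rfl⟩ := Int.le.dest h
    have := hx t
    rw [shiftPart_add] at this
    rw [add_comm]
    exact M.smul_mem _ _ _ _ this (hm t)
  · have hz : x t = 0 := by
      have := hx t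
      rwa [shiftPart_of_lt (not_le.1 h), Submodule.mem_bot] at this
    rw [hz, zero_smul]
    exact zero_mem _

/-- In degree `s + i` the free module is a sum of `n` copies of `A_i`; as an `A₀`-module, `A_i`
appears in the form `(freeGrMod 𝒜 1 0).comp i`. -/
theorem projective_comp_freeGrMod [FiniteDimensional k A] (n : ℕ) (s : ℤ) (i : ℕ)
    [Module.Projective (degreeZero 𝒜) ((freeGrMod 𝒜 1 0).comp i)] :
    Module.Projective (degreeZero 𝒜) ((freeGrMod 𝒜 n s).comp (s + i)) := by
  let f : (freeGrMod 𝒜 n s).comp (s + i) →ₗ[degreeZero 𝒜]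
      (Π₀ _ : Fin n, (freeGrMod 𝒜 1 0).comp i) :=
    (DFinsupp.linearEquivFunOnFintype (R := degreeZero 𝒜)).symm.toLinearMap.comp <|
    LinearMap.pi fun t =>
      { toFun := fun x => ⟨fun _ => x.1 t, fun _ _ => by
          have := x.2 t trivial
          change _ ∈ shiftPart 𝒜 s (s + i) at this
          change _ ∈ shiftPart 𝒜 0 i
          rw [shiftPart_add] at this
          simpa [shiftPart] using this⟩
        map_add' := fun _ _ => rfl
        map_smul' := fun _ _ => rfl }
  let g : (Π₀ _ : Fin n, (freeGrMod 𝒜 1 0).comp i) →ₗ[degreeZero 𝒜]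
      (freeGrMod 𝒜 n s).comp (s + i) :=
    { toFun := fun y => ⟨fun t => (y t).1 0, fun t _ => by
          have := (y t).2 0 trivial
          change _ ∈ shiftPart 𝒜 0 i at this
          change _ ∈ shiftPart 𝒜 s (s + i)
          rw [shiftPart_add]
          simpa [shiftPart] using this⟩
      map_add' := fun _ _ => rfl
      map_smul' := fun _ _ => rfl }
  exact Module.Projective.of_split f g (LinearMap.ext fun x => rfl)

namespace GeneratedInDegree

variable {M : GrMod 𝒜} {s : ℤ}

theorem proj_mem_span (h : GeneratedInDegree M s) (j : ℤ) (x : M) :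
    M.proj j x ∈ Submodule.span k {y : M | ∃ c ∈ shiftPart 𝒜 s j, ∃ m ∈ M.gr s, y = c • m} := by
  -- Quantifying over `a` inside the span induction makes the scalar case immediate: `a • b • x = (a
  -- * b) • x`.
  have key : ∀ x : M, ∀ a : A, M.proj j (a • x) ∈
      Submodule.span k {y : M | ∃ c ∈ shiftPart 𝒜 s j, ∃ m ∈ M.gr s, y = c • m} := by
    intro x
    have hx : x ∈ Submodule.span A (M.gr s : Set M) := by
      rw [show Submodule.span A (M.gr s : Set M) = ⊤ from h]
      trivial
    induction hx using Submodule.span_induction with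
    | mem m hm =>
      intro a
      induction a using DirectSum.Decomposition.inductionOn 𝒜 with
      | zero => rw [zero_smul, map_zero]; exact zero_mem _
      | @homogeneous i a =>
        have ham := M.smul_mem _ _ _ _ a.2 hm
        by_cases hj : (i : ℤ) + s = j
        · subst hj
          rw [GrMod.proj_of_mem ham]
          refine Submodule.subset_span ⟨a, ?_, m, hm, rfl⟩
          rw [add_comm, shiftPart_add]
          exact a.2
        · rw [GrMod.proj_of_mem_ne ham hj]
          exact zero_mem _
      | add a b ha hb => rw [add_smul, map_add]; exact add_mem ha hb
    | zero => intro a; rw [smul_zero, map_zero]; exact zero_mem _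
    | add x y _ _ hx hy => intro a; rw [smul_add, map_add]; exact add_mem (hx a) (hy a)
    | smul b x _ hx => intro a; rw [smul_smul]; exact hx _
  simpa using key x 1

theorem gr_eq_zero (h : GeneratedInDegree M s) {j : ℤ} (hj : j < s) {x : M} (hx : x ∈ M.gr j) :
    x = 0 := by
  have := h.proj_mem_span j x
  rw [GrMod.proj_of_mem hx, shiftPart_of_lt hj] at this
  rw [← Submodule.mem_bot k]
  refine Submodule.span_le.2 ?_ this
  rintro _ ⟨c, hc, m, -, rfl⟩
  rw [(Submodule.mem_bot k).1 hc, zero_smul]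
  exact zero_mem _

theorem mem_span (h : GeneratedInDegree M s) {i : ℕ} {x : M} (hx : x ∈ M.gr (s + i)) :
    x ∈ Submodule.span k {y : M | ∃ c ∈ 𝒜 i, ∃ m ∈ M.gr s, y = c • m} := by
  have := h.proj_mem_span (s + i) x
  rwa [GrMod.proj_of_mem hx, shiftPart_add] at this

theorem exists_generators (M : GrMod 𝒜) (s : ℤ) : ∃ (n : ℕ) (m : Fin n → M),
    (∀ t, m t ∈ M.gr s) ∧ Submodule.span k (Set.range m) = M.gr s := by
  have := M.finite s
  let b := Module.finBasis k (M.gr s)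
  refine ⟨_, fun t => b t, fun t => (b t).2, ?_⟩
  have : Set.range (fun t => (b t : M)) = (M.gr s).subtype '' Set.range b := by
    rw [← Set.range_comp]; rfl
  rw [this, Submodule.span_image, b.span_eq, Submodule.map_top, Submodule.range_subtype]

theorem surjective_linearCombination (h : GeneratedInDegree M s) {n : ℕ} {m : Fin n → M}
    (hm : Submodule.span k (Set.range m) = M.gr s) :
    Function.Surjective (Fintype.linearCombination A m) := by
  rw [← LinearMap.range_eq_top, Fintype.range_linearCombination, eq_top_iff,
    ← show Submodule.span A (M.gr s : Set M) = ⊤ from h, Submodule.span_le, ← hm]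
  exact Submodule.span_le_restrictScalars k A _

theorem finite (h : GeneratedInDegree M s) : Module.Finite A M := by
  obtain ⟨n, m, -, hm⟩ := exists_generators M s
  exact Module.Finite.of_surjective _ (h.surjective_linearCombination hm)

theorem of_surjective {N : GrMod 𝒜} (h : GeneratedInDegree M s) {f : M →ₗ[A] N}
    (hf : IsHomogeneousMap f) (hs : Function.Surjective f) : GeneratedInDegree N s := by
  refine eq_top_iff.2 ?_
  rw [← LinearMap.range_eq_top.2 hs, LinearMap.range_eq_map,
    ← show Submodule.span A (M.gr s : Set M) = ⊤ from h, Submodule.map_span]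
  refine Submodule.span_mono ?_
  rintro _ ⟨x, hx, rfl⟩
  exact hf s x hx

end GeneratedInDegree

theorem mem_positiveIdeal_iff {a : A} :
    a ∈ positiveIdeal 𝒜 ↔ (DirectSum.decompose 𝒜 a 0 : A) = 0 :=
  HomogeneousIdeal.mem_irrelevant_iff 𝒜 a

variable (𝒜) in
/-- The degree zero part of an element of the graded algebra. -/
def zeroPart (a : A) : degreeZero 𝒜 := ⟨DirectSum.decompose 𝒜 a 0, SetLike.coe_mem _⟩

variable (𝒜) in
theorem sub_zeroPart_mem (a : A) : a - zeroPart 𝒜 a ∈ positiveIdeal 𝒜 := by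
  rw [mem_positiveIdeal_iff, DirectSum.decompose_sub, DirectSum.sub_apply, Submodule.coe_sub,
    DirectSum.decompose_of_mem_same 𝒜 (zeroPart 𝒜 a).2, zeroPart, sub_self]

theorem smul_eq_zero_of_mem_positiveIdeal {a : A} (ha : a ∈ positiveIdeal 𝒜)
    (z : ZeroModule 𝒜) : a • z = 0 := by
  obtain ⟨b, rfl⟩ := Submodule.Quotient.mk_surjective _ z
  rw [← Submodule.Quotient.mk_smul, Submodule.Quotient.mk_eq_zero]
  exact mul_mem_positiveIdeal 𝒜 ha b

/-- A map which is linear over the degree zero subalgebra and compatible with the action of the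
positive ideal is linear. -/
def extendLinear {X Y : Type*} [AddCommGroup X] [Module A X] [AddCommGroup Y] [Module A Y]
    (f : X →ₗ[degreeZero 𝒜] Y) (hf : ∀ a ∈ positiveIdeal 𝒜, ∀ x, f (a • x) = a • f x) :
    X →ₗ[A] Y where
  toFun := f
  map_add' := f.map_add
  map_smul' a x := by
    have h1 : a = (a - zeroPart 𝒜 a) + zeroPart 𝒜 a := by abel
    have h2 : f ((zeroPart 𝒜 a : A) • x) = (zeroPart 𝒜 a : A) • f x := f.map_smul (zeroPart 𝒜 a) x
    rw [RingHom.id_apply]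
    conv_lhs => rw [h1, add_smul, map_add, hf _ (sub_zeroPart_mem 𝒜 a), h2, ← add_smul, ← h1]

variable (𝒜) in
/-- The canonical map `A₀ → A / J`. -/
def zeroModuleMap : degreeZero 𝒜 →ₗ[degreeZero 𝒜] ZeroModule 𝒜 where
  toFun r := Submodule.Quotient.mk (p := positiveIdeal 𝒜) (r : A)
  map_add' _ _ := rfl
  map_smul' _ _ := rfl

variable (𝒜) in
theorem zeroModuleMap_bijective : Function.Bijective (zeroModuleMap 𝒜) := by
  constructor
  · rw [← LinearMap.ker_eq_bot, LinearMap.ker_eq_bot']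
    intro r hr
    have hr : (r : A) ∈ positiveIdeal 𝒜 := (Submodule.Quotient.mk_eq_zero _).1 hr
    rw [mem_positiveIdeal_iff, DirectSum.decompose_of_mem_same 𝒜 r.2] at hr
    exact Subtype.ext hr
  · intro z
    obtain ⟨b, rfl⟩ := Submodule.Quotient.mk_surjective _ z
    exact ⟨zeroPart 𝒜 b, ((Submodule.Quotient.eq _).2 (sub_zeroPart_mem 𝒜 b)).symm⟩

variable (𝒜) in
/-- `A / J` is isomorphic to the degree zero subalgebra. -/
def zeroModuleEquiv : degreeZero 𝒜 ≃ₗ[degreeZero 𝒜] ZeroModule 𝒜 :=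
  LinearEquiv.ofBijective (zeroModuleMap 𝒜) (zeroModuleMap_bijective 𝒜)

theorem injective_zeroModule [h : Module.Injective (degreeZero 𝒜) (degreeZero 𝒜)] :
    Module.Injective (degreeZero 𝒜) (ZeroModule 𝒜) := by
  refine ⟨fun X Y _ _ _ _ f hf g => ?_⟩
  obtain ⟨l, hl⟩ := h.out f hf ((zeroModuleEquiv 𝒜).symm.toLinearMap.comp g)
  refine ⟨(zeroModuleEquiv 𝒜).toLinearMap.comp l, fun x => ?_⟩
  rw [LinearMap.comp_apply, hl]
  exact (zeroModuleEquiv 𝒜).apply_symm_apply _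

end Graded

end Grading

/-! ### Dimension shifting along a projective presentation -/

section Extensions

open Abelian

variable {A : Type u} [Ring A]

/-- The short exact sequence `0 → ker f → P → M → 0`. -/
def kerComplex {P M : Type u} [AddCommGroup P] [Module A P] [AddCommGroup M] [Module A M]
    (f : P →ₗ[A] M) : ShortComplex (ModuleCat.{u} A) :=
  ShortComplex.mk (ModuleCat.ofHom (LinearMap.ker f).subtype) (ModuleCat.ofHom f) (by
    ext x
    exact x.2)

theorem kerComplex_shortExact {P M : Type u} [AddCommGroup P] [Module A P] [AddCommGroup M]
    [Module A M] (f : P →ₗ[A] M) (hf : Function.Surjective f) : (kerComplex f).ShortExact where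
  exact := by
    rw [ShortComplex.moduleCat_exact_iff]
    intro x hx
    exact ⟨⟨x, hx⟩, rfl⟩
  mono_f := (ModuleCat.mono_iff_injective _).2 (Submodule.injective_subtype _)
  epi_g := (ModuleCat.epi_iff_surjective _).2 hf

/-- The class of `0 → ker f → P → M → 0` in `Ext¹(M, ker f)`. -/
def kerClass {P M : Type u} [AddCommGroup P] [Module A P] [AddCommGroup M] [Module A M]
    (f : P →ₗ[A] M) (hf : Function.Surjective f) :
    Ext.{u} (ModuleCat.of A M) (ModuleCat.of A (LinearMap.ker f)) 1 :=
  (kerComplex_shortExact f hf).extClass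

variable {P M S : Type u} [AddCommGroup P] [Module A P] [AddCommGroup M] [Module A M]
  [AddCommGroup S] [Module A S] {f : P →ₗ[A] M} (hf : Function.Surjective f)

/-- Since `n ≥ 1`, `Extⁿ(P, S)` vanishes, so the connecting map is onto. -/
theorem exists_extClass_comp [Module.Projective A P] {i n : ℕ} (hi : 1 + i = n)
    (z : Ext.{u} (ModuleCat.of A M) (ModuleCat.of A S) n) :
    ∃ z' : Ext.{u} (ModuleCat.of A (LinearMap.ker f)) (ModuleCat.of A S) i,
      (kerClass f hf).comp z' hi = z := by
  have hP : Projective (ModuleCat.of A P) := ModuleCat.projective_of_categoryTheory_projective _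
  obtain ⟨m, rfl⟩ : ∃ m, n = m + 1 := ⟨i, by omega⟩
  exact Ext.contravariant_sequence_exact₃ (kerComplex_shortExact f hf) _ z
    (Ext.eq_zero_of_projective (P := ModuleCat.of A P) _) hi

/-- The kernel of the connecting map comes from `Extⁱ(P, S)`. For `i > 0` this is zero; for `i = 0`
the hypothesis `hS` says that maps `P → S` restrict to zero. It holds for `S = A₀` when `ker f ≤ J
P`. -/
theorem eq_zero_of_extClass_comp_eq_zero [Module.Projective A P]
    (hS : ∀ h : P →ₗ[A] S, ∀ x ∈ LinearMap.ker f, h x = 0) {i n : ℕ} (hi : 1 + i = n)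
    (z : Ext.{u} (ModuleCat.of A (LinearMap.ker f)) (ModuleCat.of A S) i)
    (hz : (kerClass f hf).comp z hi = 0) : z = 0 := by
  have hP : Projective (ModuleCat.of A P) := ModuleCat.projective_of_categoryTheory_projective _
  obtain ⟨y, hy⟩ := Ext.contravariant_sequence_exact₁ (kerComplex_shortExact f hf) _ z hi hz
  rw [← hy]
  cases i with
  | zero =>
    obtain ⟨h, rfl⟩ := Ext.mk₀_bijective _ _ |>.2 y
    refine (Ext.mk₀_comp_mk₀ _ _).trans ((Ext.mk₀_eq_zero_iff _).2 ?_)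
    ext x
    exact hS h.hom x.1 x.2
  | succ i =>
    rw [Ext.eq_zero_of_projective (P := ModuleCat.of A P) y]
    exact Ext.comp_zero _ _ _ _ _

/-- Naturality of the connecting class with respect to a map of presentations. -/
theorem extClass_comp_mk₀ {P' M' : Type u} [AddCommGroup P'] [Module A P'] [AddCommGroup M']
    [Module A M'] {f' : P' →ₗ[A] M'} (hf' : Function.Surjective f') (a : P →ₗ[A] P')
    (b : M →ₗ[A] M') (hab : f'.comp a = b.comp f)
    (c : LinearMap.ker f →ₗ[A] LinearMap.ker f') (hc : ∀ x, (c x : P') = a x) :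
    (kerClass f hf).comp (Ext.mk₀ (ModuleCat.ofHom c)) (add_zero 1) =
      (Ext.mk₀ (ModuleCat.ofHom b)).comp (kerClass f' hf') (zero_add 1) := by
  let φ : kerComplex f ⟶ kerComplex f' :=
    { τ₁ := ModuleCat.ofHom c
      τ₂ := ModuleCat.ofHom a
      τ₃ := ModuleCat.ofHom b
      comm₁₂ := by
        ext x
        exact hc x
      comm₂₃ := by
        ext x
        exact LinearMap.congr_fun hab x }
  exact ShortComplex.ShortExact.extClass_naturality _ _ φ

end Extensions

/-! ### The quasi-Koszul condition in terms of syzygies -/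

section QuasiKoszul

open Abelian

variable {k : Type w} {A : Type u} [Field k] [Ring A] [Algebra k A] {𝒜 : ℕ → Submodule k A}
  [GradedAlgebra 𝒜]

variable {P M : Type u} [AddCommGroup P] [Module A P] [AddCommGroup M] [Module A M]
  {f : P →ₗ[A] M}

theorem apply_eq_zero_of_mem_smul_top (h : M →ₗ[A] ZeroModule 𝒜) {x : M}
    (hx : x ∈ positiveIdeal 𝒜 • (⊤ : Submodule A M)) : h x = 0 := by
  induction hx using Submodule.smul_induction_on' with
  | smul a ha y _ => rw [map_smul, smul_eq_zero_of_mem_positiveIdeal ha]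
  | add x _ y _ hx hy => rw [map_add, hx, hy, add_zero]

variable (𝒜) in
theorem ker_mkQ_positiveIdeal : LinearMap.ker (positiveIdeal 𝒜).mkQ = positiveIdeal 𝒜 :=
  Submodule.ker_mkQ _

theorem apply_mem_positiveIdeal (h : M →ₗ[A] A) {x : M}
    (hx : x ∈ positiveIdeal 𝒜 • (⊤ : Submodule A M)) : h x ∈ positiveIdeal 𝒜 := by
  rw [← ker_mkQ_positiveIdeal 𝒜]
  exact apply_eq_zero_of_mem_smul_top ((positiveIdeal 𝒜).mkQ.comp h) hx

/-- The syzygy of a quasi-Koszul module is quasi-Koszul. -/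
theorem IsQuasiKoszulModule.ker (hf : Function.Surjective f) [Module.Projective A P] (hM : IsQuasiKoszulModule 𝒜 M)
    (hJ : LinearMap.ker f ≤ positiveIdeal 𝒜 • (⊤ : Submodule A P)) :
    IsQuasiKoszulModule 𝒜 (LinearMap.ker f) := by
  intro i
  rw [eq_top_iff]
  intro z _
  have hz : (kerClass f hf).comp z (by omega : 1 + (i + 1) = i + 1 + 1) ∈
      (⊤ : AddSubgroup (Ext.{u} (ModuleCat.of A M) (ModuleCat.of A (ZeroModule 𝒜)) (i + 1 + 1))) :=
    trivial
  rw [← hM (i + 1)] at hz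
  -- A factor `x` on `M` of positive degree is the kernel class times some `x'` on the syzygy, so by
  -- associativity products on `M` come from products on the syzygy. Minimality then allows the
  -- kernel class to be cancelled.
  have key : ∀ y ∈ AddSubgroup.closure
    {z : Abelian.Ext.{u} (ModuleCat.of A M) (ModuleCat.of A (ZeroModule 𝒜)) (i + 1 + 1) |
      ∃ (x : Abelian.Ext.{u} (ModuleCat.of A M) (ModuleCat.of A (ZeroModule 𝒜)) (i + 1))
        (y : Abelian.Ext.{u} (ModuleCat.of A (ZeroModule 𝒜)) (ModuleCat.of A (ZeroModule 𝒜)) 1),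
        z = x.comp y rfl}, ∃ y' ∈ AddSubgroup.closure
    {z : Abelian.Ext.{u} (ModuleCat.of A (LinearMap.ker f)) (ModuleCat.of A (ZeroModule 𝒜)) (i + 1) |
      ∃ (x : Abelian.Ext.{u} (ModuleCat.of A (LinearMap.ker f)) (ModuleCat.of A (ZeroModule 𝒜)) i)
        (y : Abelian.Ext.{u} (ModuleCat.of A (ZeroModule 𝒜)) (ModuleCat.of A (ZeroModule 𝒜)) 1),
        z = x.comp y rfl},
      (kerClass f hf).comp y' (by omega : 1 + (i + 1) = i + 1 + 1) = y := by
    intro y hy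
    induction hy using AddSubgroup.closure_induction with
    | mem y hy =>
      obtain ⟨x, y, rfl⟩ := hy
      obtain ⟨x', rfl⟩ := exists_extClass_comp hf (by omega : 1 + i = i + 1) x
      refine ⟨x'.comp y rfl, AddSubgroup.subset_closure ⟨x', y, rfl⟩, ?_⟩
      exact (Ext.comp_assoc _ _ _ _ _ (by omega)).symm
    | zero => exact ⟨0, zero_mem _, Ext.comp_zero _ _ _ _ _⟩
    | add y z _ _ hy hz =>
      obtain ⟨y', hy', rfl⟩ := hy
      obtain ⟨z', hz', rfl⟩ := hz
      exact ⟨y' + z', add_mem hy' hz', Ext.comp_add _ _ _ _⟩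
    | neg y _ hy =>
      obtain ⟨y', hy', rfl⟩ := hy
      exact ⟨-y', neg_mem hy', Ext.comp_neg _ _ _⟩
  obtain ⟨z', hz', h⟩ := key _ hz
  have : z' - z = 0 := by
    refine eq_zero_of_extClass_comp_eq_zero hf
      (fun h x hx => apply_eq_zero_of_mem_smul_top h (hJ hx)) (by omega : 1 + (i + 1) = i + 1 + 1) _ ?_
    rw [sub_eq_add_neg, Ext.comp_add, Ext.comp_neg, h, add_neg_cancel]
  rwa [← sub_eq_zero.1 this]

variable (𝒜) in
theorem surjective_mkQ_positiveIdeal : Function.Surjective (positiveIdeal 𝒜).mkQ :=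
  Submodule.mkQ_surjective _

/-- The first syzygy `N` of a quasi-Koszul module with projective cover `P`: maps `N → A₀` extend
to `J P`. -/
theorem IsQuasiKoszulModule.exists_extension (hf : Function.Surjective f) [Module.Projective A P]
    (hM : IsQuasiKoszulModule 𝒜 M)
    (hJ : LinearMap.ker f ≤ positiveIdeal 𝒜 • (⊤ : Submodule A P))
    (g : LinearMap.ker f →ₗ[A] ZeroModule 𝒜) :
    ∃ h : ↥(positiveIdeal 𝒜 • (⊤ : Submodule A P)) →ₗ[A] ZeroModule 𝒜,
      g = h.comp (Submodule.inclusion hJ) := by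
  have hz : (kerClass f hf).comp (Ext.mk₀ (ModuleCat.ofHom g))
      (by omega : 1 + 0 = 0 + 1) ∈
      (⊤ : AddSubgroup (Ext.{u} (ModuleCat.of A M) (ModuleCat.of A (ZeroModule 𝒜)) (0 + 1))) :=
    trivial
  rw [← hM 0] at hz
  -- In a product `x · y`, `x` is a map `b : M → A₀`, and `y` is the class of `0 → J → A → A₀ → 0`
  -- followed by some `g' : J → A₀`. Lifting `b ∘ f` to `a : P → A`, naturality gives the kernel
  -- class followed by `g' ∘ a`, and `a` carries all of `J P` into `J`.
  have key : ∀ y ∈ AddSubgroup.closure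
    {z : Abelian.Ext.{u} (ModuleCat.of A M) (ModuleCat.of A (ZeroModule 𝒜)) (0 + 1) |
      ∃ (x : Abelian.Ext.{u} (ModuleCat.of A M) (ModuleCat.of A (ZeroModule 𝒜)) 0)
        (y : Abelian.Ext.{u} (ModuleCat.of A (ZeroModule 𝒜)) (ModuleCat.of A (ZeroModule 𝒜)) 1),
        z = x.comp y rfl},
      ∃ h : ↥(positiveIdeal 𝒜 • (⊤ : Submodule A P)) →ₗ[A] ZeroModule 𝒜,
        y = (kerClass f hf).comp
          (Ext.mk₀ (ModuleCat.ofHom (h.comp (Submodule.inclusion hJ)))) (zero_add 1) := by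
    intro y hy
    induction hy using AddSubgroup.closure_induction with
    | mem y hy =>
      obtain ⟨x, y, rfl⟩ := hy
      obtain ⟨b, rfl⟩ := (Ext.mk₀_bijective _ _).2 x
      obtain ⟨y', rfl⟩ := exists_extClass_comp (surjective_mkQ_positiveIdeal 𝒜)
        (add_zero 1) y
      obtain ⟨g', rfl⟩ := (Ext.mk₀_bijective _ _).2 y'
      obtain ⟨a, ha⟩ := Module.projective_lifting_property (positiveIdeal 𝒜).mkQ (b.hom.comp f)
        (surjective_mkQ_positiveIdeal 𝒜)
      let c : ↥(positiveIdeal 𝒜 • (⊤ : Submodule A P)) →ₗ[A] LinearMap.ker (positiveIdeal 𝒜).mkQ :=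
        a.restrict fun x hx => by
          rw [ker_mkQ_positiveIdeal]
          exact apply_mem_positiveIdeal a hx
      refine ⟨g'.hom.comp c, ?_⟩
      have := extClass_comp_mk₀ hf (surjective_mkQ_positiveIdeal 𝒜) a b.hom ha
        (c.comp (Submodule.inclusion hJ)) (fun x => rfl)
      have hcomp : ModuleCat.ofHom ((g'.hom.comp c).comp (Submodule.inclusion hJ)) =
        ModuleCat.ofHom (c.comp (Submodule.inclusion hJ)) ≫ g' := rfl
      rw [hcomp, ← Ext.mk₀_comp_mk₀, ← Ext.comp_assoc _ _ _ (add_zero 1) (add_zero 0) (by omega),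
        this]
      exact (Ext.comp_assoc _ _ _ _ _ (by omega)).symm
    | zero =>
      refine ⟨0, ?_⟩
      rw [LinearMap.zero_comp, ModuleCat.ofHom_zero, Ext.mk₀_zero, Ext.comp_zero]
    | add y z _ _ hy hz =>
      obtain ⟨y', rfl⟩ := hy
      obtain ⟨z', rfl⟩ := hz
      refine ⟨y' + z', ?_⟩
      rw [← Ext.comp_add, LinearMap.add_comp, ModuleCat.ofHom_add, Ext.mk₀_add]
    | neg y _ hy =>
      obtain ⟨y', rfl⟩ := hy
      refine ⟨-y', ?_⟩
      rw [← Ext.comp_neg, ← Ext.mk₀_neg]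
      rfl
  obtain ⟨h, hh⟩ := key _ hz
  refine ⟨h, ?_⟩
  -- Minimality makes the connecting map injective on maps to `A₀`, so equal classes come from equal
  -- maps.
  have h0 := eq_zero_of_extClass_comp_eq_zero hf
      (fun h x hx => apply_eq_zero_of_mem_smul_top h (hJ hx)) (by omega : 1 + 0 = 0 + 1)
      (Ext.mk₀ (ModuleCat.ofHom (g - h.comp (Submodule.inclusion hJ)))) (by
        have hsub : ModuleCat.ofHom (g - h.comp (Submodule.inclusion hJ)) =
          ModuleCat.ofHom g + -ModuleCat.ofHom (h.comp (Submodule.inclusion hJ)) :=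
          congrArg ModuleCat.ofHom (sub_eq_add_neg _ _)
        rw [hsub, Ext.mk₀_add, Ext.mk₀_neg,
          Ext.comp_add, Ext.comp_neg, hh, add_neg_cancel])
  rw [Ext.mk₀_eq_zero_iff] at h0
  ext1 x
  rw [← sub_eq_zero]
  exact ConcreteCategory.congr_hom h0 x

/-- The condition `Ext¹(A₀, A₀) · Extⁱ(M, A₀) = Extⁱ⁺¹(M, A₀)` for fixed `i`. -/
def QuasiKoszulAt (𝒜 : ℕ → Submodule k A) [GradedAlgebra 𝒜]
    (M : Type u) [AddCommGroup M] [Module A M] (i : ℕ) : Prop :=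
  AddSubgroup.closure
    {z : Abelian.Ext.{u} (ModuleCat.of A M) (ModuleCat.of A (ZeroModule 𝒜)) (i + 1) |
      ∃ (x : Abelian.Ext.{u} (ModuleCat.of A M) (ModuleCat.of A (ZeroModule 𝒜)) i)
        (y : Abelian.Ext.{u} (ModuleCat.of A (ZeroModule 𝒜)) (ModuleCat.of A (ZeroModule 𝒜)) 1),
        z = x.comp y rfl} = ⊤

/-- Only surjectivity of the connecting map is needed here, so the presentation need not be minimal.
-/
theorem QuasiKoszulAt.succ (hf : Function.Surjective f) [Module.Projective A P] {i : ℕ}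
    (h : QuasiKoszulAt 𝒜 (LinearMap.ker f) i) : QuasiKoszulAt 𝒜 M (i + 1) := by
  rw [QuasiKoszulAt, eq_top_iff]
  intro z _
  obtain ⟨z', rfl⟩ := exists_extClass_comp hf (by omega : 1 + (i + 1) = i + 1 + 1) z
  have hz' : z' ∈ (⊤ : AddSubgroup _) := trivial
  rw [← h] at hz'
  induction hz' using AddSubgroup.closure_induction with
  | mem y hy =>
    obtain ⟨x, y, rfl⟩ := hy
    refine AddSubgroup.subset_closure
      ⟨(kerClass f hf).comp x (by omega : 1 + i = i + 1), y, ?_⟩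
    exact (Ext.comp_assoc _ _ _ _ _ (by omega)).symm
  | zero =>
    have := Ext.comp_zero (kerClass f hf) (ModuleCat.of A (ZeroModule 𝒜))
      (i + 1) (i + 1 + 1) (by omega)
    exact this ▸ zero_mem _
  | add y z _ _ hy hz => rw [Ext.comp_add]; exact add_mem (hy trivial) (hz trivial)
  | neg y _ hy => rw [Ext.comp_neg]; exact neg_mem (hy trivial)

/-- Converse of `IsQuasiKoszulModule.exists_extension`: a dual basis of `P` writes a map that
extends to `J P` as a finite sum of maps factoring through `J`, and each summand yields a Yoneda
product. -/
theorem QuasiKoszulAt.zero (hf : Function.Surjective f) [Module.Projective A P]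
    [Module.Finite A P] (hJ : LinearMap.ker f ≤ positiveIdeal 𝒜 • (⊤ : Submodule A P))
    (hext : ∀ g : LinearMap.ker f →ₗ[A] ZeroModule 𝒜,
      ∃ h : ↥(positiveIdeal 𝒜 • (⊤ : Submodule A P)) →ₗ[A] ZeroModule 𝒜,
        g = h.comp (Submodule.inclusion hJ)) : QuasiKoszulAt 𝒜 M 0 := by
  rw [QuasiKoszulAt, eq_top_iff]
  intro z _
  obtain ⟨z', rfl⟩ := exists_extClass_comp hf (by omega : 1 + 0 = 0 + 1) z
  obtain ⟨g, rfl⟩ := (Ext.mk₀_bijective _ _).2 z'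
  obtain ⟨h, hh⟩ := hext g.hom
  obtain ⟨n, π, hπ⟩ := Module.Finite.exists_fin' A P
  obtain ⟨s, hs⟩ := Module.projective_lifting_property π LinearMap.id hπ
  -- `c t` is the `t`-th coordinate, and `g' t` sends `a ∈ J` to `h (a • p_t)` for the `t`-th
  -- generator `p_t`; `hsum` is the dual basis identity `x = ∑ s(x)_t • p_t`.
  let c (t : Fin n) : LinearMap.ker f →ₗ[A] LinearMap.ker (positiveIdeal 𝒜).mkQ :=
    ((LinearMap.proj t).comp s).restrict fun x hx => by
      rw [ker_mkQ_positiveIdeal]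
      exact apply_mem_positiveIdeal _ (hJ hx)
  let g' (t : Fin n) : LinearMap.ker (positiveIdeal 𝒜).mkQ →ₗ[A] ZeroModule 𝒜 :=
    h.comp ((LinearMap.toSpanSingleton A P (π (Pi.single t 1))).restrict fun x hx =>
      Submodule.smul_mem_smul (by rwa [ker_mkQ_positiveIdeal] at hx) trivial)
  have hsum : g.hom = ∑ t, (g' t).comp (c t) := by
    rw [hh]
    ext1 x
    rw [LinearMap.sum_apply]
    simp only [LinearMap.comp_apply, g', ← map_sum]
    congr 1
    ext1
    rw [AddSubmonoidClass.coe_finsetSum]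
    change (x : P) = ∑ t, (s x t) • π (Pi.single t 1)
    conv_lhs => rw [← LinearMap.id_apply (R := A) (x : P), ← hs, LinearMap.comp_apply,
      pi_eq_sum_univ (s x), map_sum]
    refine Finset.sum_congr rfl fun t _ => ?_
    rw [map_smul]
    congr 2
    ext t'
    simp [Pi.single_apply, eq_comm]
  have hcl : ∀ t, ∃ b : M →ₗ[A] ZeroModule 𝒜,
      (kerClass f hf).comp (Ext.mk₀ (ModuleCat.ofHom (c t))) (add_zero 1) =
      (Ext.mk₀ (ModuleCat.ofHom b)).comp
        (kerClass _ (surjective_mkQ_positiveIdeal 𝒜)) (zero_add 1) := by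
    intro t
    let a : P →ₗ[A] A := (LinearMap.proj t).comp s
    -- Modulo `J` the coordinate kills `ker f ≤ J P`, so it descends to `b : M → A₀`, and naturality
    -- of the kernel class applies.
    have hk : LinearMap.ker f ≤ LinearMap.ker ((positiveIdeal 𝒜).mkQ.comp a) := fun x hx => by
      rw [LinearMap.mem_ker]
      exact apply_eq_zero_of_mem_smul_top _ (hJ hx)
    let b : M →ₗ[A] ZeroModule 𝒜 := ((LinearMap.ker f).liftQ _ hk).comp
      (f.quotKerEquivOfSurjective hf).symm.toLinearMap
    refine ⟨b, extClass_comp_mk₀ hf (surjective_mkQ_positiveIdeal 𝒜) a b ?_ (c t) fun x => rfl⟩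
    ext1 x
    have : (f.quotKerEquivOfSurjective hf).symm (f x) = Submodule.Quotient.mk x := by
      rw [LinearEquiv.symm_apply_eq]
      rfl
    simp only [LinearMap.comp_apply, b, LinearEquiv.coe_coe, this]
    rfl
  choose b hb using hcl
  have hg : g = ∑ t, ModuleCat.ofHom (c t) ≫ ModuleCat.ofHom (g' t) := by
    ext1
    rw [hsum]
    simp only [ModuleCat.hom_sum, ModuleCat.hom_comp]
    rfl
  rw [hg, Ext.mk₀_sum, Ext.comp_sum]
  refine sum_mem fun t _ => AddSubgroup.subset_closure ⟨Ext.mk₀ (ModuleCat.ofHom (b t)),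
    (kerClass _ (surjective_mkQ_positiveIdeal 𝒜)).comp (Ext.mk₀ (ModuleCat.ofHom (g' t)))
      (add_zero 1), ?_⟩
  rw [← Ext.mk₀_comp_mk₀, ← Ext.comp_assoc _ _ _ (add_zero 1) (add_zero 0) (by omega), hb]
  exact Ext.comp_assoc _ _ _ _ _ (by omega)

end QuasiKoszul

/-! ### Split sequences over a self-injective ring -/

section Splitting

variable {R : Type u} [Ring R]

theorem injective_of_projective_of_finite [h : Module.Injective R R] (Q : Type u) [AddCommGroup Q]
    [Module R Q] [Module.Finite R Q] [Module.Projective R Q] : Module.Injective R Q := by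
  obtain ⟨n, π, hπ⟩ := Module.Finite.exists_fin' R Q
  obtain ⟨s, hs⟩ := Module.projective_lifting_property π LinearMap.id hπ
  have : Module.Injective R (Fin n → R) := inferInstance
  refine ⟨fun X Y _ _ _ _ f hf g => ?_⟩
  obtain ⟨l, hl⟩ := this.out f hf (s.comp g)
  refine ⟨π.comp l, fun x => ?_⟩
  rw [LinearMap.comp_apply, hl]
  exact LinearMap.congr_fun hs (g x)

theorem projective_of_injective_ker {X Y : Type u} [AddCommGroup X] [Module R X] [AddCommGroup Y]
    [Module R Y] (f : X →ₗ[R] Y) (hf : Function.Surjective f) [Module.Projective R X]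
    [hk : Module.Injective R (LinearMap.ker f)] : Module.Projective R Y := by
  obtain ⟨r, hr⟩ := hk.out (LinearMap.ker f).subtype (Submodule.injective_subtype _) LinearMap.id
  let p : X →ₗ[R] X := LinearMap.id - (LinearMap.ker f).subtype.comp r
  have hp : LinearMap.ker f ≤ LinearMap.ker p := fun x hx => by
    have := hr ⟨x, hx⟩
    simp only [Submodule.subtype_apply, LinearMap.id_apply] at this
    simp [p, this]
  refine Module.Projective.of_split (((LinearMap.ker f).liftQ p hp).comp
    (f.quotKerEquivOfSurjective hf).symm.toLinearMap) f ?_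
  ext y
  obtain ⟨x, rfl⟩ := hf y
  have : (f.quotKerEquivOfSurjective hf).symm (f x) = Submodule.Quotient.mk x := by
    rw [LinearEquiv.symm_apply_eq]
    rfl
  simp only [LinearMap.comp_apply, LinearEquiv.coe_coe, this]
  change f (x - (r x : X)) = f x
  rw [map_sub, LinearMap.mem_ker.1 (r x).2, sub_zero]

theorem projective_ker {X Y : Type*} [AddCommGroup X] [Module R X] [AddCommGroup Y]
    [Module R Y] (f : X →ₗ[R] Y) (hf : Function.Surjective f) [Module.Projective R X]
    [Module.Projective R Y] : Module.Projective R (LinearMap.ker f) := by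
  obtain ⟨s, hs⟩ := Module.projective_lifting_property f LinearMap.id hf
  have h : ∀ x, (LinearMap.id - s.comp f : X →ₗ[R] X) x ∈ LinearMap.ker f := fun x => by
    have := LinearMap.congr_fun hs (f x)
    simp only [LinearMap.comp_apply, LinearMap.id_apply] at this
    simp [this]
  refine Module.Projective.of_split (LinearMap.ker f).subtype
    ((LinearMap.id - s.comp f).codRestrict (LinearMap.ker f) h) ?_
  ext x
  simp

end Splitting

/-! ### Linear resolutions: degree estimates and consequences -/

section Graded

variable {k : Type w} {A : Type u} [Field k] [Ring A] [Algebra k A] {𝒜 : ℕ → Submodule k A}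
  [GradedAlgebra 𝒜]

namespace GrMod

variable (M : GrMod 𝒜)

theorem proj_smul_eq_sum (a : A) (x : M) (j : ℤ) :
    ∃ s : Finset ℕ, M.proj j (a • x) =
      ∑ i ∈ s, (DirectSum.decompose 𝒜 a i : A) • M.proj (j - i) x := by
  classical
  refine ⟨(DirectSum.decompose 𝒜 a).support, ?_⟩
  conv_lhs => rw [← DirectSum.sum_support_decompose 𝒜 a, Finset.sum_smul, map_sum]
  exact Finset.sum_congr rfl fun i _ => M.proj_smul (SetLike.coe_mem _) (by ring) x

/-- The positive ideal raises degrees. -/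
theorem proj_smul_mem_of_mem_positiveIdeal {N : Submodule A M} {l : ℤ} {x : M}
    (hx : ∀ j < l, M.proj j x ∈ N) {a : A} (ha : a ∈ positiveIdeal 𝒜) : M.proj l (a • x) ∈ N := by
  obtain ⟨s, hs⟩ := M.proj_smul_eq_sum a x l
  rw [hs]
  refine sum_mem fun i _ => ?_
  rcases Nat.eq_zero_or_pos i with rfl | hi
  · rw [mem_positiveIdeal_iff.1 ha, zero_smul]
    exact zero_mem _
  · exact N.smul_mem _ (hx _ (by omega))

/-- The degree `l` component of an element of `J M` is built from components of degree below `l`.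
This is the inductive step of graded Nakayama arguments. -/
theorem proj_mem_of_mem_smul_top {N : Submodule A M} {l : ℤ}
    (hN : ∀ j < l, ∀ x ∈ M.gr j, x ∈ N) {x : M}
    (hx : x ∈ positiveIdeal 𝒜 • (⊤ : Submodule A M)) : M.proj l x ∈ N := by
  induction hx using Submodule.smul_induction_on' with
  | smul a ha y _ =>
    exact M.proj_smul_mem_of_mem_positiveIdeal (fun j hj => hN j hj _ (M.proj_mem j y)) ha
  | add x _ y _ hx hy => rw [map_add]; exact add_mem hx hy

instance (j : ℤ) : Module.Finite (degreeZero 𝒜) (M.comp j) := by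
  have := M.finite j
  let f : M.gr j →ₗ[k] M.comp j := ⟨⟨fun x => ⟨x.1, x.2⟩, fun _ _ => rfl⟩, fun _ _ => rfl⟩
  have : Module.Finite k (M.comp j) := Module.Finite.of_surjective f fun x => ⟨⟨x.1, x.2⟩, rfl⟩
  exact Module.Finite.of_restrictScalars_finite k (degreeZero 𝒜) (M.comp j)

/-- The restriction of a homogeneous map to components. -/
def mapComp {M N : GrMod 𝒜} (f : M →ₗ[A] N) (hf : IsHomogeneousMap f) (j : ℤ) :
    M.comp j →ₗ[degreeZero 𝒜] N.comp j :=
  (f.restrictScalars (degreeZero 𝒜)).restrict fun x hx => hf j x hx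

theorem mapComp_surjective {M N : GrMod 𝒜} {f : M →ₗ[A] N} (hf : IsHomogeneousMap f)
    (hs : Function.Surjective f) (j : ℤ) : Function.Surjective (mapComp f hf j) := by
  rintro ⟨y, hy⟩
  obtain ⟨x, rfl⟩ := hs y
  refine ⟨⟨M.proj j x, M.proj_mem j x⟩, Subtype.ext ?_⟩
  change f (M.proj j x) = f x
  rw [← map_proj hf, proj_of_mem hy]

/-- The component of the kernel is the kernel on components. -/
def kernelCompEquiv {M N : GrMod 𝒜} (f : M →ₗ[A] N) (hf : IsHomogeneousMap f) (j : ℤ) :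
    (kernel f hf).comp j ≃ₗ[degreeZero 𝒜] LinearMap.ker (mapComp f hf j) where
  toFun x := ⟨⟨x.1.1, x.2⟩, LinearMap.mem_ker.2 (Subtype.ext x.1.2)⟩
  invFun x := ⟨⟨x.1.1, congrArg Subtype.val (LinearMap.mem_ker.1 x.2)⟩, x.1.2⟩
  map_add' _ _ := rfl
  map_smul' _ _ := rfl
  left_inv _ := rfl
  right_inv _ := rfl

theorem subsingleton_comp {M : GrMod 𝒜} {j : ℤ} (h : ∀ x ∈ M.gr j, x = 0) :
    Subsingleton (M.comp j) :=
  ⟨fun x y => Subtype.ext ((h x x.2).trans (h y y.2).symm)⟩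

end GrMod

namespace GeneratedInDegree

variable {M : GrMod 𝒜} {s : ℤ}

theorem proj_eq_zero (h : GeneratedInDegree M s) {j : ℤ} (hj : j < s) (x : M) : M.proj j x = 0 :=
  h.gr_eq_zero hj (M.proj_mem j x)

theorem mem_smul_of_forall (h : GeneratedInDegree M s) {i : ℕ} {N : Submodule A M} {x : M}
    (hx : x ∈ M.gr (s + i)) (hN : ∀ c ∈ 𝒜 i, ∀ m ∈ M.gr s, c • m ∈ N) : x ∈ N := by
  have hle : Submodule.span k {y : M | ∃ c ∈ 𝒜 i, ∃ m ∈ M.gr s, y = c • m} ≤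
      N.restrictScalars k := by
    rw [Submodule.span_le]
    rintro _ ⟨c, hc, m, hm, rfl⟩
    exact hN c hc m hm
  exact hle (h.mem_span hx)

theorem mem_smul_top (h : GeneratedInDegree M s) {x : M} (hx : M.proj s x = 0) :
    x ∈ positiveIdeal 𝒜 • (⊤ : Submodule A M) := by
  refine M.mem_of_proj_mem _ x fun j => ?_
  rcases lt_trichotomy j s with hj | rfl | hj
  · rw [h.proj_eq_zero hj]
    exact zero_mem _
  · rw [hx]
    exact zero_mem _
  · obtain ⟨i, rfl⟩ := Int.le.dest hj.le
    refine h.mem_smul_of_forall (M.proj_mem _ x) fun c hc m _ => ?_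
    exact Submodule.smul_mem_smul (HomogeneousIdeal.mem_irrelevant_of_mem 𝒜 (by omega) hc) trivial

/-- The equality `A_{i+2} = A_1 A_{i+1}` places all degrees from `s + 2` on in `J² M`. -/
theorem mem_smul_smul_top (h : GeneratedInDegree M s) (hmul : ∀ i j, 𝒜 i * 𝒜 j = 𝒜 (i + j))
    {i : ℕ} {x : M} (hx : x ∈ M.gr (s + (i + 2 : ℕ))) :
    x ∈ positiveIdeal 𝒜 • positiveIdeal 𝒜 • (⊤ : Submodule A M) := by
  refine h.mem_smul_of_forall hx fun c hc m _ => ?_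
  rw [show i + 2 = 1 + (i + 1) by omega, ← hmul] at hc
  induction hc using Submodule.mul_induction_on' with
  | mem_mul_mem a ha b hb =>
    rw [mul_smul]
    exact Submodule.smul_mem_smul (HomogeneousIdeal.mem_irrelevant_of_mem 𝒜 one_pos ha)
      (Submodule.smul_mem_smul (HomogeneousIdeal.mem_irrelevant_of_mem 𝒜 i.succ_pos hb) trivial)
  | add x _ y _ hx hy => rw [add_smul]; exact add_mem hx hy

theorem proj_eq_zero_of_mem_smul_top (h : GeneratedInDegree M s) {x : M}
    (hx : x ∈ positiveIdeal 𝒜 • (⊤ : Submodule A M)) {j : ℤ} (hj : j ≤ s) : M.proj j x = 0 := by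
  rw [← Submodule.mem_bot A]
  refine M.proj_mem_of_mem_smul_top (fun i hi y hy => ?_) hx
  rw [Submodule.mem_bot]
  exact h.gr_eq_zero (hi.trans_le hj) hy

/-- If `M` is generated in degree `s`, its `A`-linear maps are determined in degree `s`. -/
theorem linearMap_ext (h : GeneratedInDegree M s) {X : Type*} [AddCommGroup X] [Module A X]
    {f g : M →ₗ[A] X} (hfg : ∀ x ∈ M.gr s, f x = g x) : f = g :=
  LinearMap.ext_on (show Submodule.span A (M.gr s : Set M) = ⊤ from h) hfg

end GeneratedInDegree

variable [FiniteDimensional k A]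

theorem projective_comp_of_generated {P : GrMod 𝒜} {s : ℤ} (h : GeneratedInDegree P s)
    [Module.Projective A P] (i : ℕ)
    [Module.Projective (degreeZero 𝒜) ((freeGrMod 𝒜 1 0).comp i)] :
    Module.Projective (degreeZero 𝒜) (P.comp (s + i)) := by
  obtain ⟨n, m, hm, hspan⟩ := GeneratedInDegree.exists_generators P s
  have hs := h.surjective_linearCombination hspan
  obtain ⟨σ, hσ⟩ := Module.projective_lifting_property (Fintype.linearCombination A m)
    LinearMap.id hs
  have := projective_comp_freeGrMod (𝒜 := 𝒜) n s i
  exact GrMod.projective_comp_of_retract (X := P) (Y := freeGrMod 𝒜 n s)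
    (σ.restrictScalars (degreeZero 𝒜))
    ((Fintype.linearCombination A m).restrictScalars (degreeZero 𝒜))
    (LinearMap.ext fun x => LinearMap.congr_fun hσ x)
    (Or.inr fun j y => GrMod.map_proj (isHomogeneousMap_linearCombination hm) j y) _

/-- A graded module generated in degree `s` with a linear projective resolution. -/
def IsKoszulFrom (M : GrMod 𝒜) (s : ℤ) : Prop :=
  GeneratedInDegree M s ∧
  ∃ (P : ℕ → GrMod 𝒜) (d : ∀ n, P (n + 1) →ₗ[A] P n) (ε : P 0 →ₗ[A] M),
    (∀ n, Module.Projective A (P n)) ∧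
    (∀ n : ℕ, GeneratedInDegree (P n) (s + n)) ∧
    (∀ n, IsHomogeneousMap (d n)) ∧ IsHomogeneousMap ε ∧
    Function.Surjective ε ∧
    Function.Exact (d 0) ε ∧
    ∀ n, Function.Exact (d (n + 1)) (d n)

theorem isKoszulFrom_zero_iff {M : GrMod 𝒜} : IsKoszulFrom M 0 ↔ IsKoszulModule M := by
  simp only [IsKoszulFrom, IsKoszulModule, zero_add]

/-- Deleting the first term of a linear resolution leaves a linear resolution of the syzygy, shifted
by one. Later inductions pass from a module to its syzygy in this way. -/
theorem IsKoszulFrom.exists_syzygy {M : GrMod 𝒜} {s : ℤ} (h : IsKoszulFrom M s) :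
    ∃ (P : GrMod 𝒜) (ε : P →ₗ[A] M) (hε : IsHomogeneousMap ε), Module.Projective A P ∧
      GeneratedInDegree P s ∧ Function.Surjective ε ∧
      IsKoszulFrom (GrMod.kernel ε hε) (s + 1) := by
  obtain ⟨-, P, d, ε, hproj, hgen, hd, hε, hs, hex, hexd⟩ := h
  let ε' : P 1 →ₗ[A] GrMod.kernel ε hε :=
    (d 0).codRestrict (LinearMap.ker ε) fun x => (hex (d 0 x)).2 ⟨x, rfl⟩
  have hε' : IsHomogeneousMap ε' := fun j x hx => hd 0 j x hx
  have hs' : Function.Surjective ε' := by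
    rintro ⟨y, hy⟩
    obtain ⟨x, hx⟩ := (hex y).1 hy
    exact ⟨x, Subtype.ext hx⟩
  have hcast : ∀ n : ℕ, s + ((n + 1 : ℕ) : ℤ) = s + 1 + n := fun n => by push_cast; ring
  refine ⟨P 0, ε, hε, hproj 0, by simpa using hgen 0, hs, ?_, fun n => P (n + 1),
    fun n => d (n + 1), ε', fun n => hproj _, fun n => hcast n ▸ hgen (n + 1), fun n => hd _, hε',
    hs', ?_, fun n => hexd _⟩
  · refine GeneratedInDegree.of_surjective ?_ hε' hs'
    simpa using hgen 1
  · intro x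
    rw [← hexd 0 x]
    exact ⟨fun hx => congrArg Subtype.val hx, fun hx => Subtype.ext hx⟩

/-- Minimality of the cover: a kernel with no part in the generating degree lies in `J P`. -/
theorem ker_le_smul_top {P M : GrMod 𝒜} {s : ℤ} (h : GeneratedInDegree P s) {ε : P →ₗ[A] M}
    {hε : IsHomogeneousMap ε} (hk : ∀ x ∈ P.gr s, ε x = 0 → x = 0) :
    LinearMap.ker ε ≤ positiveIdeal 𝒜 • (⊤ : Submodule A P) := by
  intro x hx
  refine h.mem_smul_top (hk _ (P.proj_mem s x) ?_)
  rw [← GrMod.map_proj hε, LinearMap.mem_ker.1 hx, map_zero]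

theorem GeneratedInDegree.ker_injective {P M : GrMod 𝒜} {s : ℤ} {ε : P →ₗ[A] M}
    {hε : IsHomogeneousMap ε} (hk : GeneratedInDegree (GrMod.kernel ε hε) (s + 1)) :
    ∀ x ∈ P.gr s, ε x = 0 → x = 0 := by
  intro x hx h
  have := hk.gr_eq_zero (lt_add_one s) (x := (⟨x, h⟩ : LinearMap.ker ε)) hx
  exact congrArg Subtype.val this

/-- If the syzygy is generated in degree one higher, its maps to `A₀` extend. -/
theorem exists_extension_of_generated [Module.Injective (degreeZero 𝒜) (degreeZero 𝒜)]
    {P M : GrMod 𝒜} {s : ℤ} (h : GeneratedInDegree P s) {ε : P →ₗ[A] M}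
    {hε : IsHomogeneousMap ε} (hk : GeneratedInDegree (GrMod.kernel ε hε) (s + 1))
    (hJ : LinearMap.ker ε ≤ positiveIdeal 𝒜 • (⊤ : Submodule A P))
    (g : LinearMap.ker ε →ₗ[A] ZeroModule 𝒜) :
    ∃ h : ↥(positiveIdeal 𝒜 • (⊤ : Submodule A P)) →ₗ[A] ZeroModule 𝒜,
      g = h.comp (Submodule.inclusion hJ) := by
  have hinj : Module.Injective (degreeZero 𝒜) (ZeroModule 𝒜) := injective_zeroModule
  let i : (GrMod.kernel ε hε).comp (s + 1) →ₗ[degreeZero 𝒜] P.comp (s + 1) :=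
    { toFun := fun x => ⟨x.1.1, x.2⟩, map_add' := fun _ _ => rfl, map_smul' := fun _ _ => rfl }
  have hi : Function.Injective i := fun x y hxy =>
    Subtype.ext (Subtype.ext (congrArg (fun z : P.comp (s + 1) => (z : P)) hxy))
  -- Self-injectivity of `A₀` extends `g` from `Ω_{s+1}` to `P_{s+1}`. Precomposing with the
  -- projection to degree `s + 1` is `A`-linear on `J P`, because `J · J P` has no component there
  -- and `J` kills `A₀`.
  obtain ⟨l, hl⟩ := hinj.out i hi ((g.restrictScalars (degreeZero 𝒜)).comp
    ((GrMod.kernel ε hε).comp (s + 1)).subtype)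
  let h' : ↥(positiveIdeal 𝒜 • (⊤ : Submodule A P)) →ₗ[degreeZero 𝒜] ZeroModule 𝒜 :=
    l.comp ((P.projComp (s + 1)).comp
      ((positiveIdeal 𝒜 • (⊤ : Submodule A P)).subtype.restrictScalars (degreeZero 𝒜)))
  refine ⟨extendLinear h' fun a ha x => ?_, ?_⟩
  · rw [smul_eq_zero_of_mem_positiveIdeal ha]
    have : P.projComp (s + 1) (a • x.1) = 0 := by
      refine Subtype.ext ((Submodule.mem_bot A).1
        (P.proj_smul_mem_of_mem_positiveIdeal (fun j hj => ?_) ha))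
      rw [Submodule.mem_bot]
      exact h.proj_eq_zero_of_mem_smul_top x.2 (by omega)
    change l (P.projComp (s + 1) (a • x.1)) = 0
    rw [this, map_zero]
  · refine hk.linearMap_ext (M := GrMod.kernel ε hε) fun x hx => ?_
    have h1 := hl ⟨x, hx⟩
    refine h1.symm.trans ?_
    change _ = l (P.projComp (s + 1) x.1)
    congr 1
    exact Subtype.ext (GrMod.proj_of_mem (show x.1 ∈ P.gr (s + 1) from hx)).symm

theorem IsKoszulFrom.quasiKoszulAt [Module.Injective (degreeZero 𝒜) (degreeZero 𝒜)] (i : ℕ) :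
    ∀ {M : GrMod 𝒜} {s : ℤ}, IsKoszulFrom M s → QuasiKoszulAt 𝒜 M i := by
  induction i with
  | zero =>
    intro M s h
    obtain ⟨P, ε, hε, hP, hgen, hs, hΩ⟩ := h.exists_syzygy
    have := hgen.finite
    have hJ := ker_le_smul_top (hε := hε) hgen hΩ.1.ker_injective
    exact QuasiKoszulAt.zero hs hJ (exists_extension_of_generated hgen hΩ.1 hJ)
  | succ i ih =>
    intro M s h
    obtain ⟨P, ε, hε, hP, hgen, hs, hΩ⟩ := h.exists_syzygy
    exact QuasiKoszulAt.succ hs (ih hΩ)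

/-- `M_{s+i}` is the quotient of `P_{s+i}` by `Ω_{s+i}`, which is projective by induction since `Ω`
starts in degree `s + 1`; being also finitely generated, it is injective and the sequence splits.
Requiring only `A_j` with `j ≤ i` is what permits the induction in `projective_of_isKoszulAlgebra`.
-/
theorem IsKoszulFrom.projective_comp [Module.Injective (degreeZero 𝒜) (degreeZero 𝒜)] (i : ℕ) :
    ∀ {M : GrMod 𝒜} {s : ℤ}, IsKoszulFrom M s →
      (∀ j ≤ i, Module.Projective (degreeZero 𝒜) ((freeGrMod 𝒜 1 0).comp j)) →
      Module.Projective (degreeZero 𝒜) (M.comp (s + i)) := by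
  induction i with
  | zero =>
    intro M s h hA
    obtain ⟨P, ε, hε, hP, hgen, hs, hΩ⟩ := h.exists_syzygy
    have := hA 0 le_rfl
    have := projective_comp_of_generated hgen 0
    have hb : Function.Bijective (GrMod.mapComp ε hε (s + (0 : ℕ))) := by
      refine ⟨?_, GrMod.mapComp_surjective hε hs _⟩
      rw [← LinearMap.ker_eq_bot, LinearMap.ker_eq_bot']
      rintro ⟨x, hx⟩ h0
      rw [GrMod.mem_comp, Nat.cast_zero, add_zero] at hx
      exact Subtype.ext (hΩ.1.ker_injective x hx (congrArg Subtype.val h0))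
    exact Module.Projective.of_equiv' (LinearEquiv.ofBijective _ hb)
  | succ i ih =>
    intro M s h hA
    obtain ⟨P, ε, hε, hP, hgen, hs, hΩ⟩ := h.exists_syzygy
    have := hA (i + 1) le_rfl
    have := projective_comp_of_generated hgen (i + 1)
    have hcast : s + 1 + i = s + ((i + 1 : ℕ) : ℤ) := by push_cast; ring
    have h1 : Module.Projective (degreeZero 𝒜)
        ((GrMod.kernel ε hε).comp (s + ((i + 1 : ℕ) : ℤ))) := by
      rw [← hcast]
      exact ih hΩ fun j hj => hA j (by omega)
    have : Module.Projective (degreeZero 𝒜)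
        (LinearMap.ker (GrMod.mapComp ε hε (s + ((i + 1 : ℕ) : ℤ)))) :=
      Module.Projective.of_equiv' (GrMod.kernelCompEquiv ε hε _)
    have : Module.Finite (degreeZero 𝒜)
        (LinearMap.ker (GrMod.mapComp ε hε (s + ((i + 1 : ℕ) : ℤ)))) :=
      Module.Finite.equiv (GrMod.kernelCompEquiv ε hε _)
    have := injective_of_projective_of_finite (R := degreeZero 𝒜)
      (LinearMap.ker (GrMod.mapComp ε hε (s + ((i + 1 : ℕ) : ℤ))))
    exact projective_of_injective_ker _ (GrMod.mapComp_surjective hε hs _)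

end Graded

/-! ### Koszul modules over a finite-dimensional graded algebra -/

section KoszulAlgebra

variable {k : Type w} {A : Type u} [Field k] [Ring A] [Algebra k A] {𝒜 : ℕ → Submodule k A}
  [GradedAlgebra 𝒜]

/-- From `x = -(u - 1) • x`, where `u - 1` raises degrees, the components of `x` vanish one after
another, starting from the bottom. -/
theorem GeneratedInDegree.eq_zero_of_smul_eq_zero {M : GrMod 𝒜} {s : ℤ}
    (h : GeneratedInDegree M s) {u : A} (hu : u - 1 ∈ positiveIdeal 𝒜) {x : M}
    (hx : u • x = 0) : x = 0 := by
  have hx' : x = -((u - 1) • x) := by rw [sub_smul, hx, one_smul, zero_sub, neg_neg]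
  have key : ∀ n : ℕ, ∀ j < s + n, M.proj j x = 0 := by
    intro n
    induction n with
    | zero => intro j hj; exact h.proj_eq_zero (by simpa using hj) x
    | succ n ih =>
      intro j hj
      rw [hx', map_neg, neg_eq_zero, ← Submodule.mem_bot A]
      refine M.proj_smul_mem_of_mem_positiveIdeal (fun i hi => ?_) hu
      rw [Submodule.mem_bot]
      exact ih i (by push_cast at hj; omega)
  refine GrMod.ext_proj fun j => ?_
  rw [map_zero]
  exact key (j - s + 1).toNat j (by omega)

variable [FiniteDimensional k A]

/-- Left multiplication by `u` is injective, hence surjective in finite dimension. -/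
theorem exists_mul_eq_one_of_sub_mem {u : A} (hu : u - 1 ∈ positiveIdeal 𝒜) : ∃ v, u * v = 1 := by
  have hinj : Function.Injective (LinearMap.mulLeft k u) := by
    rw [← LinearMap.ker_eq_bot, LinearMap.ker_eq_bot']
    intro a ha
    have := (freeGrMod_generated (𝒜 := 𝒜) 1 0).eq_zero_of_smul_eq_zero hu
      (x := (fun _ => a : Fin 1 → A)) (funext fun _ => ha)
    exact congrFun this 0
  exact LinearMap.injective_iff_surjective.1 hinj 1

instance projective_comp_freeGrMod_zero :
    Module.Projective (degreeZero 𝒜) ((freeGrMod 𝒜 1 0).comp (0 : ℕ)) := by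
  have hs : shiftPart 𝒜 0 ((0 : ℕ) : ℤ) = 𝒜 0 := by simp [shiftPart]
  let f : (freeGrMod 𝒜 1 0).comp (0 : ℕ) →ₗ[degreeZero 𝒜] degreeZero 𝒜 :=
    { toFun := fun x => ⟨x.1 0, by
        have := x.2 0 trivial
        change _ ∈ shiftPart 𝒜 0 ((0 : ℕ) : ℤ) at this
        rwa [hs] at this⟩
      map_add' := fun _ _ => rfl
      map_smul' := fun _ _ => rfl }
  let g : degreeZero 𝒜 →ₗ[degreeZero 𝒜] (freeGrMod 𝒜 1 0).comp (0 : ℕ) :=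
    { toFun := fun r => ⟨fun _ => r, fun t _ => by
        change _ ∈ shiftPart 𝒜 0 ((0 : ℕ) : ℤ)
        rw [hs]
        exact r.2⟩
      map_add' := fun _ _ => rfl
      map_smul' := fun _ _ => rfl }
  refine Module.Projective.of_split f g (LinearMap.ext fun x => Subtype.ext ?_)
  funext t
  rw [Subsingleton.elim t 0]
  rfl

theorem projective_of_comp_freeGrMod
    (h : ∀ i : ℕ, Module.Projective (degreeZero 𝒜) ((freeGrMod 𝒜 1 0).comp i)) :
    Module.Projective (degreeZero 𝒜) A := by
  have : Module.Projective (degreeZero 𝒜) (freeGrMod 𝒜 1 0) := by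
    refine GrMod.projective_of_comp _ fun j => ?_
    rcases le_or_gt 0 j with hj | hj
    · obtain ⟨i, rfl⟩ := Int.eq_ofNat_of_zero_le hj
      exact h i
    · have := GrMod.subsingleton_comp
        fun x hx => (freeGrMod_generated (𝒜 := 𝒜) 1 0).gr_eq_zero hj (x := x) hx
      infer_instance
  have : Module.Projective (degreeZero 𝒜) (Fin 1 → A) := this
  exact Module.Projective.of_equiv' (P := A) (M := Fin 1 → A)
    (LinearEquiv.funUnique (Fin 1) (degreeZero 𝒜) A)

theorem projective_freeGrMod [Module.Projective (degreeZero 𝒜) A] (n : ℕ) (s : ℤ) :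
    Module.Projective (degreeZero 𝒜) (freeGrMod 𝒜 n s) := by
  change Module.Projective (degreeZero 𝒜) (Fin n → A)
  exact Module.Projective.of_equiv' (M := Π₀ _ : Fin n, A)
    (DFinsupp.linearEquivFunOnFintype (R := degreeZero 𝒜))

theorem zeroGrMod_generated : GeneratedInDegree (zeroGrMod 𝒜) 0 := by
  refine eq_top_iff.2 fun x _ => Submodule.subset_span ?_
  change x ∈ (if (0 : ℤ) = 0 then ⊤ else ⊥ : Submodule k (ZeroModule 𝒜))
  rw [if_pos rfl]
  trivial

theorem zeroGrMod_eq_zero {j : ℤ} (hj : j ≠ 0) {x : zeroGrMod 𝒜} (hx : x ∈ (zeroGrMod 𝒜).gr j) :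
    x = 0 := by
  change x ∈ (if j = 0 then ⊤ else ⊥ : Submodule k (ZeroModule 𝒜)) at hx
  rwa [if_neg hj] at hx

theorem projective_of_isKoszulAlgebra [Module.Injective (degreeZero 𝒜) (degreeZero 𝒜)]
    (h : IsKoszulAlgebra 𝒜) : Module.Projective (degreeZero 𝒜) A := by
  obtain ⟨P, ε, hε, hP, hgen, hs, hΩ⟩ := (isKoszulFrom_zero_iff.2 h).exists_syzygy
  refine projective_of_comp_freeGrMod fun i => ?_
  induction i using Nat.strong_induction_on with
  | _ i ih =>
  rcases Nat.eq_zero_or_pos i with rfl | hi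
  · infer_instance
  -- For `i > 0` the module `A₀` has no degree `i` part, so `P_i = Ω_i`. As `Ω` starts in degree
  -- `1`, its degree `i` part involves only `A_j` with `j < i`.
  have h1 : Module.Projective (degreeZero 𝒜) (P.comp i) := by
    obtain ⟨l, rfl⟩ : ∃ l, i = l + 1 := ⟨i - 1, by omega⟩
    have hcast : (0 : ℤ) + 1 + l = ((l + 1 : ℕ) : ℤ) := by push_cast; ring
    have h2 : Module.Projective (degreeZero 𝒜)
        ((GrMod.kernel ε hε).comp ((l + 1 : ℕ) : ℤ)) := by
      rw [← hcast]
      exact hΩ.projective_comp l fun j hj => ih j (by omega)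
    have htop : LinearMap.ker (GrMod.mapComp ε hε ((l + 1 : ℕ) : ℤ)) = ⊤ := by
      refine eq_top_iff.2 fun x _ => Subtype.ext ?_
      exact zeroGrMod_eq_zero (by omega) (hε _ _ x.2)
    exact Module.Projective.of_equiv' ((GrMod.kernelCompEquiv ε hε _).trans
      ((LinearEquiv.ofEq _ _ htop).trans Submodule.topEquiv))
  obtain ⟨x, hx⟩ := hs (Submodule.Quotient.mk (p := positiveIdeal 𝒜) 1)
  set p : P := P.proj 0 x with hp
  have hp0 : p ∈ P.gr 0 := P.proj_mem 0 x
  have hεp : ε p = (positiveIdeal 𝒜).mkQ 1 := by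
    rw [hp, ← GrMod.map_proj hε, hx]
    refine GrMod.proj_of_mem (M := zeroGrMod 𝒜) ?_
    change _ ∈ (if (0 : ℤ) = 0 then ⊤ else ⊥ : Submodule k (ZeroModule 𝒜))
    rw [if_pos rfl]
    trivial
  -- `A` is a retract of `P`: `1 ↦ p` is homogeneous, and `r p ≡ 1` modulo `J` has a right inverse
  -- `v`, so `r` followed by right multiplication by `v` is a retraction, not necessarily
  -- homogeneous.
  obtain ⟨r, hr⟩ := Module.projective_lifting_property (positiveIdeal 𝒜).mkQ ε
    (surjective_mkQ_positiveIdeal 𝒜)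
  have hrp : r p - 1 ∈ positiveIdeal 𝒜 := by
    rw [← ker_mkQ_positiveIdeal 𝒜, LinearMap.mem_ker, map_sub, ← hεp, ← hr]
    exact sub_self _
  obtain ⟨v, hv⟩ := exists_mul_eq_one_of_sub_mem hrp
  let g : P →ₗ[A] freeGrMod 𝒜 1 0 := LinearMap.pi (φ := fun _ : Fin 1 => A) fun _ =>
    (LinearMap.toSpanSingleton A A v).comp r
  refine GrMod.projective_comp_of_retract (X := freeGrMod 𝒜 1 0) (Y := P)
    ((Fintype.linearCombination A fun _ : Fin 1 => p).restrictScalars (degreeZero 𝒜))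
    (g.restrictScalars (degreeZero 𝒜)) ?_
    (Or.inl fun j y hy => isHomogeneousMap_linearCombination (fun _ => hp0) j y hy) _
  refine LinearMap.ext fun (y : Fin 1 → A) => funext fun t => ?_
  rw [Subsingleton.elim t 0]
  change r (Fintype.linearCombination A (fun _ : Fin 1 => p) y) * v = y 0
  simp [Fintype.linearCombination_apply, mul_assoc, hv]

/-- Every finite-dimensional module generated in degree `s` and projective over `A₀` has a
projective cover generated in degree `s`. -/
theorem exists_cover {M : GrMod 𝒜} {s : ℤ} (hM : GeneratedInDegree M s)
    [Module.Projective (degreeZero 𝒜) A] [Module.Projective (degreeZero 𝒜) M] :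
    ∃ (P : GrMod 𝒜) (ε : P →ₗ[A] M), IsHomogeneousMap ε ∧ Module.Projective A P ∧
      Module.Projective (degreeZero 𝒜) P ∧
      GeneratedInDegree P s ∧ Function.Surjective ε ∧ ∀ x ∈ P.gr s, ε x = 0 → x = 0 := by
  classical
  obtain ⟨n, m, hm, hspan⟩ := GeneratedInDegree.exists_generators M s
  have := M.projective_comp s
  let m' : Fin n → M.comp s := fun t => ⟨m t, hm t⟩
  let π : (Fin n → degreeZero 𝒜) →ₗ[degreeZero 𝒜] M.comp s := Fintype.linearCombination _ m'
  have hπ : Function.Surjective π := by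
    rintro ⟨x, hx⟩
    have hx' : x ∈ Submodule.span k (Set.range m) := hspan ▸ hx
    obtain ⟨c, rfl⟩ := (Submodule.mem_span_range_iff_exists_fun k).1 hx'
    refine ⟨fun t => algebraMap k _ (c t), Subtype.ext ?_⟩
    simp [π, Fintype.linearCombination_apply, m']
  obtain ⟨σ, hσ⟩ := Module.projective_lifting_property π LinearMap.id hπ
  have hσ' : ∀ x, π (σ x) = x := fun x => LinearMap.congr_fun hσ x
  let coe : (Fin n → degreeZero 𝒜) →ₗ[degreeZero 𝒜] (Fin n → A) :=
    { toFun := fun y t => y t, map_add' := fun _ _ => rfl, map_smul' := fun _ _ => rfl }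
  have hs0 : shiftPart 𝒜 s s = 𝒜 0 := by
    have := shiftPart_add (𝒜 := 𝒜) s 0
    simpa using this
  have hcoe : ∀ y, coe y ∈ (freeGrMod 𝒜 n s).gr s := fun y t _ => by
    change _ ∈ shiftPart 𝒜 s s
    rw [hs0]
    exact (y t).2
  -- `E` is the `A`-linear extension of the idempotent `σ ∘ π` of `A₀ⁿ`, so its image is a copy of
  -- `A ⊗ M_s` over `A₀`.
  let E : (Fin n → A) →ₗ[A] freeGrMod 𝒜 n s :=
    Fintype.linearCombination A fun t => (coe (σ (m' t)) : freeGrMod 𝒜 n s)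
  have hE : IsHomogeneousMap (M := freeGrMod 𝒜 n s) (N := freeGrMod 𝒜 n s) E :=
    isHomogeneousMap_linearCombination fun t => hcoe _
  have hEcoe : ∀ y, E (coe y) = coe (σ (π y)) := by
    intro y
    have : π y = ∑ t, y t • m' t := rfl
    rw [this, map_sum, map_sum]
    simp only [map_smul]
    rfl
  let e : (Fin n → A) →ₗ[A] M := Fintype.linearCombination A m
  have hecoe : ∀ y, e (coe y) = π y := by
    intro y
    have : π y = ∑ t, y t • m' t := rfl
    rw [this, AddSubmonoidClass.coe_finsetSum]
    rfl
  have hsingle : ∀ t, (Pi.single t 1 : Fin n → A) = coe (Pi.single t 1) := by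
    intro t
    funext t'
    by_cases h : t' = t
    · subst h; simp [coe]
    · simp [coe, h]
  have hEE : ∀ x, E (E x) = E x := by
    intro x
    have : E.comp E = E := by
      refine LinearMap.pi_ext' fun t => LinearMap.ext_ring ?_
      change E (E (Pi.single t 1)) = E (Pi.single t 1)
      rw [hsingle, hEcoe, hEcoe, hσ']
    exact LinearMap.congr_fun this x
  have heE : ∀ x, e (E x) = e x := by
    intro x
    have : e.comp E = e := by
      refine LinearMap.pi_ext' fun t => LinearMap.ext_ring ?_
      change e (E (Pi.single t 1)) = e (Pi.single t 1)
      rw [hsingle, hEcoe, hecoe, hecoe, hσ']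
    exact LinearMap.congr_fun this x
  let N : Submodule A (freeGrMod 𝒜 n s) := LinearMap.range E
  have hN : ∀ x ∈ N, ∀ j, (freeGrMod 𝒜 n s).proj j x ∈ N := by
    rintro _ ⟨x, rfl⟩ j
    exact ⟨(freeGrMod 𝒜 n s).proj j x, (GrMod.map_proj hE j x).symm⟩
  let P := (freeGrMod 𝒜 n s).sub N hN
  let q : freeGrMod 𝒜 n s →ₗ[A] P := LinearMap.rangeRestrict E
  let i : P →ₗ[A] freeGrMod 𝒜 n s := N.subtype
  have hqi : q.comp i = LinearMap.id := by
    refine LinearMap.ext ?_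
    rintro ⟨_, x, rfl⟩
    exact Subtype.ext (hEE x)
  have hproj : Module.Projective A (freeGrMod 𝒜 n s) :=
    inferInstanceAs (Module.Projective A (Fin n → A))
  have hproj0 := projective_freeGrMod (𝒜 := 𝒜) n s
  let ε : P →ₗ[A] M := e.comp i
  refine ⟨P, ε, ?_, Module.Projective.of_split i q hqi,
    Module.Projective.of_split (i.restrictScalars (degreeZero 𝒜))
      (q.restrictScalars (degreeZero 𝒜)) (LinearMap.ext fun x => LinearMap.congr_fun hqi x),
    (freeGrMod_generated n s).of_surjective (f := q) (fun j x hx => hE j x hx)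
      (LinearMap.surjective_rangeRestrict E), ?_, ?_⟩
  · intro j x hx
    exact isHomogeneousMap_linearCombination hm j x.1 hx
  · intro y
    obtain ⟨x, rfl⟩ := hM.surjective_linearCombination hspan y
    exact ⟨q x, heE x⟩
  · rintro x hx h
    obtain ⟨x, hxN⟩ := x
    have hx : ∀ t, x t ∈ 𝒜 0 := fun t => hs0 ▸ hx t trivial
    let y : Fin n → degreeZero 𝒜 := fun t => ⟨x t, hx t⟩
    have hπy : π y = 0 := Subtype.ext ((hecoe y).symm.trans h)
    -- In degree `s` the map `ε` is `π`, so `E` kills `x`; but `E` fixes its own range, which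
    -- contains `x`.
    have h1 : E (coe y) = 0 := by
      rw [hEcoe, hπy, map_zero, map_zero]
      rfl
    obtain ⟨z, rfl⟩ := hxN
    exact Subtype.ext ((hEE z).symm.trans h1)

/-- The hypotheses on a module which pass to its syzygy. -/
def IsLinearCandidate (M : GrMod 𝒜) (s : ℤ) : Prop :=
  GeneratedInDegree M s ∧ Module.Projective (degreeZero 𝒜) M ∧ IsQuasiKoszulModule 𝒜 M

theorem IsLinearCandidate.exists_syzygy [Module.Projective (degreeZero 𝒜) A]
    (hmul : ∀ i j, 𝒜 i * 𝒜 j = 𝒜 (i + j))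
    (hcog : ∀ {X : Type u} [AddCommGroup X] [Module (degreeZero 𝒜) X] {x : X}, x ≠ 0 →
      ∃ f : X →ₗ[degreeZero 𝒜] degreeZero 𝒜, f x ≠ 0)
    {M : GrMod 𝒜} {s : ℤ} (hM : IsLinearCandidate M s) :
    ∃ (P : GrMod 𝒜) (ε : P →ₗ[A] M) (hε : IsHomogeneousMap ε), Module.Projective A P ∧
      GeneratedInDegree P s ∧ Function.Surjective ε ∧
      IsLinearCandidate (GrMod.kernel ε hε) (s + 1) := by
  obtain ⟨hgenM, hprojM, hqk⟩ := hM
  obtain ⟨P, ε, hε, hP, hP0, hgen, hs, hk⟩ := exists_cover hgenM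
  have hJ := ker_le_smul_top (hε := hε) hgen hk
  refine ⟨P, ε, hε, hP, hgen, hs, ?_, projective_ker (ε.restrictScalars (degreeZero 𝒜)) hs,
    hqk.ker hs hJ⟩
  set Ω := GrMod.kernel ε hε with hΩ
  have hlow : ∀ j ≤ s, ∀ x ∈ Ω.gr j, x = 0 := by
    intro j hj x hx
    rcases hj.lt_or_eq with h | rfl
    · exact Subtype.ext (hgen.gr_eq_zero h hx)
    · exact Subtype.ext (hk _ hx x.2)
  -- No minimal generator of `Ω` has degree `s + 2` or more: a map `Ω / JΩ → A₀` detecting it would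
  -- extend to `J P` and vanish on `J² P`, which contains `x`.
  have hrad : ∀ i : ℕ, ∀ x ∈ Ω.gr (s + (i + 2 : ℕ)),
      x ∈ positiveIdeal 𝒜 • (⊤ : Submodule A Ω) := by
    intro i x hx
    by_contra hne
    have hne' : (Submodule.Quotient.mk x : Ω ⧸ positiveIdeal 𝒜 • (⊤ : Submodule A Ω)) ≠ 0 := by
      rwa [Ne, Submodule.Quotient.mk_eq_zero]
    obtain ⟨f, hf⟩ := hcog hne'
    let g₀ : Ω →ₗ[degreeZero 𝒜] ZeroModule 𝒜 := (zeroModuleMap 𝒜).comp (f.comp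
      ((positiveIdeal 𝒜 • (⊤ : Submodule A Ω)).mkQ.restrictScalars (degreeZero 𝒜)))
    let g : LinearMap.ker ε →ₗ[A] ZeroModule 𝒜 := extendLinear (X := Ω) g₀ fun a ha y => by
      rw [smul_eq_zero_of_mem_positiveIdeal ha]
      have : (positiveIdeal 𝒜 • (⊤ : Submodule A Ω)).mkQ (a • y) = 0 :=
        (Submodule.Quotient.mk_eq_zero _).2 (Submodule.smul_mem_smul ha trivial)
      change zeroModuleMap 𝒜 (f ((positiveIdeal 𝒜 • (⊤ : Submodule A Ω)).mkQ (a • y))) = 0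
      rw [this, map_zero, map_zero]
    have hgx : g x ≠ 0 := fun h => hf
      ((zeroModuleMap_bijective 𝒜).1 (h.trans (map_zero (zeroModuleMap 𝒜)).symm))
    obtain ⟨h, hh⟩ := hqk.exists_extension hs hJ g
    apply hgx
    have key : ∀ y ∈ positiveIdeal 𝒜 • positiveIdeal 𝒜 • (⊤ : Submodule A P),
        ∃ hy : y ∈ positiveIdeal 𝒜 • (⊤ : Submodule A P), h ⟨y, hy⟩ = 0 := by
      intro y hy
      induction hy using Submodule.smul_induction_on' with
      | smul a ha y hy =>
        exact ⟨Submodule.smul_mem _ _ hy,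
          (h.map_smul a ⟨y, hy⟩).trans (smul_eq_zero_of_mem_positiveIdeal ha _)⟩
      | add y _ z _ hy hz =>
        obtain ⟨hy, hy'⟩ := hy
        obtain ⟨hz, hz'⟩ := hz
        exact ⟨add_mem hy hz, (h.map_add ⟨y, hy⟩ ⟨z, hz⟩).trans (by rw [hy', hz', add_zero])⟩
    obtain ⟨_, h0⟩ := key _ (hgen.mem_smul_smul_top hmul (show x.1 ∈ _ from hx))
    rw [hh]
    exact h0
  -- Graded Nakayama: beyond degree `s + 1` elements lie in `J Ω`, hence come from lower degrees.
  have hall : ∀ i : ℕ, ∀ x ∈ Ω.gr (s + 1 + i),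
      x ∈ Submodule.span A (Ω.gr (s + 1) : Set Ω) := by
    intro i
    induction i using Nat.strong_induction_on with
    | _ i ih =>
    intro x hx
    rcases Nat.eq_zero_or_pos i with rfl | hi
    · exact Submodule.subset_span (by simpa using hx)
    obtain ⟨l, rfl⟩ : ∃ l, i = l + 1 := ⟨i - 1, by omega⟩
    have hcast : s + 1 + ((l + 1 : ℕ) : ℤ) = s + (l + 2 : ℕ) := by push_cast; ring
    rw [← GrMod.proj_of_mem hx]
    refine Ω.proj_mem_of_mem_smul_top (fun j hj y hy => ?_) (hrad l x (hcast ▸ hx))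
    rcases le_or_gt j s with hjs | hjs
    · rw [hlow j hjs y hy]
      exact zero_mem _
    · obtain ⟨t, rfl⟩ := Int.le.dest (show s + 1 ≤ j by omega)
      exact ih t (by omega) y hy
  refine eq_top_iff.2 fun x _ => Ω.mem_of_proj_mem _ x fun j => ?_
  rcases le_or_gt j s with hjs | hjs
  · rw [hlow j hjs _ (Ω.proj_mem j x)]
    exact zero_mem _
  · obtain ⟨t, rfl⟩ := Int.le.dest (show s + 1 ≤ j by omega)
    exact hall t _ (Ω.proj_mem _ x)

/-- A property of graded modules which passes to syzygies of linear covers yields linear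
resolutions. -/
theorem isKoszulFrom_of_syzygy (p : GrMod 𝒜 → ℤ → Prop)
    (hgen : ∀ M s, p M s → GeneratedInDegree M s)
    (hstep : ∀ M s, p M s → ∃ (P : GrMod 𝒜) (ε : P →ₗ[A] M) (hε : IsHomogeneousMap ε),
      Module.Projective A P ∧ GeneratedInDegree P s ∧ Function.Surjective ε ∧
      p (GrMod.kernel ε hε) (s + 1)) {M : GrMod 𝒜} {s : ℤ} (h : p M s) : IsKoszulFrom M s := by
  choose! P ε hε hP hPgen hs hp using hstep
  let next : (x : Σ' (M : GrMod 𝒜) (s : ℤ), p M s) → Σ' (M : GrMod 𝒜) (s : ℤ), p M s :=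
    fun x => ⟨GrMod.kernel (ε x.1 x.2.1) (hε x.1 x.2.1 x.2.2), x.2.1 + 1, hp x.1 x.2.1 x.2.2⟩
  -- The iterated syzygies, each with its generating degree and the property `p`; splicing their
  -- covers gives the resolution.
  let seq : ℕ → Σ' (M : GrMod 𝒜) (s : ℤ), p M s := fun n => Nat.rec ⟨M, s, h⟩ (fun _ => next) n
  have hdeg : ∀ n, (seq n).2.1 = s + n := by
    intro n
    induction n with
    | zero => simp [seq]
    | succ n ih =>
      change (seq n).2.1 + 1 = _
      rw [ih]
      push_cast
      ring
  refine ⟨hgen M s h, fun n => P (seq n).1 (seq n).2.1,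
    fun n => (LinearMap.ker (ε (seq n).1 (seq n).2.1)).subtype.comp
      (ε (seq (n + 1)).1 (seq (n + 1)).2.1), ε M s, fun n => hP _ _ (seq n).2.2,
    fun n => hdeg n ▸ hPgen _ _ (seq n).2.2, fun n j x hx => hε _ _ (seq (n + 1)).2.2 j x hx,
    hε M s h, hs M s h, ?_, ?_⟩
  · intro x
    constructor
    · intro hx
      obtain ⟨y, hy⟩ := hs _ _ (seq 1).2.2 ⟨x, hx⟩
      exact ⟨y, congrArg Subtype.val hy⟩
    · rintro ⟨y, rfl⟩
      exact (ε (seq 1).1 (seq 1).2.1 y).2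
  · intro n x
    constructor
    · intro hx
      have hx' : ε (seq (n + 1)).1 (seq (n + 1)).2.1 x = 0 := Subtype.ext hx
      obtain ⟨y, hy⟩ := hs _ _ (seq (n + 1 + 1)).2.2 ⟨x, hx'⟩
      exact ⟨y, congrArg Subtype.val hy⟩
    · rintro ⟨y, rfl⟩
      exact congrArg Subtype.val (ε (seq (n + 1 + 1)).1 (seq (n + 1 + 1)).2.1 y).2

theorem isKoszulModule_iff [Module.Injective (degreeZero 𝒜) (degreeZero 𝒜)]
    [Module.Projective (degreeZero 𝒜) A]
    (hmul : ∀ i j, 𝒜 i * 𝒜 j = 𝒜 (i + j))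
    (hcog : ∀ {X : Type u} [AddCommGroup X] [Module (degreeZero 𝒜) X] {x : X}, x ≠ 0 →
      ∃ f : X →ₗ[degreeZero 𝒜] degreeZero 𝒜, f x ≠ 0)
    {M : GrMod 𝒜} (hM : GeneratedInDegree M 0) :
    IsKoszulModule M ↔ IsQuasiKoszulModule 𝒜 M ∧ Module.Projective (degreeZero 𝒜) M := by
  rw [← isKoszulFrom_zero_iff]
  constructor
  · intro h
    refine ⟨fun i => h.quasiKoszulAt i, M.projective_of_comp fun j => ?_⟩
    rcases lt_or_ge j 0 with hj | hj
    · have := GrMod.subsingleton_comp fun x hx => hM.gr_eq_zero hj (x := x) hx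
      infer_instance
    · obtain ⟨i, rfl⟩ := Int.eq_ofNat_of_zero_le hj
      have := projective_freeGrMod (𝒜 := 𝒜) 1 0
      have := h.projective_comp i fun j _ => GrMod.projective_comp _ _
      rwa [zero_add] at this
  · rintro ⟨hq, hp⟩
    exact isKoszulFrom_of_syzygy IsLinearCandidate (fun _ _ h => h.1)
      (fun _ _ h => h.exists_syzygy hmul hcog) ⟨hM, hp, hq⟩

theorem isKoszulAlgebra_iff [Module.Injective (degreeZero 𝒜) (degreeZero 𝒜)]
    (hmul : ∀ i j, 𝒜 i * 𝒜 j = 𝒜 (i + j))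
    (hcog : ∀ {X : Type u} [AddCommGroup X] [Module (degreeZero 𝒜) X] {x : X}, x ≠ 0 →
      ∃ f : X →ₗ[degreeZero 𝒜] degreeZero 𝒜, f x ≠ 0) :
    IsKoszulAlgebra 𝒜 ↔ Module.Projective (degreeZero 𝒜) A ∧ IsQuasiKoszulAlgebra 𝒜 := by
  constructor
  · intro h
    have := projective_of_isKoszulAlgebra h
    exact ⟨this, ((isKoszulModule_iff hmul hcog zeroGrMod_generated).1 h).1⟩
  · rintro ⟨hp, hq⟩
    exact (isKoszulModule_iff hmul hcog zeroGrMod_generated).2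
      ⟨hq, Module.Projective.of_equiv' (zeroModuleEquiv 𝒜)⟩

end KoszulAlgebra

/-! ### The associated algebra: idempotents and standard modules -/

section CategoryAlgebra

variable {k : Type w} [Field k] {C : Type u} [Category.{v} C] [Preadditive C] [Fintype C]

namespace CatAlg

theorem ofHom_apply_self {x y : C} (f : x ⟶ y) : ofHom f x y = f := by
  simp [ofHom]

theorem ofHom_apply_ne {x y x' y' : C} (f : x ⟶ y) (h : ¬(x = x' ∧ y = y')) :
    ofHom f x' y' = 0 := by
  simp [ofHom, h]

theorem ofHom_mul_apply {x y : C} (f : x ⟶ y) (a : CatAlg C) (t : C) :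
    (ofHom f * a) t y = a t x ≫ f := by
  rw [mul_apply, Finset.sum_eq_single x]
  · rw [ofHom_apply_self]
  · intro z _ hz
    rw [ofHom_apply_ne f (fun h => hz h.1.symm), Limits.comp_zero]
  · simp

theorem ofHom_mul_apply_ne {x y : C} (f : x ⟶ y) (a : CatAlg C) (t : C) {z : C} (h : y ≠ z) :
    (ofHom f * a) t z = 0 := by
  rw [mul_apply]
  exact Finset.sum_eq_zero fun _ _ => by rw [ofHom_apply_ne f (fun h' => h h'.2), Limits.comp_zero]

theorem mul_ofHom_apply {x y : C} (f : x ⟶ y) (a : CatAlg C) (t : C) :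
    (a * ofHom f) x t = f ≫ a y t := by
  rw [mul_apply, Finset.sum_eq_single y]
  · rw [ofHom_apply_self]
  · intro z _ hz
    rw [ofHom_apply_ne f (fun h => hz h.2.symm), Limits.zero_comp]
  · simp

theorem mul_ofHom_apply_ne {x y : C} (f : x ⟶ y) (a : CatAlg C) (t : C) {z : C} (h : x ≠ z) :
    (a * ofHom f) z t = 0 := by
  rw [mul_apply]
  exact Finset.sum_eq_zero fun _ _ => by rw [ofHom_apply_ne f (fun h' => h h'.1), Limits.zero_comp]

/-- Evaluation of an element of the associated algebra at a pair of objects. -/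
def eval (x y : C) : CatAlg C →+ (x ⟶ y) where
  toFun a := a x y
  map_zero' := rfl
  map_add' _ _ := rfl

theorem sum_apply {ι : Type*} (s : Finset ι) (a : ι → CatAlg C) (x y : C) :
    (∑ i ∈ s, a i) x y = ∑ i ∈ s, a i x y :=
  map_sum (eval x y) a s

end CatAlg

variable [Linear k C]

namespace CatGrading

variable (G : CatGrading k C)

theorem gr_self_eq_zero {i : ℕ} (hi : i ≠ 0) {x : C} {f : x ⟶ x} (hf : f ∈ G.gr i x x) : f = 0 := by
  have h := (G.isInternal x x).submodule_iSupIndep.pairwiseDisjoint hi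
  exact Submodule.disjoint_def.1 h f hf
    (show f ∈ G.gr 0 x x by rw [G.zero_self]; trivial)

theorem mem_part_zero_iff {a : CatAlg C} : a ∈ G.part 0 ↔ ∀ x y, x ≠ y → a x y = 0 := by
  constructor
  · intro h x y hxy
    have := h x y
    rwa [G.zero_ne x y hxy] at this
  · intro h x y
    by_cases hxy : x = y
    · subst hxy
      rw [G.zero_self]
      trivial
    · rw [h x y hxy]
      exact zero_mem _

theorem decompose_zero_apply_self (a : CatAlg C) (x : C) :
    (DirectSum.decompose G.part a 0 : CatAlg C) x x = a x x := by
  induction a using DirectSum.Decomposition.inductionOn G.part with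
  | zero => simp
  | @homogeneous i a =>
    by_cases hi : i = 0
    · subst hi
      rw [DirectSum.decompose_of_mem_same G.part a.2]
    · rw [DirectSum.decompose_of_mem_ne G.part a.2 hi, CatAlg.zero_apply,
        G.gr_self_eq_zero hi (a.2 x x)]
  | add a b ha hb =>
    rw [DirectSum.decompose_add, DirectSum.add_apply, Submodule.coe_add, CatAlg.add_apply, ha, hb,
      CatAlg.add_apply]

/-- Diagonal entries are purely of degree zero and off-diagonal entries have no degree zero part.
This translates the grading into the language of directedness. -/
theorem mem_positiveIdeal_iff_apply {a : CatAlg C} :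
    a ∈ positiveIdeal G.part ↔ ∀ x, a x x = 0 := by
  rw [mem_positiveIdeal_iff]
  constructor
  · intro h x
    rw [← G.decompose_zero_apply_self a x, h, CatAlg.zero_apply]
  · intro h
    ext x y
    by_cases hxy : x = y
    · subst hxy
      rw [G.decompose_zero_apply_self, h, CatAlg.zero_apply]
    · exact G.mem_part_zero_iff.1 (SetLike.coe_mem _) x y hxy

theorem mul_apply_self {a : CatAlg C} (b : CatAlg C) (ha : a ∈ G.part 0) (x : C) :
    (a * b) x x = b x x ≫ a x x := by
  rw [CatAlg.mul_apply, Finset.sum_eq_single x]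
  · intro z _ hz
    rw [G.mem_part_zero_iff.1 ha z x hz, Limits.comp_zero]
  · simp

end CatGrading

namespace PrimitiveSystem

variable (E : PrimitiveSystem C) (G : CatGrading k C)

instance : Fintype E.Index := inferInstanceAs (Fintype (Σ x : C, {e : End x // e ∈ E.idem x}))

/-- The element of the associated algebra corresponding to a primitive idempotent. -/
def elt (l : E.Index) : CatAlg C := CatAlg.ofHom (l.2.1 : l.1 ⟶ l.1)

theorem elt_mem (l : E.Index) : E.elt l ∈ G.part 0 :=
  G.mem_part_zero_iff.2 fun _ _ h => CatAlg.ofHom_apply_ne _ fun h' => h (h'.1.symm.trans h'.2)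

/-- A primitive idempotent in the degree zero subalgebra. -/
def zeroElt (l : E.Index) : degreeZero G.part := ⟨E.elt l, E.elt_mem G l⟩

theorem elt_apply_self (l : E.Index) : E.elt l l.1 l.1 = l.2.1 := CatAlg.ofHom_apply_self _

theorem idem_mul_self (l : E.Index) : (l.2.1 : l.1 ⟶ l.1) ≫ l.2.1 = l.2.1 :=
  (E.primitive l.1 l.2.1 l.2.2).1

theorem elt_mul_self (l : E.Index) : E.elt l * E.elt l = E.elt l := by
  ext x y
  by_cases hx : l.1 = x
  · subst hx
    rw [elt, CatAlg.mul_ofHom_apply]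
    by_cases hy : l.1 = y
    · subst hy
      rw [CatAlg.ofHom_apply_self]
      exact E.idem_mul_self l
    · rw [CatAlg.ofHom_apply_ne _ (fun h => hy h.2), Limits.comp_zero]
  · rw [elt, CatAlg.mul_ofHom_apply_ne _ _ _ hx, CatAlg.ofHom_apply_ne _ fun h => hx h.1]

theorem sum_elt : ∑ l, E.elt l = 1 := by
  have h : ∑ l, E.elt l = ∑ x : C, ∑ e : {e : End x // e ∈ E.idem x},
      CatAlg.ofHom (e.1 : x ⟶ x) :=
    Fintype.sum_sigma (fun l : (Σ x : C, {e : End x // e ∈ E.idem x}) =>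
      CatAlg.ofHom (l.2.1 : l.1 ⟶ l.1))
  rw [h]
  ext x y
  rw [CatAlg.sum_apply, CatAlg.one_apply]
  simp only [CatAlg.sum_apply]
  split_ifs with hxy
  · subst hxy
    rw [Finset.sum_eq_single x]
    · simp only [CatAlg.ofHom_apply_self]
      rw [eqToHom_refl]
      exact (Finset.sum_coe_sort (E.idem x) fun e => e).trans (E.sum_eq_one x)
    · intro z _ hz
      exact Finset.sum_eq_zero fun e _ => CatAlg.ofHom_apply_ne _ fun h => hz h.1
    · simp
  · refine Finset.sum_eq_zero fun z _ => Finset.sum_eq_zero fun e _ => ?_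
    exact CatAlg.ofHom_apply_ne _ fun h => hxy (h.1.symm.trans h.2)

theorem sum_zeroElt : ∑ l, E.zeroElt G l = 1 := by
  refine Subtype.ext ?_
  rw [AddSubmonoidClass.coe_finsetSum]
  exact E.sum_elt

/-- A summand `c` of `e_l` in `A₀` satisfies `c e_l = c`, so it is determined by its diagonal entry
at `l.1`, where primitivity in the endomorphism ring applies. -/
theorem isPrimitiveIdempotent_zeroElt (l : E.Index) : IsPrimitiveIdempotent (E.zeroElt G l) := by
  refine ⟨Subtype.ext (E.elt_mul_self l), fun h => (E.primitive l.1 l.2.1 l.2.2).2.1 ?_, ?_⟩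
  · have h1 : E.elt l = 0 := congrArg Subtype.val h
    rw [← E.elt_apply_self l, h1]
    rfl
  · intro a b ha hb hab hba hsum
    have hxx : ∀ c d : degreeZero G.part, (c * d).1 l.1 l.1 =
        d.1 l.1 l.1 ≫ c.1 l.1 l.1 := fun c d =>
      G.mul_apply_self d.1 c.2 l.1
    have key : ∀ c : degreeZero G.part, c * E.zeroElt G l = c → c.1 l.1 l.1 = 0 → c = 0 := by
      intro c hc h0
      refine Subtype.ext (CatAlg.ext fun x y => ?_)
      rw [← hc]
      change (c.1 * E.elt l) x y = 0
      by_cases hx : l.1 = x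
      · subst hx
        rw [elt, CatAlg.mul_ofHom_apply]
        by_cases hy : l.1 = y
        · subst hy
          rw [h0, Limits.comp_zero]
        · rw [G.mem_part_zero_iff.1 c.2 _ _ hy, Limits.comp_zero]
      · rw [elt, CatAlg.mul_ofHom_apply_ne _ _ _ hx]
    have ha' : a * E.zeroElt G l = a := by rw [← hsum, mul_add, hab, add_zero, ha.eq]
    have hb' : b * E.zeroElt G l = b := by rw [← hsum, mul_add, hba, zero_add, hb.eq]
    refine ((E.primitive l.1 l.2.1 l.2.2).2.2 (a.1 l.1 l.1) (b.1 l.1 l.1) ?_ ?_ ?_ ?_ ?_).imp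
      (key a ha') (key b hb')
    · exact (hxx a a).symm.trans (congrArg (fun c : degreeZero G.part => c.1 l.1 l.1) ha)
    · exact (hxx b b).symm.trans (congrArg (fun c : degreeZero G.part => c.1 l.1 l.1) hb)
    · exact (hxx a b).symm.trans (congrArg (fun c : degreeZero G.part => c.1 l.1 l.1) hab)
    · exact (hxx b a).symm.trans (congrArg (fun c : degreeZero G.part => c.1 l.1 l.1) hba)
    · exact (congrArg (fun c : degreeZero G.part => c.1 l.1 l.1) hsum).trans (E.elt_apply_self l)

theorem mem_proj_iff {l : E.Index} {a : CatAlg C} : a ∈ E.proj l ↔ a * E.elt l = a := by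
  constructor
  · intro h
    obtain ⟨b, rfl⟩ := Submodule.mem_span_singleton.1 h
    change b * E.elt l * E.elt l = b * E.elt l
    rw [mul_assoc, E.elt_mul_self]
  · intro h
    exact Submodule.mem_span_singleton.2 ⟨a, h⟩

theorem mul_elt_mem (a : CatAlg C) (l : E.Index) : a * E.elt l ∈ E.proj l :=
  Submodule.mem_span_singleton.2 ⟨a, rfl⟩

theorem apply_eq_zero_of_mem_proj {l : E.Index} {a : CatAlg C} (ha : a ∈ E.proj l) {x : C}
    (hx : l.1 ≠ x) (y : C) : a x y = 0 := by
  rw [← E.mem_proj_iff.1 ha]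
  exact CatAlg.mul_ofHom_apply_ne _ _ _ hx

/-- The elements of positive degree in an indecomposable projective module. -/
def posPart (l : E.Index) : Submodule (CatAlg C) (E.proj l) :=
  Submodule.comap (E.proj l).subtype (positiveIdeal G.part)

/-- The submodule defining a standard module consists of the elements of positive degree. -/
theorem iSup_trace_eq {le : C → C → Prop} [IsPartialOrder C le] (hdir : DirectedWrt le)
    (l : E.Index) : (⨆ (m : E.Index) (_ : ¬ E.preceq le m l),
      traceSubmodule (CatAlg C) (E.proj m) (E.proj l)) =
      E.posPart G l := by
  apply le_antisymm
  · refine iSup₂_le fun m hm => iSup_le fun f => ?_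
    rintro _ ⟨⟨y, hy⟩, rfl⟩
    -- An image is `y e_m f(e_m)`; its diagonal entry at `l.1` passes through a morphism from `m.1`
    -- to `l.1`, which is zero because `m ⋠ l`.
    let ee : E.proj m := ⟨E.elt m, E.mem_proj_iff.2 (E.elt_mul_self m)⟩
    have h1 : (⟨y, hy⟩ : E.proj m) = y • E.elt m • ee := by
      refine Subtype.ext ?_
      change y = y * (E.elt m * E.elt m)
      rw [E.elt_mul_self, E.mem_proj_iff.1 hy]
    rw [h1, map_smul, map_smul]
    change y * (E.elt m * (f ee).1) ∈ positiveIdeal G.part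
    rw [G.mem_positiveIdeal_iff_apply]
    intro x
    by_cases hx : l.1 = x
    · subst hx
      rw [CatAlg.mul_apply]
      refine Finset.sum_eq_zero fun z _ => ?_
      by_cases hz : m.1 = z
      · subst hz
        have : y m.1 l.1 = 0 := by
          by_contra h0
          exact hm (hdir _ _ _ h0)
        rw [this, Limits.comp_zero]
      · rw [elt, CatAlg.ofHom_mul_apply_ne _ _ _ hz, Limits.zero_comp]
    · exact E.apply_eq_zero_of_mem_proj
        ((E.proj l).smul_mem y ((E.proj l).smul_mem (E.elt m) (f ee).2)) hx x
  · rintro ⟨p, hp⟩ hpJ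
    have hpJ : ∀ x, p x x = 0 := G.mem_positiveIdeal_iff_apply.1 hpJ
    -- If `m ⋠ l`, then `e_m p` lies in the trace of `P_m`. If `m ≼ l`, a nonzero entry from `l.1`
    -- to `m.1` would force equality by antisymmetry, and diagonal entries of `p` vanish.
    have h1 : (⟨p, hp⟩ : E.proj l) = ∑ m, E.elt m • (⟨p, hp⟩ : E.proj l) := by
      rw [← Finset.sum_smul, E.sum_elt, one_smul]
    rw [h1]
    refine sum_mem fun m _ => ?_
    by_cases hm : E.preceq le m l
    · have h0 : E.elt m • (⟨p, hp⟩ : E.proj l) = 0 := by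
        refine Subtype.ext (CatAlg.ext fun x y => ?_)
        change (E.elt m * p) x y = 0
        by_cases hy : m.1 = y
        · subst hy
          rw [elt, CatAlg.ofHom_mul_apply]
          by_cases hx : l.1 = x
          · have h2 : p x m.1 = 0 := by
              by_contra h0
              have hxm : x = m.1 := antisymm (r := le) (hdir _ _ _ h0) (hx ▸ hm)
              exact h0 (hxm ▸ hpJ x)
            rw [h2, Limits.zero_comp]
          · rw [E.apply_eq_zero_of_mem_proj hp hx, Limits.zero_comp]
        · exact CatAlg.ofHom_mul_apply_ne _ _ _ hy
      rw [h0]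
      exact zero_mem _
    · refine (le_iSup₂ (f := fun (m : E.Index) (_ : ¬ E.preceq le m l) =>
        traceSubmodule (CatAlg C) (E.proj m) (E.proj l)) m hm) ?_
      refine Submodule.mem_iSup_of_mem ((LinearMap.toSpanSingleton (CatAlg C) (E.proj l) ⟨p, hp⟩).comp
        (E.proj m).subtype) ⟨⟨E.elt m, E.mem_proj_iff.2 (E.elt_mul_self m)⟩, rfl⟩

/-- The standard module is the quotient of the projective by its elements of positive degree. -/
def standardEquiv {le : C → C → Prop} [IsPartialOrder C le] (hdir : DirectedWrt le)
    (l : E.Index) : E.Standard le l ≃ₗ[CatAlg C]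
      (E.proj l ⧸ E.posPart G l) :=
  Submodule.quotEquivOfEq _ _ (E.iSup_trace_eq G hdir l)

/-- Right multiplication by `e_l` makes this quotient a retract of `A / J ≅ A₀`. -/
theorem projective_quotient (l : E.Index) : Module.Projective (degreeZero G.part)
    (E.proj l ⧸ E.posPart G l) := by
  let i : (E.proj l ⧸ E.posPart G l) →ₗ[CatAlg C]
      ZeroModule G.part := Submodule.mapQ _ _ (E.proj l).subtype le_rfl
  let r : CatAlg C →ₗ[CatAlg C] E.proj l := LinearMap.toSpanSingleton (CatAlg C) (E.proj l)
    ⟨E.elt l, E.mem_proj_iff.2 (E.elt_mul_self l)⟩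
  let s : ZeroModule G.part →ₗ[CatAlg C]
      (E.proj l ⧸ E.posPart G l) :=
    Submodule.mapQ _ _ r fun a ha => mul_mem_positiveIdeal G.part ha _
  have : Module.Projective (degreeZero G.part) (ZeroModule G.part) :=
    Module.Projective.of_equiv' (zeroModuleEquiv G.part)
  refine Module.Projective.of_split (i.restrictScalars (degreeZero G.part))
    (s.restrictScalars (degreeZero G.part)) (LinearMap.ext fun z => ?_)
  obtain ⟨⟨a, ha⟩, rfl⟩ := Submodule.Quotient.mk_surjective _ z
  change Submodule.Quotient.mk (r a) = _
  congr 1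
  exact Subtype.ext (E.mem_proj_iff.1 ha)

theorem projective_catAlg (h : ∀ l, Module.Projective (degreeZero G.part) (E.proj l)) :
    Module.Projective (degreeZero G.part) (CatAlg C) := by
  classical
  let i : CatAlg C →ₗ[degreeZero G.part] (Π₀ l, E.proj l) :=
    (DFinsupp.linearEquivFunOnFintype (R := degreeZero G.part)).symm.toLinearMap.comp <|
      LinearMap.pi fun l => (LinearMap.toSpanSingleton (CatAlg C) (E.proj l)
        ⟨E.elt l, E.mem_proj_iff.2 (E.elt_mul_self l)⟩).restrictScalars (degreeZero G.part)
  let s : (Π₀ l, E.proj l) →ₗ[degreeZero G.part] CatAlg C :=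
    (∑ l, ((E.proj l).subtype.restrictScalars (degreeZero G.part)).comp (LinearMap.proj l)).comp
      (DFinsupp.linearEquivFunOnFintype (R := degreeZero G.part)).toLinearMap
  refine Module.Projective.of_split i s (LinearMap.ext fun a => ?_)
  change (∑ l, ((E.proj l).subtype.restrictScalars (degreeZero G.part)).comp (LinearMap.proj l) :
    (∀ l, E.proj l) →ₗ[degreeZero G.part] CatAlg C) _ = a
  rw [LinearMap.sum_apply]
  change ∑ l, a * E.elt l = a
  rw [← Finset.mul_sum, E.sum_elt, mul_one]

end PrimitiveSystem

theorem projective_of_projective_ker {R : Type*} [Ring R] {X Y : Type*} [AddCommGroup X]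
    [Module R X] [AddCommGroup Y] [Module R Y] (f : X →ₗ[R] Y) (hf : Function.Surjective f)
    [Module.Projective R (LinearMap.ker f)] [Module.Projective R Y] : Module.Projective R X := by
  obtain ⟨s, hs⟩ := Module.projective_lifting_property f LinearMap.id hf
  have h : ∀ x, (LinearMap.id - s.comp f : X →ₗ[R] X) x ∈ LinearMap.ker f := fun x => by
    have := LinearMap.congr_fun hs (f x)
    simp only [LinearMap.comp_apply, LinearMap.id_apply] at this
    simp [this]
  refine Module.Projective.of_split (M := LinearMap.ker f × Y)
    (((LinearMap.id - s.comp f).codRestrict (LinearMap.ker f) h).prod f)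
    ((LinearMap.ker f).subtype.coprod s) (LinearMap.ext fun x => ?_)
  simp

theorem projective_of_submoduleOf {A : Type*} [Ring A] [Algebra k A] (R : Subalgebra k A)
    {X : Type*} [AddCommGroup X] [Module A X] {N N' : Submodule A X} (hle : N ≤ N')
    [Module.Projective R N] [Module.Projective R (N' ⧸ N.submoduleOf N')] :
    Module.Projective R N' := by
  let q : N' →ₗ[R] (N' ⧸ N.submoduleOf N') := (N.submoduleOf N').mkQ.restrictScalars R
  have hq : ∀ x : N', q x = 0 ↔ (x : X) ∈ N := fun x =>
    Submodule.Quotient.mk_eq_zero (N.submoduleOf N')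
  let t : N ≃ₗ[R] LinearMap.ker q :=
    { toFun := fun x => ⟨⟨x, hle x.2⟩, (hq _).2 x.2⟩
      invFun := fun x => ⟨x.1.1, (hq _).1 x.2⟩
      map_add' := fun _ _ => rfl
      map_smul' := fun _ _ => rfl
      left_inv := fun _ => rfl
      right_inv := fun _ => rfl }
  have h4 : Module.Projective R (LinearMap.ker q) := Module.Projective.of_equiv' t
  exact projective_of_projective_ker q (Submodule.mkQ_surjective (N.submoduleOf N'))

/-- Standard modules are projective over `A₀`, so projectivity climbs the filtration of each `P_l`.
-/
theorem IsStandardlyStratified.projective {E : PrimitiveSystem C} (G : CatGrading k C)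
    {le : C → C → Prop} [IsPartialOrder C le] (hdir : DirectedWrt le)
    (h : IsStandardlyStratified le E) : Module.Projective (degreeZero G.part) (CatAlg C) := by
  refine E.projective_catAlg G fun l => ?_
  obtain ⟨n, F, h0, hn, hle, hF⟩ := h l
  have key : ∀ i ≤ n, Module.Projective (degreeZero G.part) (F i) := by
    intro i
    induction i with
    | zero =>
      intro _
      rw [h0]
      infer_instance
    | succ i ih =>
      intro hi
      have h1 := ih (by omega)
      obtain ⟨m, ⟨e⟩⟩ := hF i (by omega)
      have h2 := E.projective_quotient G m
      have h3 : Module.Projective (degreeZero G.part)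
          (F (i + 1) ⧸ (F i).submoduleOf (F (i + 1))) :=
        Module.Projective.of_equiv'
          ((e.trans (E.standardEquiv G hdir m)).symm.restrictScalars (degreeZero G.part))
      exact projective_of_submoduleOf _ (hle i (by omega))
  have h5 := key n le_rfl
  rw [hn] at h5
  exact Module.Projective.of_equiv'
    ((Submodule.topEquiv (R := CatAlg C) (M := E.proj l)).restrictScalars (degreeZero G.part))

end CategoryAlgebra

/-! ### Constructing standard filtrations from the degree filtration -/

section StandardFiltrations

variable {k : Type w} [Field k] {C : Type u} [Category.{v} C] [Preadditive C] [Fintype C]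
  [Linear k C]

/-- Descent of a map which is only linear over a subalgebra to a quotient. -/
def liftRestrict {A : Type*} [Ring A] [Algebra k A] {R : Subalgebra k A} {X Y : Type*}
    [AddCommGroup X] [Module A X] [AddCommGroup Y] [Module R Y] (N : Submodule A X)
    (p : X →ₗ[R] Y) (hp : ∀ x ∈ N, p x = 0) : (X ⧸ N) →ₗ[R] Y where
  toFun z := Quotient.liftOn' z p fun x y hxy => by
    rw [Submodule.quotientRel_def] at hxy
    have := hp _ hxy
    rwa [map_sub, sub_eq_zero] at this
  map_add' := by
    rintro ⟨x⟩ ⟨y⟩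
    exact p.map_add x y
  map_smul' := by
    rintro r ⟨x⟩
    exact p.map_smul r x

/-- `N` has a finite filtration by submodules of `X` with standard successive quotients. -/
inductive StandardChain (E : PrimitiveSystem C) (le : C → C → Prop) {X : Type (max u v)}
    [AddCommGroup X] [Module (CatAlg C) X] : Submodule (CatAlg C) X → Prop
  | bot : StandardChain E le ⊥
  | step {N N' : Submodule (CatAlg C) X} (hle : N ≤ N') (l : E.Index)
      (e : (N' ⧸ N.submoduleOf N') ≃ₗ[CatAlg C] E.Standard le l) :
      StandardChain E le N → StandardChain E le N'

theorem StandardChain.exists_filtration {E : PrimitiveSystem C} {le : C → C → Prop}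
    {X : Type (max u v)} [AddCommGroup X] [Module (CatAlg C) X] {N : Submodule (CatAlg C) X}
    (h : StandardChain E le N) :
    ∃ (n : ℕ) (F : ℕ → Submodule (CatAlg C) X), F 0 = ⊥ ∧ F n = N ∧
      (∀ i < n, F i ≤ F (i + 1)) ∧
      ∀ i < n, ∃ l : E.Index,
        Nonempty ((F (i + 1) ⧸ (F i).submoduleOf (F (i + 1))) ≃ₗ[CatAlg C] E.Standard le l) := by
  induction h with
  | bot => exact ⟨0, fun _ => ⊥, rfl, rfl, fun _ _ => le_rfl, fun _ hi => absurd hi (by omega)⟩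
  | @step N N' hle l e _ ih =>
    obtain ⟨n, F, h0, hn, hF, hq⟩ := ih
    let F' : ℕ → Submodule (CatAlg C) X := fun i => if i ≤ n then F i else N'
    have h1 : ∀ i ≤ n, F' i = F i := fun i hi => if_pos hi
    have h2 : F' (n + 1) = N' := if_neg (by omega)
    refine ⟨n + 1, F', (h1 0 (by omega)).trans h0, h2, ?_, ?_⟩
    · intro i hi
      rcases Nat.lt_succ_iff_lt_or_eq.1 hi with hi | rfl
      · rw [h1 i hi.le, h1 (i + 1) hi]
        exact hF i hi
      · rw [h1 i le_rfl, h2, hn]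
        exact hle
    · intro i hi
      rcases Nat.lt_succ_iff_lt_or_eq.1 hi with hi | rfl
      · rw [h1 i hi.le, h1 (i + 1) hi]
        exact hq i hi
      · rw [h1 i le_rfl, h2, hn]
        exact ⟨l, ⟨e⟩⟩

variable (G : CatGrading k C) (E : PrimitiveSystem C)

namespace PrimitiveSystem

/-- Over the degree zero subalgebra, the standard module is generated by the idempotent. -/
def spanEquiv (l : E.Index) : Submodule.span (degreeZero G.part) {E.zeroElt G l}
    ≃ₗ[degreeZero G.part] (E.proj l ⧸ E.posPart G l) := by
  have hmem : ∀ r : Submodule.span (degreeZero G.part) {E.zeroElt G l},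
      (r : degreeZero G.part).1 ∈ E.proj l := by
    rintro ⟨r, hr⟩
    obtain ⟨a, rfl⟩ := Submodule.mem_span_singleton.1 hr
    exact E.mul_elt_mem a l
  let f : Submodule.span (degreeZero G.part) {E.zeroElt G l} →ₗ[degreeZero G.part]
      (E.proj l ⧸ E.posPart G l) :=
    { toFun := fun r => Submodule.Quotient.mk ⟨r.1.1, hmem r⟩
      map_add' := fun _ _ => rfl
      map_smul' := fun _ _ => rfl }
  refine LinearEquiv.ofBijective f ⟨?_, ?_⟩
  · rw [← LinearMap.ker_eq_bot, LinearMap.ker_eq_bot']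
    intro r hr
    have hr : r.1.1 ∈ positiveIdeal G.part :=
      (Submodule.Quotient.mk_eq_zero (E.posPart G l)).1 hr
    rw [mem_positiveIdeal_iff, DirectSum.decompose_of_mem_same G.part r.1.2] at hr
    exact Subtype.ext (Subtype.ext hr)
  · intro z
    obtain ⟨⟨a, ha⟩, rfl⟩ := Submodule.Quotient.mk_surjective _ z
    refine ⟨⟨zeroPart G.part a * E.zeroElt G l, Submodule.mem_span_singleton.2 ⟨_, rfl⟩⟩, ?_⟩
    refine ((Submodule.Quotient.eq (E.posPart G l)).2 ?_).symm
    change a - zeroPart G.part a * E.elt l ∈ positiveIdeal G.part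
    have h : a - zeroPart G.part a * E.elt l = (a - zeroPart G.part a) * E.elt l := by
      rw [sub_mul, E.mem_proj_iff.1 ha]
    rw [h]
    exact mul_mem_positiveIdeal G.part (sub_zeroPart_mem G.part a) _

theorem smul_quotient_eq_zero {a : CatAlg C} (ha : a ∈ positiveIdeal G.part) (l : E.Index)
    (z : E.proj l ⧸ E.posPart G l) : a • z = 0 := by
  obtain ⟨⟨b, hb⟩, rfl⟩ := Submodule.Quotient.mk_surjective _ z
  rw [← Submodule.Quotient.mk_smul, Submodule.Quotient.mk_eq_zero]
  exact mul_mem_positiveIdeal G.part ha b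

variable [∀ x y : C, FiniteDimensional k (x ⟶ y)]

/-- A nonzero module concentrated in degree zero and projective over the degree zero subalgebra
has a standard submodule with projective quotient. -/
theorem exists_standard_submodule {le : C → C → Prop} [IsPartialOrder C le]
    (hdir : DirectedWrt le) (Q : Type (max u v)) [AddCommGroup Q] [Module (CatAlg C) Q]
    [Nontrivial Q] [Module.Finite (degreeZero G.part) Q]
    [Module.Projective (degreeZero G.part) Q]
    (hQ : ∀ a ∈ positiveIdeal G.part, ∀ x : Q, a • x = 0) :
    ∃ (l : E.Index) (U : Submodule (CatAlg C) Q), U ≠ ⊥ ∧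
      Nonempty (U ≃ₗ[CatAlg C] E.Standard le l) ∧
      Module.Projective (degreeZero G.part) (Q ⧸ U) := by
  have : IsArtinianRing (degreeZero G.part) := IsArtinianRing.of_finite k _
  have : IsNoetherianRing (degreeZero G.part) := IsNoetherianRing.of_finite k _
  obtain ⟨l, α, β, hβα⟩ := exists_retract_of_projective (E.isPrimitiveIdempotent_zeroElt G)
    (E.sum_zeroElt G) Q
  have hβα' : ∀ x, β (α x) = x := fun x => LinearMap.congr_fun hβα x
  -- `J` kills both source and target, so an `A₀`-linear map between them is automatically
  -- `A`-linear.
  let γ : (E.proj l ⧸ E.posPart G l) →ₗ[CatAlg C] Q :=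
    extendLinear (α.comp (E.spanEquiv G l).symm.toLinearMap) fun a ha x => by
      rw [hQ a ha, E.smul_quotient_eq_zero G ha, map_zero]
  have hγ : ∀ x, γ x = α ((E.spanEquiv G l).symm x) := fun _ => rfl
  have hγi : Function.Injective γ := by
    intro x y hxy
    have := congrArg β hxy
    rw [hγ, hγ, hβα', hβα'] at this
    exact (E.spanEquiv G l).symm.injective this
  refine ⟨l, LinearMap.range γ, ?_, ⟨(LinearEquiv.ofInjective γ hγi).symm.trans
    (E.standardEquiv G hdir l).symm⟩, ?_⟩
  · intro h
    have h0 : γ = 0 := LinearMap.range_eq_bot.1 h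
    let e : Submodule.span (degreeZero G.part) {E.zeroElt G l} :=
      ⟨E.zeroElt G l, Submodule.mem_span_singleton_self _⟩
    have h1 : α e = 0 := by
      have := LinearMap.congr_fun h0 (E.spanEquiv G l e)
      rwa [hγ, LinearEquiv.symm_apply_apply] at this
    have h2 : e = 0 := by rw [← hβα' e, h1, map_zero]
    exact (E.isPrimitiveIdempotent_zeroElt G l).2.1 (congrArg Subtype.val h2)
  -- The complementary projection `id - α β` splits the quotient map over `A₀`.
  · let p : Q →ₗ[degreeZero G.part] Q := LinearMap.id - α.comp β
    have hp : ∀ x, p x = x - α (β x) := fun _ => rfl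
    have hker : ∀ x ∈ LinearMap.range γ, p x = 0 := by
      rintro _ ⟨y, rfl⟩
      rw [hp, hγ, hβα', sub_self]
    refine Module.Projective.of_split (liftRestrict (LinearMap.range γ) p hker)
      ((LinearMap.range γ).mkQ.restrictScalars (degreeZero G.part)) (LinearMap.ext fun z => ?_)
    obtain ⟨x, rfl⟩ := Submodule.Quotient.mk_surjective _ z
    change Submodule.Quotient.mk (x - α (β x)) = (Submodule.Quotient.mk x : Q ⧸ LinearMap.range γ)
    rw [Submodule.Quotient.eq, sub_sub_cancel_left]
    refine neg_mem ⟨E.spanEquiv G l (β x), ?_⟩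
    rw [hγ, LinearEquiv.symm_apply_apply]

end PrimitiveSystem

variable {E} in
-- Noetherian induction on growing `N`: one standard module is split off the layer `N' / N`, and its
-- preimage `N''` replaces `N`. The new layer is again killed by `J` and projective over `A₀`.
theorem StandardChain.extend [∀ x y : C, FiniteDimensional k (x ⟶ y)]
    {le : C → C → Prop} [IsPartialOrder C le]
    (hdir : DirectedWrt le) {X : Type (max u v)} [AddCommGroup X] [Module (CatAlg C) X]
    [Module k X] [IsScalarTower k (CatAlg C) X] [FiniteDimensional k X]
    {N' : Submodule (CatAlg C) X} (N : Submodule (CatAlg C) X) :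
    StandardChain E le N → N ≤ N' → (∀ a ∈ positiveIdeal G.part, ∀ x ∈ N', a • x ∈ N) →
    Module.Projective (degreeZero G.part) (N' ⧸ N.submoduleOf N') → StandardChain E le N' := by
  have hnoeth : IsNoetherian (CatAlg C) X := isNoetherian_of_tower k inferInstance
  induction N using WellFoundedGT.induction with
  | ind N ih =>
  intro hN hle hJ hproj
  rcases eq_or_ne N N' with rfl | hne
  · exact hN
  have hfin : Module.Finite k N' := Module.Finite.of_injective
    (N'.subtype.restrictScalars k) (Submodule.injective_subtype _)
  have hfin1 : Module.Finite k (N' ⧸ N.submoduleOf N') := Module.Finite.of_surjective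
    ((N.submoduleOf N').mkQ.restrictScalars k) (Submodule.mkQ_surjective (N.submoduleOf N'))
  have hfin2 : Module.Finite (degreeZero G.part) (N' ⧸ N.submoduleOf N') :=
    Module.Finite.of_restrictScalars_finite k _ _
  have hnt : Nontrivial (N' ⧸ N.submoduleOf N') := by
    rw [Submodule.Quotient.nontrivial_iff]
    intro h
    refine hne (le_antisymm hle fun x hx => ?_)
    have : (⟨x, hx⟩ : N') ∈ N.submoduleOf N' := h ▸ trivial
    exact this
  obtain ⟨l, U, hU, ⟨e⟩, hQU⟩ := E.exists_standard_submodule G hdir (N' ⧸ N.submoduleOf N')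
    (by
      rintro a ha x
      obtain ⟨x, rfl⟩ := Submodule.Quotient.mk_surjective _ x
      rw [← Submodule.Quotient.mk_smul, Submodule.Quotient.mk_eq_zero]
      exact hJ a ha x x.2)
  let N'' : Submodule (CatAlg C) X := (U.comap (N.submoduleOf N').mkQ).map N'.subtype
  have hmem : ∀ x : N', (x : X) ∈ N'' ↔ (N.submoduleOf N').mkQ x ∈ U := fun x => by
    constructor
    · rintro ⟨y, hy, hyx⟩
      rwa [Subtype.ext hyx] at hy
    · exact fun h => ⟨x, h, rfl⟩
  have h1 : N'' ≤ N' := Submodule.map_subtype_le _ _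
  have hmk : ∀ x : N', (N.submoduleOf N').mkQ x = 0 ↔ (x : X) ∈ N := fun x =>
    Submodule.Quotient.mk_eq_zero _
  have h2 : N ≤ N'' := fun x hx => (hmem ⟨x, hle hx⟩).2 (by
    rw [(hmk ⟨x, hle hx⟩).2 hx]
    exact zero_mem _)
  have h3 : N < N'' := by
    refine lt_of_le_of_ne h2 fun h => hU ?_
    rw [eq_bot_iff]
    intro z hz
    obtain ⟨x, rfl⟩ := (N.submoduleOf N').mkQ_surjective z
    rw [Submodule.mem_bot, hmk, h]
    exact (hmem x).2 hz
  let f : N'' →ₗ[CatAlg C] U := ((N.submoduleOf N').mkQ.comp (Submodule.inclusion h1)).codRestrict U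
    fun x => (hmem ⟨x, h1 x.2⟩).1 x.2
  have hf : Function.Surjective f := by
    rintro ⟨z, hz⟩
    obtain ⟨x, rfl⟩ := (N.submoduleOf N').mkQ_surjective z
    exact ⟨⟨x, (hmem x).2 hz⟩, rfl⟩
  have hfk : N.submoduleOf N'' = LinearMap.ker f := by
    ext x
    rw [LinearMap.mem_ker, ← Submodule.coe_eq_zero]
    exact (hmk ⟨x, h1 x.2⟩).symm
  let g : N' →ₗ[CatAlg C] ((N' ⧸ N.submoduleOf N') ⧸ U) := U.mkQ.comp (N.submoduleOf N').mkQ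
  have hg : Function.Surjective g := U.mkQ_surjective.comp (N.submoduleOf N').mkQ_surjective
  have hgk : N''.submoduleOf N' = LinearMap.ker g := by
    ext x
    rw [LinearMap.mem_ker]
    exact (hmem x).trans (Submodule.Quotient.mk_eq_zero U).symm
  have hchain : StandardChain E le N'' := StandardChain.step h2 l
    (((Submodule.quotEquivOfEq _ _ hfk).trans (f.quotKerEquivOfSurjective hf)).trans e) hN
  refine ih N'' h3 hchain h1 (fun a ha x hx => h2 (hJ a ha x hx)) ?_
  exact Module.Projective.of_equiv' (((Submodule.quotEquivOfEq _ _ hgk).trans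
    (g.quotKerEquivOfSurjective hg)).symm.restrictScalars (degreeZero G.part))

section Tails

variable {A : Type*} [Ring A] [Algebra k A] (𝒜 : ℕ → Submodule k A) [GradedAlgebra 𝒜]

/-- The left ideal of elements of degree at least `j`. -/
def tailIdeal (j : ℕ) : Ideal A where
  carrier := {a | ∀ i < j, (DirectSum.decompose 𝒜 a i : A) = 0}
  add_mem' ha hb i hi := by
    rw [DirectSum.decompose_add, DirectSum.add_apply, Submodule.coe_add, ha i hi, hb i hi, add_zero]
  zero_mem' i _ := by rw [DirectSum.decompose_zero]; rfl
  smul_mem' c a ha i hi := by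
    rw [smul_eq_mul]
    induction c using DirectSum.Decomposition.inductionOn 𝒜 with
    | zero => rw [zero_mul, DirectSum.decompose_zero]; rfl
    | @homogeneous t c =>
      rw [DirectSum.coe_decompose_mul_of_left_mem 𝒜 i c.2]
      split_ifs
      · rw [ha _ (by omega), mul_zero]
      · rfl
    | add c d hc hd =>
      rw [add_mul, DirectSum.decompose_add, DirectSum.add_apply, Submodule.coe_add, hc, hd, add_zero]

theorem mul_mem_tailIdeal_succ {j : ℕ} {a b : A} (ha : a ∈ positiveIdeal 𝒜)
    (hb : b ∈ tailIdeal 𝒜 j) : a * b ∈ tailIdeal 𝒜 (j + 1) := by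
  -- As `b` starts in degree `j`, only the degree zero part of `c` contributes to degrees up to `j`.
  have key : ∀ c : A, ∀ i ≤ j, (DirectSum.decompose 𝒜 (c * b) i : A) =
      DirectSum.decompose 𝒜 c 0 * DirectSum.decompose 𝒜 b i := by
    intro c i hi
    induction c using DirectSum.Decomposition.inductionOn 𝒜 with
    | zero => simp
    | @homogeneous t c =>
      rcases Nat.eq_zero_or_pos t with rfl | ht
      · rw [DirectSum.coe_decompose_mul_of_left_mem_zero 𝒜 c.2,
          DirectSum.decompose_of_mem_same 𝒜 c.2]
      · rw [DirectSum.coe_decompose_mul_of_left_mem 𝒜 i c.2,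
          DirectSum.decompose_of_mem_ne 𝒜 c.2 (by omega), zero_mul]
        split_ifs
        · rw [hb _ (by omega), mul_zero]
        · rfl
    | add c d hc hd =>
      rw [add_mul, DirectSum.decompose_add, DirectSum.add_apply, Submodule.coe_add, hc, hd,
        DirectSum.decompose_add, DirectSum.add_apply, Submodule.coe_add, add_mul]
  intro i hi
  rw [key a i (by omega), mem_positiveIdeal_iff.1 ha, zero_mul]

theorem exists_tailIdeal_eq_bot [FiniteDimensional k A] : ∃ n, tailIdeal 𝒜 n = ⊥ := by
  have hfin : {i | 𝒜 i ≠ ⊥}.Finite := WellFoundedGT.finite_ne_bot_of_iSupIndep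
    (DirectSum.Decomposition.isInternal 𝒜).submodule_iSupIndep
  obtain ⟨n, hn⟩ := hfin.bddAbove
  refine ⟨n + 1, eq_bot_iff.2 fun a ha => ?_⟩
  rw [Submodule.mem_bot]
  apply (DirectSum.decompose 𝒜).injective
  rw [DirectSum.decompose_zero]
  refine DFinsupp.ext fun i => Subtype.ext ?_
  by_cases hi : i < n + 1
  · exact ha i hi
  · have : 𝒜 i = ⊥ := by
      by_contra h
      have := hn h
      omega
    exact (Submodule.mem_bot k).1 (this.le (DirectSum.decompose 𝒜 a i).2)

end Tails

variable {E} in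
-- Each layer of the degree filtration of `P_l` is `A_j e_l`, an `A₀`-direct summand of `A`, so
-- `StandardChain.extend` refines it.
theorem isStandardlyStratified_of_projective [∀ x y : C, FiniteDimensional k (x ⟶ y)]
    {le : C → C → Prop} [IsPartialOrder C le] (hdir : DirectedWrt le)
    [Module.Projective (degreeZero G.part) (CatAlg C)] : IsStandardlyStratified le E := by
  intro l
  let T : ℕ → Submodule (CatAlg C) (E.proj l) := fun j =>
    Submodule.comap (E.proj l).subtype (tailIdeal G.part j)
  have hfd : FiniteDimensional k (E.proj l) := Module.Finite.of_injective
    ((E.proj l).subtype.restrictScalars k) (Submodule.injective_subtype _)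
  have hdec : ∀ p : E.proj l, ∀ j, (DirectSum.decompose G.part p.1 j : CatAlg C) * E.elt l =
      DirectSum.decompose G.part p.1 j := by
    intro p j
    rw [← DirectSum.coe_decompose_mul_of_right_mem_zero G.part (E.elt_mem G l),
      E.mem_proj_iff.1 p.2]
  have hstep : ∀ j, StandardChain E le (T (j + 1)) → StandardChain E le (T j) := by
    intro j hj
    refine hj.extend G hdir (T (j + 1)) (fun p hp i hi => hp i (by omega))
      (fun a ha p hp => mul_mem_tailIdeal_succ G.part ha hp) ?_
    let i : T j →ₗ[degreeZero G.part] CatAlg C :=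
      { toFun := fun p => DirectSum.decompose G.part p.1.1 j
        map_add' := fun p q => by
          change (DirectSum.decompose G.part (p.1.1 + q.1.1) j : CatAlg C) = _
          rw [DirectSum.decompose_add, DirectSum.add_apply, Submodule.coe_add]
        map_smul' := fun r p => DirectSum.coe_decompose_mul_of_left_mem_zero G.part r.2 }
    have hmem : ∀ a : CatAlg C, (DirectSum.decompose G.part a j : CatAlg C) * E.elt l ∈ G.part j :=
      fun a => SetLike.mul_mem_graded (SetLike.coe_mem _) (E.elt_mem G l)
    let s : CatAlg C →ₗ[degreeZero G.part] T j :=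
      { toFun := fun a => ⟨⟨(DirectSum.decompose G.part a j : CatAlg C) * E.elt l,
          E.mul_elt_mem _ l⟩, fun i hi =>
            DirectSum.decompose_of_mem_ne G.part (hmem a) (by omega)⟩
        map_add' := fun a b => Subtype.ext (Subtype.ext (by
          change (DirectSum.decompose G.part (a + b) j : CatAlg C) * E.elt l = _ + _
          rw [DirectSum.decompose_add, DirectSum.add_apply, Submodule.coe_add, add_mul]))
        map_smul' := fun r a => Subtype.ext (Subtype.ext (by
          change (DirectSum.decompose G.part (r.1 * a) j : CatAlg C) * E.elt l = r.1 * (_ * _)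
          rw [DirectSum.coe_decompose_mul_of_left_mem_zero G.part r.2, mul_assoc])) }
    -- The layer embeds in `A` by taking the degree `j` component; taking that component and
    -- multiplying by `e_l` on the right is a retraction.
    refine Module.Projective.of_split
      (liftRestrict ((T (j + 1)).submoduleOf (T j)) i fun p hp => hp j (by omega))
      ((((T (j + 1)).submoduleOf (T j)).mkQ.restrictScalars (degreeZero G.part)).comp s)
      (LinearMap.ext fun z => ?_)
    obtain ⟨p, rfl⟩ := Submodule.Quotient.mk_surjective _ z
    refine (Submodule.Quotient.eq ((T (j + 1)).submoduleOf (T j))).2 fun t ht => ?_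
    change (DirectSum.decompose G.part
      ((DirectSum.decompose G.part (DirectSum.decompose G.part p.1.1 j : CatAlg C) j : CatAlg C) *
        E.elt l - p.1.1) t : CatAlg C) = 0
    rw [DirectSum.decompose_of_mem_same G.part
        (SetLike.coe_mem (DirectSum.decompose G.part p.1.1 j)),
      hdec, DirectSum.decompose_sub, DirectSum.sub_apply, Submodule.coe_sub, sub_eq_zero]
    rcases Nat.lt_succ_iff_lt_or_eq.1 ht with ht | rfl
    · rw [DirectSum.decompose_of_mem_ne G.part (SetLike.coe_mem _) (by omega)]
      exact (p.2 t ht).symm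
    · exact DirectSum.decompose_of_mem_same G.part (SetLike.coe_mem _)
  obtain ⟨n, hn⟩ := exists_tailIdeal_eq_bot G.part
  have hTn : T n = ⊥ := by
    refine eq_bot_iff.2 fun p hp => Subtype.ext ?_
    have : p.1 ∈ tailIdeal G.part n := hp
    rwa [hn] at this
  -- The chain grows as the degree bound drops, from `T n = ⊥` to `T 0 = ⊤`.
  have key : ∀ m ≤ n, StandardChain E le (T (n - m)) := by
    intro m
    induction m with
    | zero =>
      intro _
      rw [Nat.sub_zero, hTn]
      exact .bot
    | succ m ih =>
      intro hm
      apply hstep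
      rw [show n - (m + 1) + 1 = n - m by omega]
      exact ih (by omega)
  have h0 := key n le_rfl
  have hT0 : T (n - n) = ⊤ := by
    rw [Nat.sub_self]
    exact eq_top_iff.2 fun p _ i hi => absurd hi (by omega)
  rw [hT0] at h0
  exact h0.exists_filtration

end StandardFiltrations

end KoszulStrat

end

theorem theorem5p8
    {k : Type w} [Field k] [IsAlgClosed k]
    {C : Type u} [Category.{v} C] [Preadditive C] [Linear k C] [Fintype C]
    [∀ x y : C, FiniteDimensional k (x ⟶ y)]
    (le : C → C → Prop) [IsPartialOrder C le] (hdir : KoszulStrat.DirectedWrt le)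
    (G : KoszulStrat.CatGrading k C)
    (hself : Module.Injective (KoszulStrat.degreeZero G.part) (KoszulStrat.degreeZero G.part))
    (E : KoszulStrat.PrimitiveSystem C) :
    (KoszulStrat.IsStandardlyStratified le E ↔
      Module.Projective (KoszulStrat.degreeZero G.part) (KoszulStrat.CatAlg C)) ∧
    (KoszulStrat.IsKoszulAlgebra G.part ↔
      KoszulStrat.IsStandardlyStratified le E ∧ KoszulStrat.IsQuasiKoszulAlgebra G.part) ∧
    (KoszulStrat.IsStandardlyStratified le E →
      ∀ M : KoszulStrat.GrMod G.part, KoszulStrat.GeneratedInDegree M 0 →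
        (KoszulStrat.IsKoszulModule M ↔
          KoszulStrat.IsQuasiKoszulModule G.part M ∧
            Module.Projective (KoszulStrat.degreeZero G.part) M)) := by
  have hart : IsArtinianRing (KoszulStrat.degreeZero G.part) := IsArtinianRing.of_finite k _
  have hnoeth : IsNoetherianRing (KoszulStrat.degreeZero G.part) := IsNoetherianRing.of_finite k _
  have hmul : ∀ i j, G.part i * G.part j = G.part (i + j) := G.mul_eq
  have hstrat : KoszulStrat.IsStandardlyStratified le E ↔
      Module.Projective (KoszulStrat.degreeZero G.part) (KoszulStrat.CatAlg C) :=
    ⟨fun h => h.projective G hdir, fun h =>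
      KoszulStrat.isStandardlyStratified_of_projective G hdir⟩
  refine ⟨hstrat, ?_, fun h M hM => ?_⟩
  · rw [hstrat]
    exact KoszulStrat.isKoszulAlgebra_iff hmul fun hx =>
      KoszulStrat.exists_linearMap_apply_ne_zero (E.isPrimitiveIdempotent_zeroElt G)
        (E.sum_zeroElt G) hx
  · have := hstrat.1 h
    exact KoszulStrat.isKoszulModule_iff hmul (fun hx =>
      KoszulStrat.exists_linearMap_apply_ne_zero (E.isPrimitiveIdempotent_zeroElt G)
        (E.sum_zeroElt G) hx) hM
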